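/- **Setting.** Pointers are either control ($\textsc{cptr}$) or data ($\textsc{dptr}$) pointers, and a predicate $is\_rdesc$ singles out the pointers that store RDCSS descriptors. Memory words are a unit value $tt$, client data, and pointers; $\textsc{Val}$ is the set of words that do not satisfy $is\_rdesc$. A descriptor $desc$ has fields $pt_1:\textsc{cptr}$, $pt_2:\textsc{dptr}$, $exp_1,exp_2,new_2\in\textsc{Val}$. The primitives are dereference $!p$, $CAS(p,e,n)$ (outputs the old value), $p:=v$, and $Alloc$ (returns a fresh pointer of the requested kind, satisfying $is\_rdesc$ iff a descriptor is stored). The RDCSS implementation consists of the procedures (labels of code lines in brackets) - $rdcss(desc)$: [A] $d\gets Alloc(desc)$ as $\textsc{dptr}$; return $loop(d,desc)$. - $loop(d,desc)$: [B] $old\gets CAS(desc.pt_2,desc.exp_2,d)$; if $is\_rdesc(old)$ then $complete(old)$ and return $loop(d,desc)$; otherwise, if $old=desc.exp_2$ then $complete(d)$; return $old$. - $complete(d)$: $desc\gets{!d}$; [R] $x\gets{!desc.pt_1}$; if $x=desc.exp_1$ then [S] $CAS(desc.pt_2,d,desc.new_2)$, else [U] $CAS(desc.pt_2,d,desc.exp_2)$.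 - $rread(p)$: [C] $old\gets{!p}$; if $is\_rdesc(old)$ then $complete(old)$ and return $rread(p)$, else return $old$. $rCAS(p,e,n)$: the same with [D] $old\gets CAS(p,e,n)$. - $rwrite(p,v)$: [E] $old\gets{!p}$; if $is\_rdesc(old)$ then $complete(old)$ and $rwrite(p,v)$; else [F] $x\gets CAS(p,old,v)$ and, if $x\ne old$, $rwrite(p,v)$. - on control pointers $rread\text{-}c(p)$: [G] return $!p$; $rCAS\text{-}c(p,e,n)$: [H] return $CAS(p,e,n)$; $rwrite\text{-}c(p,v)$: [I] $p:=v$. $ralloc(v,k)$: return $Alloc(v)$ as $\textsc{cptr}$ [J] or as $\textsc{dptr}$ [K], according to $k$. The exported procedures are all of these except $loop$ and $complete$. An execution history consists of a set $\textsc{Ev}$ of invocations (events) of exported procedures by threads, each thread executing one event at a time, and of the rep events, i.e. the executions of code lines that call a primitive. Events and rep events have start times and, once finished, end times and outputs; rep events need not be atomic. We are given a linearization $\le^R$ of the rep events: a finite linear order on a set $[\le^R]$ of rep events that contains all finished ones, respects real time, and is sequentially sound for the primitives from the empty heap (with the actual outputs for finished rep events). Value inputs of events are in $\textsc{Val}$;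 pointer inputs have the declared kind and were output by a $ralloc$ event that terminated before the event started. $T$ is the set of terminated events; $x\sqsubset y$ means that $x$ terminated before $y$ started. **Specification.** Write $\textsc{writer}(x,p,v)$ if $x$ attempts to write $v$ into $p$: $x=rdcss(d)$ with $p=d.pt_2$, $v=d.new_2$; or $x=ralloc(v,\_)\in T$ with output $p$; or $x$ is one of $rCAS(p,\_,v)$, $rwrite(p,v)$, $rCAS\text{-}c(p,\_,v)$, $rwrite\text{-}c(p,v)$. For relations $\lessdot_p,\ltimes_p$ on $\textsc{Ev}$, the RDCSS specification $V_R(\lessdot_p,\ltimes_p)=(W_p,A_p,Q)$ is: $x\in A_p$ iff $x$ is a terminated $ralloc$ with output $p$. - $x\in W_p$ iff: ($rdcss(d)$) $p=d.pt_2$ and there are $z_1\lessdot_{d.pt_1}x$, $z_2\lessdot_{d.pt_2}x$ with $\textsc{writer}(z_1,d.pt_1,d.exp_1)$, $\textsc{writer}(z_2,d.pt_2,d.exp_2)$; ($ralloc$) $x\in A_p$; ($rCAS(q,e,\_)$, $rCAS\text{-}c(q,e,\_)$) $p=q$ and some $z\lessdot_q x$ has $\textsc{writer}(z,q,e)$;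 ($rwrite(q,\_)$, $rwrite\text{-}c(q,\_)$) $p=q$; never for reads. - $Q(x,v)$ iff: ($rdcss(d)$) some $z_2\lessdot_{d.pt_2}x$ has $\textsc{writer}(z_2,d.pt_2,v)$ and, if $v=d.exp_2$, some $z_1\lessdot_{d.pt_1}x$; ($ralloc$) $x\in T$ and $v$ is its output; (CASes and reads of $q$) some $z\lessdot_q x$ has $\textsc{writer}(z,q,v)$; (writes) $v=tt$. **The span structure $Z_R$.** Spans are pairs of linearized rep events; $(b)$ abbreviates $(b,b)$; $f,l$ are the projections. Outputs of rep events are their outputs in the linearization. $S_p$ consists of, for $p$ a $\textsc{dptr}$: $(b)$ with $b$ a failed CAS on $p$ at B, output in $\textsc{Val}$; $(b,c)$ with $b<^Rc$, $b=CAS(p,\_,n)$ successful at B with output in $\textsc{Val}$, $c=CAS(p,n,\_)$ successful at S, $is\_rdesc(n)$, and no rep event writing $p$ strictly between; $(b,c)$ likewise with $b=CAS(p,e,n)$ at B and $c=CAS(p,n,e)$ at U; $(b)$ with output in $\textsc{Val}$ and $b$ a read of $p$ at C, a CAS on $p$ at D, or a successful CAS on $p$ at F; $(b)$ with $b$ at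 K with output $p$, executed by a terminated $ralloc$; and, for $p$ a $\textsc{cptr}$: $(b)$ with $b$ accessing $p$ at R, G, H or I; $(b)$ with $b$ at J with output $p$, executed by a terminated $ralloc$. The write spans $W^S_p\subseteq S_p$ are the $(b)$ with $b$ writing or allocating $p$ and the $(b,c)$ with $c$ at S; the alloc spans $A^S_p\subseteq W^S_p$ are the $(b)$ with $b$ allocating $p$ at J or K. The denotation $[\![x]\!]=(S(x),o(x))$ is: - $x=rdcss(desc)$: let $i=Alloc(desc)$ be executed at A within $x$, with output $d$. If there is $(c)\in S_{desc.pt_2}$ with $c=CAS(desc.pt_2,desc.exp_2,d)$ at B with output $v\ne desc.exp_2$: $(\{(c)\},v)$. If there are $(c_1,c_2)\in W^S_{desc.pt_2}$ and $(r)\in S_{desc.pt_1}$ with $c_1=CAS(desc.pt_2,desc.exp_2,d)$ at B, $c_2=CAS(desc.pt_2,d,desc.new_2)$ at S, and $r={!desc.pt_1}$ at R the last read executed before $c_2$ by the thread of $c_2$: $(\{(r),(c_1,c_2)\},desc.exp_2)$. The same with $(c_1,c_2)\in S_{desc.pt_2}$ and $c_2=CAS(desc.pt_2,d,desc.exp_2)$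 at U. - $rread(p)$, $rread\text{-}c(p)$, $rCAS(p,e,n)$, $rCAS\text{-}c(p,e,n)$: $(\{(b)\},v)$ if there is $(b)\in S_p$, executed within $x$ at C, G, D, H respectively, with the arguments of $x$ and output $v$. - $rwrite(p,v)$: $(\{(c)\},tt)$ if there is $(c)\in W^S_p$ executed within $x$ at F, $c=CAS(p,w,v)$, where $w$ is the output of a read $r={!p}$ at E that is the last read executed before $c$ by that thread. $rwrite\text{-}c(p,v)$: $(\{(c)\},tt)$ if there is $(c)\in W^S_p$ executed within $x$, $c=(p:=v)$ at I. - $ralloc(v,k)$: $(\{(i)\},v')$ if $x$ is terminated with output a pointer $p$ and there is $(i)\in W^S_p$ executed within $x$, $i=Alloc(v)$ at J or K according to $k$, with output $v'$. - In all other cases $(\emptyset,\bot)$. Put $b\sqsubset^S c$ iff $l(b)<^R f(c)$, $S_p(x)=S(x)\cap S_p$, and $$x\ltimes_p y\iff\exists b\in S_p(x),c\in S_p(y).\ b\sqsubset^S c,\qquad x\lessdot_p y\iff\exists b\in S_p(x),c\in S_p(y).\ b=\max\nolimits_{\sqsubseteq^S}\{d\in W^S_p: d\sqsubset^S c\}.$$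 **Theorem.** For every execution history of the RDCSS implementation, $[\![\cdot]\!]$ is well defined (for each event at most one pair is prescribed by the above cases), its outputs are in $\textsc{Val}\cup\{\bot\}$, each $rdcss$ event has at most two spans in its denotation, and $V_R(\lessdot_p,\ltimes_p)=(W_p,A_p,Q)$ is implemented by $Z_R$, i.e. for all events $x,y$, pointers $p$ and spans $b,c$: 1. $b,c\in S_p\Rightarrow b\sqsubset^S c\vee c\sqsubset^S b\vee b=c$; 2. $b,c\in S(x)\Rightarrow f(b)\le^R l(c)$; 3. $x\in T\Rightarrow o(x)$ is the output of $x$ and $S(x)\neq\emptyset$; 4. $f(b)\le^R l(b)$ for every $b\in\bigcup_pS_p$; 5. $S(x)\cap S(y)\ne\emptyset\Rightarrow x=y$; 6. $b\in W^S_p\Rightarrow\exists x.\ b\in S(x)$; 7. $S(x)\neq\emptyset\Rightarrow o(x)\ne\bot\wedge Q(x,o(x))$; 8. $S(x)\ne\emptyset\Rightarrow(x\in W_p\Leftrightarrow S(x)\cap W^S_p\neq\emptyset)$; 9. if $b\in S(x)$, then $f(b)$ does not start before $x$ starts, and if moreover $x\in T$, there is $i\in[\le^R]$ that has ended no later than $x$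 with $l(b)\le^R i$; 10. $b,c\in A^S_p\Rightarrow b=c$; 11. $b\in S_p\Rightarrow\exists c\in A^S_p.\ c\sqsubset^S b\vee c=b$; 12. $S(x)\neq\emptyset\Rightarrow(x\in A_p\Leftrightarrow S(x)\cap A^S_p\ne\emptyset)$. -/

import Mathlib

/-! # The RDCSS implementation, its execution histories, and its span structure -/

namespace RDCSS

/-! ## Values, pointers, descriptors, memory -/

/-- Control pointers and data pointers. -/
inductive PtKind
  | cptr
  | dptr

/-- The classification of pointers: control or data (`kind`), and the predicate `rdesc`
telling the pointers that are used for storing RDCSS descriptors (for example a reserved bit).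
No implementation is fixed; allocation returns pointers of the right class, see `MemStep`. -/
class PtrTags (Ptr : Type*) where
  kind : Ptr → PtKind
  rdesc : Ptr → Prop

/-- Memory words: the unit value, client data, pointers. -/
inductive Word (Ptr Dat : Type*)
  | tt
  | dat (a : Dat)
  | ptr (p : Ptr)

/-- The predicate `is_rdesc`. The words that do not satisfy it form the set `Val`. -/
def Word.isRdesc {Ptr Dat : Type*} [PtrTags Ptr] : Word Ptr Dat → Prop
  | .ptr p => PtrTags.rdesc p
  | _ => False

/-- RDCSS descriptors. -/
structure Desc (Ptr Dat : Type*) where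
  pt1 : Ptr
  pt2 : Ptr
  exp1 : Word Ptr Dat
  exp2 : Word Ptr Dat
  new2 : Word Ptr Dat

/-- What a memory cell stores, and what a primitive outputs. -/
inductive Cell (Ptr Dat : Type*)
  | word (w : Word Ptr Dat)
  | desc (δ : Desc Ptr Dat)

/-- The primitive (system) operations. -/
inductive Op (Ptr Dat : Type*)
  | deref (p : Ptr)
  | cas (p : Ptr) (e n : Word Ptr Dat)
  | write (p : Ptr) (w : Word Ptr Dat)
  | alloc (c : Cell Ptr Dat) (k : PtKind)

abbrev Heap (Ptr Dat : Type*) := Ptr → Option (Cell Ptr Dat)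

open Classical in
/-- The heap `h` with the cell of `p` set to `c`. -/
noncomputable def Heap.set {Ptr Dat : Type*} (h : Heap Ptr Dat) (p : Ptr) (c : Cell Ptr Dat) :
    Heap Ptr Dat :=
  fun q => if q = p then some c else h q

/-- `MemStep h o c h'`: sequential semantics of the primitives; in heap `h` the operation `o`
outputs `c` and leaves the heap `h'`. A CAS outputs the old value. An allocation returns a fresh
pointer of the requested kind, which satisfies `rdesc` iff what it stores is a descriptor. -/
inductive MemStep {Ptr Dat : Type*} [PtrTags Ptr] :
    Heap Ptr Dat → Op Ptr Dat → Cell Ptr Dat → Heap Ptr Dat → Prop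
  | deref (h : Heap Ptr Dat) (p : Ptr) (c : Cell Ptr Dat) (hp : h p = some c) :
      MemStep h (.deref p) c h
  | casOk (h : Heap Ptr Dat) (p : Ptr) (e n : Word Ptr Dat) (hp : h p = some (.word e)) :
      MemStep h (.cas p e n) (.word e) (h.set p (.word n))
  | casFail (h : Heap Ptr Dat) (p : Ptr) (e n w : Word Ptr Dat) (hp : h p = some (.word w))
      (hw : w ≠ e) :
      MemStep h (.cas p e n) (.word w) h
  | write (h : Heap Ptr Dat) (p : Ptr) (w : Word Ptr Dat) (hp : h p ≠ none) :
      MemStep h (.write p w) (.word .tt) (h.set p (.word w))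
  | alloc (h : Heap Ptr Dat) (p : Ptr) (c : Cell Ptr Dat) (k : PtKind) (hp : h p = none)
      (hk : PtrTags.kind p = k) (hr : PtrTags.rdesc p ↔ ∃ δ, c = .desc δ) :
      MemStep h (.alloc c k) (.word (.ptr p)) (h.set p c)

/-! ## The code

```
rdcss(desc)       { d <- Alloc(desc) as dptr;                    (rdcssAlloc)
                    return rdcssLoop(d, desc) }
rdcssLoop(d,desc) { old <- CAS(desc.pt2, desc.exp2, d);          (rdcssCas)
                    if is_rdesc(old) { complete(old); return rdcssLoop(d, desc) }
                    else { if old = desc.exp2 { complete(d) }; return old } }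
complete(d)       { desc <- !d;                                  (completeRead)
                    x <- !desc.pt1;                              (completePt1)
                    if x = desc.exp1 { CAS(desc.pt2, d, desc.new2) }   (completeSucc)
                    else { CAS(desc.pt2, d, desc.exp2) } }             (completeUndo)
rread(pt)         { old <- !pt;                                  (rreadRead)
                    if is_rdesc(old) { complete(old); return rread(pt) } else { return old } }
rCAS(pt,exp,new)  { old <- CAS(pt, exp, new);                    (rcasCas)
                    if is_rdesc(old) { complete(old); return rCAS(pt, exp, new) }
                    else { return old } }
rwrite(pt,v)      { old <- !pt;                                  (rwriteRead)
                    if is_rdesc(old) { complete(old); rwrite(pt, v) }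
                    else { x <- CAS(pt, old, v);                 (rwriteCas)
                           if x != old { rwrite(pt, v) } } }
rread-c(pt)         { return !pt }                               (rreadcRead)
rCAS-c(pt,exp,new)  { return CAS(pt, exp, new) }                 (rcascCas)
rwrite-c(pt,v)      { pt := v }                                  (rwritecWrite)
ralloc(v,k)         { if k = cptr { return Alloc(v) as cptr }    (rallocC)
                      else { return Alloc(v) as dptr } }         (rallocD)
```
-/

/-- Exported procedures, with their arguments. -/
inductive Call (Ptr Dat : Type*)
  | rdcss (δ : Desc Ptr Dat)
  | ralloc (v : Word Ptr Dat) (k : PtKind)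
  | rcas (p : Ptr) (e n : Word Ptr Dat)
  | rwrite (p : Ptr) (v : Word Ptr Dat)
  | rread (p : Ptr)
  | rcasc (p : Ptr) (e n : Word Ptr Dat)
  | rwritec (p : Ptr) (v : Word Ptr Dat)
  | rreadc (p : Ptr)

/-- The pointers in the input of a call, with the kinds that the signatures declare. -/
def Call.ptrs {Ptr Dat : Type*} : Call Ptr Dat → List (Ptr × PtKind)
  | .rdcss δ => [(δ.pt1, .cptr), (δ.pt2, .dptr)]
  | .ralloc _ _ => []
  | .rcas p _ _ => [(p, .dptr)]
  | .rwrite p _ => [(p, .dptr)]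
  | .rread p => [(p, .dptr)]
  | .rcasc p _ _ => [(p, .cptr)]
  | .rwritec p _ => [(p, .cptr)]
  | .rreadc p => [(p, .cptr)]

/-- The arguments of a call that the signatures declare to be in `Val`. -/
def Call.vals {Ptr Dat : Type*} : Call Ptr Dat → List (Word Ptr Dat)
  | .rdcss δ => [δ.exp1, δ.exp2, δ.new2]
  | .ralloc v _ => [v]
  | .rcas _ e n => [e, n]
  | .rwrite _ v => [v]
  | .rread _ => []
  | .rcasc _ e n => [e, n]
  | .rwritec _ v => [v]
  | .rreadc _ => []

/-- The code lines that execute a primitive. -/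
inductive Line
  | rdcssAlloc | rdcssCas
  | completeRead | completePt1 | completeSucc | completeUndo
  | rreadRead | rcasCas | rwriteRead | rwriteCas
  | rreadcRead | rcascCas | rwritecWrite | rallocC | rallocD

/-- Control points of a thread that is executing an exported procedure: it is about to execute
the named line with the given values of the local variables, or (`ret`) to return a word. In the
control points inside `complete`, `k` is the point at which the caller goes on. -/
inductive Pc (Ptr Dat : Type*)
  | rdcssAlloc (δ : Desc Ptr Dat)
  | rdcssCas (d : Ptr) (δ : Desc Ptr Dat)
  | completeRead (d : Ptr) (k : Pc Ptr Dat)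
  | completePt1 (d : Ptr) (δ : Desc Ptr Dat) (k : Pc Ptr Dat)
  | completeSucc (d : Ptr) (δ : Desc Ptr Dat) (k : Pc Ptr Dat)
  | completeUndo (d : Ptr) (δ : Desc Ptr Dat) (k : Pc Ptr Dat)
  | rreadRead (p : Ptr)
  | rcasCas (p : Ptr) (e n : Word Ptr Dat)
  | rwriteRead (p : Ptr) (v : Word Ptr Dat)
  | rwriteCas (p : Ptr) (v old : Word Ptr Dat)
  | rreadcRead (p : Ptr)
  | rcascCas (p : Ptr) (e n : Word Ptr Dat)
  | rwritecWrite (p : Ptr) (v : Word Ptr Dat)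
  | rallocC (v : Word Ptr Dat)
  | rallocD (v : Word Ptr Dat)
  | ret (w : Word Ptr Dat)

/-- The code line of a control point (none for `ret`). -/
def Pc.line {Ptr Dat : Type*} : Pc Ptr Dat → Option Line
  | .rdcssAlloc _ => some .rdcssAlloc
  | .rdcssCas _ _ => some .rdcssCas
  | .completeRead _ _ => some .completeRead
  | .completePt1 _ _ _ => some .completePt1
  | .completeSucc _ _ _ => some .completeSucc
  | .completeUndo _ _ _ => some .completeUndo
  | .rreadRead _ => some .rreadRead
  | .rcasCas _ _ _ => some .rcasCas
  | .rwriteRead _ _ => some .rwriteRead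
  | .rwriteCas _ _ _ => some .rwriteCas
  | .rreadcRead _ => some .rreadcRead
  | .rcascCas _ _ _ => some .rcascCas
  | .rwritecWrite _ _ => some .rwritecWrite
  | .rallocC _ => some .rallocC
  | .rallocD _ => some .rallocD
  | .ret _ => none

/-- The primitive operation that a control point executes (none for `ret`). -/
def Pc.op {Ptr Dat : Type*} : Pc Ptr Dat → Option (Op Ptr Dat)
  | .rdcssAlloc δ => some (.alloc (.desc δ) .dptr)
  | .rdcssCas d δ => some (.cas δ.pt2 δ.exp2 (.ptr d))
  | .completeRead d _ => some (.deref d)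
  | .completePt1 _ δ _ => some (.deref δ.pt1)
  | .completeSucc d δ _ => some (.cas δ.pt2 (.ptr d) δ.new2)
  | .completeUndo d δ _ => some (.cas δ.pt2 (.ptr d) δ.exp2)
  | .rreadRead p => some (.deref p)
  | .rcasCas p e n => some (.cas p e n)
  | .rwriteRead p _ => some (.deref p)
  | .rwriteCas p v old => some (.cas p old v)
  | .rreadcRead p => some (.deref p)
  | .rcascCas p e n => some (.cas p e n)
  | .rwritecWrite p v => some (.write p v)
  | .rallocC v => some (.alloc (.word v) .cptr)
  | .rallocD v => some (.alloc (.word v) .dptr)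
  | .ret _ => none

/-- The control point at which a call starts. -/
def Call.entry {Ptr Dat : Type*} : Call Ptr Dat → Pc Ptr Dat
  | .rdcss δ => .rdcssAlloc δ
  | .ralloc v .cptr => .rallocC v
  | .ralloc v .dptr => .rallocD v
  | .rcas p e n => .rcasCas p e n
  | .rwrite p v => .rwriteRead p v
  | .rread p => .rreadRead p
  | .rcasc p e n => .rcascCas p e n
  | .rwritec p v => .rwritecWrite p v
  | .rreadc p => .rreadcRead p

/-- `Next pc c pc'`: if the primitive executed at `pc` outputs `c`, then the next control point
is `pc'`. -/
inductive Next {Ptr Dat : Type*} [PtrTags Ptr] :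
    Pc Ptr Dat → Cell Ptr Dat → Pc Ptr Dat → Prop
  | rdcssAlloc (δ : Desc Ptr Dat) (d : Ptr) :
      Next (.rdcssAlloc δ) (.word (.ptr d)) (.rdcssCas d δ)
  | rdcssHelp (d : Ptr) (δ : Desc Ptr Dat) (q : Ptr) (hq : PtrTags.rdesc q) :
      Next (.rdcssCas d δ) (.word (.ptr q)) (.completeRead q (.rdcssCas d δ))
  | rdcssSelf (d : Ptr) (δ : Desc Ptr Dat) (old : Word Ptr Dat) (ho : ¬ old.isRdesc)
      (he : old = δ.exp2) :
      Next (.rdcssCas d δ) (.word old) (.completeRead d (.ret old))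
  | rdcssFail (d : Ptr) (δ : Desc Ptr Dat) (old : Word Ptr Dat) (ho : ¬ old.isRdesc)
      (he : old ≠ δ.exp2) :
      Next (.rdcssCas d δ) (.word old) (.ret old)
  | completeRead (d : Ptr) (k : Pc Ptr Dat) (δ : Desc Ptr Dat) :
      Next (.completeRead d k) (.desc δ) (.completePt1 d δ k)
  | completeMatch (d : Ptr) (δ : Desc Ptr Dat) (k : Pc Ptr Dat) (x : Word Ptr Dat)
      (hx : x = δ.exp1) :
      Next (.completePt1 d δ k) (.word x) (.completeSucc d δ k)
  | completeMismatch (d : Ptr) (δ : Desc Ptr Dat) (k : Pc Ptr Dat) (x : Word Ptr Dat)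
      (hx : x ≠ δ.exp1) :
      Next (.completePt1 d δ k) (.word x) (.completeUndo d δ k)
  | completeSucc (d : Ptr) (δ : Desc Ptr Dat) (k : Pc Ptr Dat) (w : Word Ptr Dat) :
      Next (.completeSucc d δ k) (.word w) k
  | completeUndo (d : Ptr) (δ : Desc Ptr Dat) (k : Pc Ptr Dat) (w : Word Ptr Dat) :
      Next (.completeUndo d δ k) (.word w) k
  | rreadHelp (p q : Ptr) (hq : PtrTags.rdesc q) :
      Next (.rreadRead p) (.word (.ptr q)) (.completeRead q (.rreadRead p))
  | rreadDone (p : Ptr) (old : Word Ptr Dat) (ho : ¬ old.isRdesc) :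
      Next (.rreadRead p) (.word old) (.ret old)
  | rcasHelp (p : Ptr) (e n : Word Ptr Dat) (q : Ptr) (hq : PtrTags.rdesc q) :
      Next (.rcasCas p e n) (.word (.ptr q)) (.completeRead q (.rcasCas p e n))
  | rcasDone (p : Ptr) (e n old : Word Ptr Dat) (ho : ¬ old.isRdesc) :
      Next (.rcasCas p e n) (.word old) (.ret old)
  | rwriteHelp (p : Ptr) (v : Word Ptr Dat) (q : Ptr) (hq : PtrTags.rdesc q) :
      Next (.rwriteRead p v) (.word (.ptr q)) (.completeRead q (.rwriteRead p v))
  | rwriteTry (p : Ptr) (v old : Word Ptr Dat) (ho : ¬ old.isRdesc) :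
      Next (.rwriteRead p v) (.word old) (.rwriteCas p v old)
  | rwriteAgain (p : Ptr) (v old x : Word Ptr Dat) (hx : x ≠ old) :
      Next (.rwriteCas p v old) (.word x) (.rwriteRead p v)
  | rwriteDone (p : Ptr) (v old x : Word Ptr Dat) (hx : x = old) :
      Next (.rwriteCas p v old) (.word x) (.ret .tt)
  | rreadc (p : Ptr) (w : Word Ptr Dat) :
      Next (.rreadcRead p) (.word w) (.ret w)
  | rcasc (p : Ptr) (e n w : Word Ptr Dat) :
      Next (.rcascCas p e n) (.word w) (.ret w)
  | rwritec (p : Ptr) (v w : Word Ptr Dat) :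
      Next (.rwritecWrite p v) (.word w) (.ret .tt)
  | rallocC (v w : Word Ptr Dat) :
      Next (.rallocC v) (.word w) (.ret w)
  | rallocD (v w : Word Ptr Dat) :
      Next (.rallocD v) (.word w) (.ret w)

/-! ## Execution histories -/

/-- A rep event: the execution of a code line that calls a primitive. It has a start time and,
if it has finished, an end time together with an output. Rep events need not be atomic. -/
structure RepRec (Ptr Dat : Type*) where
  pc : Pc Ptr Dat
  start : ℕ
  resp : Option (ℕ × Cell Ptr Dat)

/-- An event: the invocation of an exported procedure by a thread, with the rep events executed
by that thread within the invocation, in program order, and, if the event has terminated, its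
end time together with its output. -/
structure EvRec (Ptr Dat Thr : Type*) where
  thread : Thr
  call : Call Ptr Dat
  start : ℕ
  reps : List (RepRec Ptr Dat)
  resp : Option (ℕ × Word Ptr Dat)

/-- `Run pc t l r`: from control point `pc`, where it has arrived at time `t`, a thread executes
the rep events `l`, and then it has returned with response `r` or (if `r = none`) the history ends
before the procedure returns. The outputs of the primitives are arbitrary here; they are
constrained by the linearization of the whole history. -/
inductive Run {Ptr Dat : Type*} [PtrTags Ptr] :
    Pc Ptr Dat → ℕ → List (RepRec Ptr Dat) → Option (ℕ × Word Ptr Dat) → Prop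
  | cut (pc : Pc Ptr Dat) (t : ℕ) : Run pc t [] none
  | pending (pc : Pc Ptr Dat) (t s : ℕ) (hpc : pc.op ≠ none) (hs : t < s) :
      Run pc t [⟨pc, s, none⟩] none
  | step (pc pc' : Pc Ptr Dat) (t s e : ℕ) (c : Cell Ptr Dat) (l : List (RepRec Ptr Dat))
      (r : Option (ℕ × Word Ptr Dat)) (hs : t < s) (he : s ≤ e) (hn : Next pc c pc')
      (hr : Run pc' e l r) :
      Run pc t (⟨pc, s, some (e, c)⟩ :: l) r
  | ret (w : Word Ptr Dat) (t e : ℕ) (he : t ≤ e) : Run (.ret w) t [] (some (e, w))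

/-- Rep events of a family of events: the `j`-th rep event executed within the event `x`. -/
abbrev Rep {Ptr Dat Thr Ev : Type*} (ev : Ev → EvRec Ptr Dat Thr) :=
  Σ x : Ev, Fin (ev x).reps.length

/-- The data of a history: a set `Ev` of events with their rep events, and a linearization of the
rep events. The linearization is given as the list of the linearized rep events, in order, each
with its output (for a rep event that has not finished this is the output it is completed with). -/
structure History (Ptr Dat Thr Ev : Type*) where
  ev : Ev → EvRec Ptr Dat Thr
  lin : List (Rep ev × Cell Ptr Dat)

namespace History

variable {Ptr Dat Thr Ev : Type*} (H : History Ptr Dat Thr Ev)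

/-- The set of rep events of the history. -/
abbrev Rp := Rep H.ev

def rep (a : H.Rp) : RepRec Ptr Dat := (H.ev a.1).reps.get a.2

def line (a : H.Rp) : Option Line := (H.rep a).pc.line

def op (a : H.Rp) : Option (Op Ptr Dat) := (H.rep a).pc.op

/-- Start time of a rep event. -/
def rstart (a : H.Rp) : ℕ := (H.rep a).start

/-- End time of a rep event, if it has finished. -/
def rend (a : H.Rp) : Option ℕ := (H.rep a).resp.map Prod.fst

/-- The thread that executes a rep event. -/
def thr (a : H.Rp) : Thr := (H.ev a.1).thread

/-- The domain of the linearization of the rep events. -/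
def dom : Set H.Rp := {a | ∃ c, (a, c) ∈ H.lin}

/-- `c` is the output of the linearized rep event `a`. -/
def Out (a : H.Rp) (c : Cell Ptr Dat) : Prop := (a, c) ∈ H.lin

/-- The strict order of the linearization of the rep events. -/
def lt (a b : H.Rp) : Prop :=
  ∃ (i j : ℕ) (c c' : Cell Ptr Dat), i < j ∧ H.lin[i]? = some (a, c) ∧ H.lin[j]? = some (b, c')

/-- The order of the linearization of the rep events. -/
def le (a b : H.Rp) : Prop := H.lt a b ∨ (a = b ∧ a ∈ H.dom)

def call (x : Ev) : Call Ptr Dat := (H.ev x).call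

/-- Start time of an event. -/
def start (x : Ev) : ℕ := (H.ev x).start

/-- End time of an event, if it has terminated. -/
def fin (x : Ev) : Option ℕ := (H.ev x).resp.map Prod.fst

/-- Output of an event, if it has terminated. -/
def out (x : Ev) : Option (Word Ptr Dat) := (H.ev x).resp.map Prod.snd

/-- The set of terminated events. -/
def terminated : Set Ev := {x | H.fin x ≠ none}

/-- Returns-before relation on events. -/
def before (x y : Ev) : Prop := ∃ t, H.fin x = some t ∧ t < H.start y

variable [PtrTags Ptr]

/-- `Legal op h l`: executing the operations in the order of `l`, from the heap `h`, is possible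
with the listed outputs. -/
inductive Legal {R : Type*} (op : R → Option (Op Ptr Dat)) :
    Heap Ptr Dat → List (R × Cell Ptr Dat) → Prop
  | nil (h : Heap Ptr Dat) : Legal op h []
  | cons (h h' : Heap Ptr Dat) (a : R) (o : Op Ptr Dat) (c : Cell Ptr Dat)
      (l : List (R × Cell Ptr Dat)) (ho : op a = some o) (hm : MemStep h o c h')
      (hl : Legal op h' l) :
      Legal op h ((a, c) :: l)

/-- The execution histories of the RDCSS implementation. -/
structure IsExecution : Prop where
  /-- Every event executes the code of its procedure. -/
  run : ∀ x, Run (H.call x).entry (H.start x) (H.ev x).reps (H.ev x).resp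
  /-- A thread executes one event at a time. -/
  sequential : ∀ x y, x ≠ y → (H.ev x).thread = (H.ev y).thread → H.before x y ∨ H.before y x
  /-- Value arguments are in `Val`. -/
  input_val : ∀ x, ∀ v ∈ (H.call x).vals, ¬ v.isRdesc
  /-- Pointer arguments are of the declared kind. -/
  input_kind : ∀ x, ∀ q ∈ (H.call x).ptrs, PtrTags.kind q.1 = q.2
  /-- Pointer arguments have been returned by a previous invocation of `ralloc`. -/
  input_alloc : ∀ x, ∀ q ∈ (H.call x).ptrs, ∃ y v k,
    H.call y = .ralloc v k ∧ H.out y = some (.ptr q.1) ∧ H.before y x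
  /-- A rep event is linearized at most once. -/
  lin_nodup : (H.lin.map Prod.fst).Nodup
  /-- Every finished rep event is linearized, with the output that it has returned. -/
  lin_finished : ∀ a e c, (H.rep a).resp = some (e, c) → H.Out a c
  /-- The linearization respects the real-time order. -/
  lin_realtime : ∀ a b e, H.rend a = some e → e < H.rstart b → b ∈ H.dom → H.lt a b
  /-- The linearization is sequentially sound, from the empty heap. -/
  lin_sound : Legal H.op (fun _ => none) H.lin

end History

/-! ## Specifications, span structures, span axioms -/

/-- A specification: successful write events, alloc events, postcondition predicate. -/
structure Specification (Ptr Ev V : Type*) where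
  writes : Ptr → Set Ev
  allocs : Ptr → Set Ev
  post : Ev → V → Prop

/-- A span structure: spans, write spans and alloc spans of every pointer, and the denotation of
events (`none` is an undefined output). The 1-tuple span `(a)` is the pair `(a, a)`. -/
structure SpanStructure (Ptr Ev R V : Type*) where
  spans : Ptr → Set (R × R)
  wspans : Ptr → Set (R × R)
  aspans : Ptr → Set (R × R)
  den : Ev → Set (R × R) × Option V
  wspans_sub : ∀ p, wspans p ⊆ spans p
  aspans_sub : ∀ p, aspans p ⊆ wspans p
  den_sub : ∀ x, (den x).1 ⊆ ⋃ p, spans p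

namespace History

variable {Ptr Dat Thr Ev : Type*} (H : History Ptr Dat Thr Ev)

/-- Span returns-before relation. -/
def sbefore (b c : H.Rp × H.Rp) : Prop := H.lt b.2 c.1

/-- Reflexive closure of the span returns-before relation. -/
def sbeforeEq (b c : H.Rp × H.Rp) : Prop := H.sbefore b c ∨ b = c

/-- Separable-before relation induced by a span structure. -/
def sep (Z : SpanStructure Ptr Ev H.Rp (Word Ptr Dat)) (p : Ptr) (x y : Ev) : Prop :=
  ∃ b ∈ (Z.den x).1 ∩ Z.spans p, ∃ c ∈ (Z.den y).1 ∩ Z.spans p, H.sbefore b c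

/-- Observation relation induced by a span structure: some `p`-span of `x` is the latest write
span into `p` before some `p`-span of `y`. -/
def obs (Z : SpanStructure Ptr Ev H.Rp (Word Ptr Dat)) (p : Ptr) (x y : Ev) : Prop :=
  ∃ b ∈ (Z.den x).1 ∩ Z.spans p, ∃ c ∈ (Z.den y).1 ∩ Z.spans p,
    (b ∈ Z.wspans p ∧ H.sbefore b c) ∧
    ∀ d, d ∈ Z.wspans p → H.sbefore d c → H.sbeforeEq d b

/-- The specification `V` is implemented by the span structure `Z`: the span axioms. -/
structure ImplementedBy (V : Specification Ptr Ev (Word Ptr Dat))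
    (Z : SpanStructure Ptr Ev H.Rp (Word Ptr Dat)) : Prop where
  disjointness : ∀ p, ∀ b ∈ Z.spans p, ∀ c ∈ Z.spans p, H.sbefore b c ∨ H.sbefore c b ∨ b = c
  bunching : ∀ x, ∀ b ∈ (Z.den x).1, ∀ c ∈ (Z.den x).1, H.le b.1 c.2
  adequacy : ∀ x ∈ H.terminated, (Z.den x).2 = H.out x ∧ (Z.den x).1.Nonempty
  first_le_last : ∀ p, ∀ b ∈ Z.spans p, H.le b.1 b.2
  injective : ∀ x y, ((Z.den x).1 ∩ (Z.den y).1).Nonempty → x = y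
  write_spans_denoted : ∀ p, ∀ b ∈ Z.wspans p, ∃ x, b ∈ (Z.den x).1
  postcondition : ∀ x, (Z.den x).1.Nonempty → ∃ v, (Z.den x).2 = some v ∧ V.post x v
  writers : ∀ x p, (Z.den x).1.Nonempty →
    (x ∈ V.writes p ↔ ((Z.den x).1 ∩ Z.wspans p).Nonempty)
  starts_within : ∀ x, ∀ b ∈ (Z.den x).1, H.start x ≤ H.rstart b.1
  ends_within : ∀ x, ∀ b ∈ (Z.den x).1, ∀ t, H.fin x = some t →
    ∃ i ∈ H.dom, (∃ s, H.rend i = some s ∧ s ≤ t) ∧ H.le b.2 i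
  alloc_unique : ∀ p, ∀ b ∈ Z.aspans p, ∀ c ∈ Z.aspans p, b = c
  allocated : ∀ p, ∀ b ∈ Z.spans p, ∃ c ∈ Z.aspans p, H.sbeforeEq c b
  allocators : ∀ x p, (Z.den x).1.Nonempty →
    (x ∈ V.allocs p ↔ ((Z.den x).1 ∩ Z.aspans p).Nonempty)

/-! ## The specification of RDCSS -/

/-- `H.writer x p v`: the event `x` attempts to write `v` into `p`. -/
def writer (x : Ev) (p : Ptr) (v : Word Ptr Dat) : Prop :=
  match H.call x with
  | .rdcss δ => p = δ.pt2 ∧ v = δ.new2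
  | .ralloc u _ => v = u ∧ H.fin x ≠ none ∧ H.out x = some (.ptr p)
  | .rcas q _ n => p = q ∧ v = n
  | .rwrite q u => p = q ∧ v = u
  | .rcasc q _ n => p = q ∧ v = n
  | .rwritec q u => p = q ∧ v = u
  | .rread _ => False
  | .rreadc _ => False

/-- The specification of RDCSS over an observation and a separable-before relation (the second
one is not used by its components). -/
def specR (vis _sp : Ptr → Ev → Ev → Prop) : Specification Ptr Ev (Word Ptr Dat) where
  allocs p := {x | (∃ v k, H.call x = .ralloc v k) ∧ H.fin x ≠ none ∧ H.out x = some (.ptr p)}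
  writes p := {x |
    match H.call x with
    | .rdcss δ => p = δ.pt2 ∧ ∃ z₁ z₂, vis δ.pt1 z₁ x ∧ vis δ.pt2 z₂ x ∧
        H.writer z₁ δ.pt1 δ.exp1 ∧ H.writer z₂ δ.pt2 δ.exp2
    | .ralloc _ _ => H.fin x ≠ none ∧ H.out x = some (.ptr p)
    | .rcas q e _ => p = q ∧ ∃ z, vis q z x ∧ H.writer z q e
    | .rwrite q _ => p = q
    | .rcasc q e _ => p = q ∧ ∃ z, vis q z x ∧ H.writer z q e
    | .rwritec q _ => p = q
    | .rread _ => False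
    | .rreadc _ => False}
  post x v :=
    match H.call x with
    | .rdcss δ => ∃ z₂, vis δ.pt2 z₂ x ∧ H.writer z₂ δ.pt2 v ∧
        (v = δ.exp2 → ∃ z₁, vis δ.pt1 z₁ x)
    | .ralloc _ _ => H.fin x ≠ none ∧ H.out x = some v
    | .rcas q _ _ => ∃ z, vis q z x ∧ H.writer z q v
    | .rwrite _ _ => v = .tt
    | .rread q => ∃ z, vis q z x ∧ H.writer z q v
    | .rcasc q _ _ => ∃ z, vis q z x ∧ H.writer z q v
    | .rwritec _ _ => v = .tt
    | .rreadc q => ∃ z, vis q z x ∧ H.writer z q v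

/-! ## The span structure of RDCSS -/

/-- `b` is a successful `CAS(p, e, n)`. -/
def CasOk (b : H.Rp) (p : Ptr) (e n : Word Ptr Dat) : Prop :=
  H.op b = some (.cas p e n) ∧ H.Out b (.word e)

/-- `b` is a failed `CAS(p, e, n)`. -/
def CasFail (b : H.Rp) (p : Ptr) (e n : Word Ptr Dat) : Prop :=
  H.op b = some (.cas p e n) ∧ ∃ w, w ≠ e ∧ H.Out b (.word w)

/-- `b` mutates the pointer `p`. -/
def Writes (b : H.Rp) (p : Ptr) : Prop :=
  (∃ e n, H.CasOk b p e n) ∨ (∃ w, H.op b = some (.write p w) ∧ b ∈ H.dom)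

/-- `b` allocates the pointer `p`. -/
def Allocs (b : H.Rp) (p : Ptr) : Prop :=
  (∃ c k, H.op b = some (.alloc c k)) ∧ H.Out b (.word (.ptr p))

/-- `r` is the last read executed before `c` by the thread of `c`. -/
def LastRead (r c : H.Rp) : Prop :=
  ((∃ p, H.op r = some (.deref p)) ∧ H.thr r = H.thr c ∧ H.rstart r < H.rstart c) ∧
  ∀ s p, H.op s = some (.deref p) → H.thr s = H.thr c → H.rstart s < H.rstart c →
    H.rstart s ≤ H.rstart r

variable [PtrTags Ptr]

/-- The output of `b` is a word that is not a pointer to a descriptor. -/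
def OutVal (b : H.Rp) : Prop := ∃ w, H.Out b (.word w) ∧ ¬ w.isRdesc

/-- The spans accessing `p`. -/
inductive IsSpan (p : Ptr) : H.Rp × H.Rp → Prop
  | rdcssFail (b : H.Rp) (hp : PtrTags.kind p = .dptr) (hl : H.line b = some .rdcssCas)
      (ho : H.OutVal b) (hb : ∃ e n, H.CasFail b p e n) : IsSpan p (b, b)
  | rdcssSucc (b c : H.Rp) (hp : PtrTags.kind p = .dptr) (hl : H.line b = some .rdcssCas)
      (hl' : H.line c = some .completeSucc) (ho : H.OutVal b) (hlt : H.lt b c)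
      (hno : ∀ a, H.Writes a p → ¬ (H.lt b a ∧ H.lt a c))
      (hbc : ∃ e n v, n.isRdesc ∧ H.CasOk b p e n ∧ H.CasOk c p n v) : IsSpan p (b, c)
  | rdcssUndo (b c : H.Rp) (hp : PtrTags.kind p = .dptr) (hl : H.line b = some .rdcssCas)
      (hl' : H.line c = some .completeUndo) (ho : H.OutVal b) (hlt : H.lt b c)
      (hno : ∀ a, H.Writes a p → ¬ (H.lt b a ∧ H.lt a c))
      (hbc : ∃ e n, n.isRdesc ∧ H.CasOk b p e n ∧ H.CasOk c p n e) : IsSpan p (b, c)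
  | completePt1 (b : H.Rp) (hp : PtrTags.kind p = .cptr) (hl : H.line b = some .completePt1)
      (hd : b ∈ H.dom) (hb : H.op b = some (.deref p)) : IsSpan p (b, b)
  | rread (b : H.Rp) (hp : PtrTags.kind p = .dptr) (hl : H.line b = some .rreadRead)
      (ho : H.OutVal b) (hb : H.op b = some (.deref p)) : IsSpan p (b, b)
  | rcas (b : H.Rp) (hp : PtrTags.kind p = .dptr) (hl : H.line b = some .rcasCas)
      (ho : H.OutVal b) (hb : ∃ e n, H.op b = some (.cas p e n)) : IsSpan p (b, b)
  | rwrite (b : H.Rp) (hp : PtrTags.kind p = .dptr) (hl : H.line b = some .rwriteCas)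
      (ho : H.OutVal b) (hb : ∃ e n, H.CasOk b p e n) : IsSpan p (b, b)
  | rreadc (b : H.Rp) (hp : PtrTags.kind p = .cptr) (hl : H.line b = some .rreadcRead)
      (hd : b ∈ H.dom) (hb : H.op b = some (.deref p)) : IsSpan p (b, b)
  | rcasc (b : H.Rp) (hp : PtrTags.kind p = .cptr) (hl : H.line b = some .rcascCas)
      (hd : b ∈ H.dom) (hb : ∃ e n, H.op b = some (.cas p e n)) : IsSpan p (b, b)
  | rwritec (b : H.Rp) (hp : PtrTags.kind p = .cptr) (hl : H.line b = some .rwritecWrite)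
      (hd : b ∈ H.dom) (hb : ∃ w, H.op b = some (.write p w)) : IsSpan p (b, b)
  /- An allocation counts once its invocation of `ralloc` has handed the pointer out. -/
  | rallocC (b : H.Rp) (hp : PtrTags.kind p = .cptr) (hl : H.line b = some .rallocC)
      (ht : b.1 ∈ H.terminated) (hb : H.Out b (.word (.ptr p))) : IsSpan p (b, b)
  | rallocD (b : H.Rp) (hp : PtrTags.kind p = .dptr) (hl : H.line b = some .rallocD)
      (ht : b.1 ∈ H.terminated) (hb : H.Out b (.word (.ptr p))) : IsSpan p (b, b)

/-- Successful write spans. -/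
def wspansR (p : Ptr) : Set (H.Rp × H.Rp) :=
  {s | H.IsSpan p s ∧ ((∃ b, s = (b, b) ∧ (H.Writes b p ∨ H.Allocs b p)) ∨
    H.line s.2 = some .completeSucc)}

/-- Alloc spans. -/
def aspansR (p : Ptr) : Set (H.Rp × H.Rp) :=
  {s | s ∈ H.wspansR p ∧ ∃ b, s = (b, b) ∧ H.Allocs b p ∧
    (H.line b = some .rallocC ∨ H.line b = some .rallocD)}

/-- `IsDen x D`: the event `x` satisfies the conditions of one of the cases in which its denotation
is nonempty, and `D` is the pair of spans and output which that case prescribes. In all cases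
`a.1 = x` says that the thread that invoked `x` executes `a` within the invocation of `x`. -/
inductive IsDen (x : Ev) : Set (H.Rp × H.Rp) × Option (Word Ptr Dat) → Prop
  | rdcssFail (δ : Desc Ptr Dat) (d : Ptr) (i c : H.Rp) (v : Word Ptr Dat)
      (hx : H.call x = .rdcss δ)
      (hi : i.1 = x) (hil : H.line i = some .rdcssAlloc)
      (hio : H.op i = some (.alloc (.desc δ) .dptr)) (hid : H.Out i (.word (.ptr d)))
      (hc : H.IsSpan δ.pt2 (c, c)) (hcl : H.line c = some .rdcssCas)
      (hco : H.op c = some (.cas δ.pt2 δ.exp2 (.ptr d)))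
      (hcv : H.Out c (.word v)) (hv : v ≠ δ.exp2) :
      IsDen x ({(c, c)}, some v)
  | rdcssSucc (δ : Desc Ptr Dat) (d : Ptr) (i r c₁ c₂ : H.Rp)
      (hx : H.call x = .rdcss δ)
      (hi : i.1 = x) (hil : H.line i = some .rdcssAlloc)
      (hio : H.op i = some (.alloc (.desc δ) .dptr)) (hid : H.Out i (.word (.ptr d)))
      (hr : H.IsSpan δ.pt1 (r, r)) (hc : (c₁, c₂) ∈ H.wspansR δ.pt2)
      (hrl : H.line r = some .completePt1) (hro : H.op r = some (.deref δ.pt1))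
      (hc1l : H.line c₁ = some .rdcssCas)
      (hc1o : H.op c₁ = some (.cas δ.pt2 δ.exp2 (.ptr d)))
      (hc2l : H.line c₂ = some .completeSucc)
      (hc2o : H.op c₂ = some (.cas δ.pt2 (.ptr d) δ.new2))
      (hlast : H.LastRead r c₂) :
      IsDen x ({(r, r), (c₁, c₂)}, some δ.exp2)
  | rdcssUndo (δ : Desc Ptr Dat) (d : Ptr) (i r c₁ c₂ : H.Rp)
      (hx : H.call x = .rdcss δ)
      (hi : i.1 = x) (hil : H.line i = some .rdcssAlloc)
      (hio : H.op i = some (.alloc (.desc δ) .dptr)) (hid : H.Out i (.word (.ptr d)))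
      (hr : H.IsSpan δ.pt1 (r, r)) (hc : H.IsSpan δ.pt2 (c₁, c₂))
      (hrl : H.line r = some .completePt1) (hro : H.op r = some (.deref δ.pt1))
      (hc1l : H.line c₁ = some .rdcssCas)
      (hc1o : H.op c₁ = some (.cas δ.pt2 δ.exp2 (.ptr d)))
      (hc2l : H.line c₂ = some .completeUndo)
      (hc2o : H.op c₂ = some (.cas δ.pt2 (.ptr d) δ.exp2))
      (hlast : H.LastRead r c₂) :
      IsDen x ({(r, r), (c₁, c₂)}, some δ.exp2)
  | rread (p : Ptr) (r : H.Rp) (v : Word Ptr Dat) (hx : H.call x = .rread p)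
      (hs : H.IsSpan p (r, r)) (hr : r.1 = x) (hrl : H.line r = some .rreadRead)
      (hro : H.op r = some (.deref p)) (hrv : H.Out r (.word v)) :
      IsDen x ({(r, r)}, some v)
  | rreadc (p : Ptr) (r : H.Rp) (v : Word Ptr Dat) (hx : H.call x = .rreadc p)
      (hs : H.IsSpan p (r, r)) (hr : r.1 = x) (hrl : H.line r = some .rreadcRead)
      (hro : H.op r = some (.deref p)) (hrv : H.Out r (.word v)) :
      IsDen x ({(r, r)}, some v)
  | rcas (p : Ptr) (e n : Word Ptr Dat) (c : H.Rp) (v : Word Ptr Dat)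
      (hx : H.call x = .rcas p e n)
      (hs : H.IsSpan p (c, c)) (hc : c.1 = x) (hcl : H.line c = some .rcasCas)
      (hco : H.op c = some (.cas p e n)) (hcv : H.Out c (.word v)) :
      IsDen x ({(c, c)}, some v)
  | rcasc (p : Ptr) (e n : Word Ptr Dat) (c : H.Rp) (v : Word Ptr Dat)
      (hx : H.call x = .rcasc p e n)
      (hs : H.IsSpan p (c, c)) (hc : c.1 = x) (hcl : H.line c = some .rcascCas)
      (hco : H.op c = some (.cas p e n)) (hcv : H.Out c (.word v)) :
      IsDen x ({(c, c)}, some v)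
  | rwrite (p : Ptr) (v w : Word Ptr Dat) (r c : H.Rp) (hx : H.call x = .rwrite p v)
      (hs : (c, c) ∈ H.wspansR p) (hc : c.1 = x)
      (hrl : H.line r = some .rwriteRead) (hro : H.op r = some (.deref p))
      (hrv : H.Out r (.word w))
      (hcl : H.line c = some .rwriteCas) (hco : H.op c = some (.cas p w v))
      (hlast : H.LastRead r c) :
      IsDen x ({(c, c)}, some .tt)
  | rwritec (p : Ptr) (v : Word Ptr Dat) (c : H.Rp) (hx : H.call x = .rwritec p v)
      (hs : (c, c) ∈ H.wspansR p) (hc : c.1 = x) (hcl : H.line c = some .rwritecWrite)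
      (hco : H.op c = some (.write p v)) :
      IsDen x ({(c, c)}, some .tt)
  | rallocC (v w : Word Ptr Dat) (p : Ptr) (i : H.Rp) (hx : H.call x = .ralloc v .cptr)
      (ht : H.fin x ≠ none) (hp : H.out x = some (.ptr p))
      (hs : (i, i) ∈ H.wspansR p) (hi : i.1 = x) (hil : H.line i = some .rallocC)
      (hio : H.op i = some (.alloc (.word v) .cptr)) (hiw : H.Out i (.word w)) :
      IsDen x ({(i, i)}, some w)
  | rallocD (v w : Word Ptr Dat) (p : Ptr) (i : H.Rp) (hx : H.call x = .ralloc v .dptr)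
      (ht : H.fin x ≠ none) (hp : H.out x = some (.ptr p))
      (hs : (i, i) ∈ H.wspansR p) (hi : i.1 = x) (hil : H.line i = some .rallocD)
      (hio : H.op i = some (.alloc (.word v) .dptr)) (hiw : H.Out i (.word w)) :
      IsDen x ({(i, i)}, some w)

open Classical in
/-- The denotation of events: the pair prescribed by `IsDen` if there is one, and otherwise no
spans and no output. -/
noncomputable def denR (x : Ev) : Set (H.Rp × H.Rp) × Option (Word Ptr Dat) :=
  if h : ∃ D, H.IsDen x D then h.choose else (∅, none)

theorem IsDen.sub {x : Ev} {D : Set (H.Rp × H.Rp) × Option (Word Ptr Dat)} (h : H.IsDen x D) :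
    D.1 ⊆ ⋃ p, {s | H.IsSpan p s} := by
  have one : ∀ (p : Ptr) (s : H.Rp × H.Rp), H.IsSpan p s →
      ({s} : Set (H.Rp × H.Rp)) ⊆ ⋃ p, {s | H.IsSpan p s} := by
    intro p s hs
    rw [Set.singleton_subset_iff]
    exact Set.mem_iUnion.2 ⟨p, hs⟩
  have two : ∀ (p q : Ptr) (s t : H.Rp × H.Rp), H.IsSpan p s → H.IsSpan q t →
      ({s, t} : Set (H.Rp × H.Rp)) ⊆ ⋃ p, {s | H.IsSpan p s} := by
    intro p q s t hs ht
    rw [Set.insert_subset_iff, Set.singleton_subset_iff]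
    exact ⟨Set.mem_iUnion.2 ⟨p, hs⟩, Set.mem_iUnion.2 ⟨q, ht⟩⟩
  cases h with
  | rdcssFail δ d i c v hx hi hil hio hid hc => exact one _ _ hc
  | rdcssSucc δ d i r c₁ c₂ hx hi hil hio hid hr hc => exact two _ _ _ _ hr hc.1
  | rdcssUndo δ d i r c₁ c₂ hx hi hil hio hid hr hc => exact two _ _ _ _ hr hc
  | rread p r v hx hs => exact one _ _ hs
  | rreadc p r v hx hs => exact one _ _ hs
  | rcas p e n c v hx hs => exact one _ _ hs
  | rcasc p e n c v hx hs => exact one _ _ hs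
  | rwrite p v w r c hx hs => exact one _ _ hs.1
  | rwritec p v c hx hs => exact one _ _ hs.1
  | rallocC v w p i hx ht hp hs => exact one _ _ hs.1
  | rallocD v w p i hx ht hp hs => exact one _ _ hs.1

/-- The span structure of RDCSS. -/
noncomputable def spanR : SpanStructure Ptr Ev H.Rp (Word Ptr Dat) where
  spans p := {s | H.IsSpan p s}
  wspans := H.wspansR
  aspans := H.aspansR
  den := H.denR
  wspans_sub _ _ h := h.1
  aspans_sub _ _ h := h.1
  den_sub x := by
    unfold denR
    split
    · rename_i h
      exact IsDen.sub H h.choose_spec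
    · exact Set.empty_subset _

end History

end RDCSS

/-!
Along the linearization the memory passes through a sequence of heaps. Everything is read off from
two descriptions of it: the contents of a cell come from the last rep event that stored into it
(`exists_last_store`), and the possible rep events are those of the code, whose control points are
constrained by `CodePc` and by the lemmas on predecessors in program order.

The core is the life of a descriptor. The pointer `d` allocated by an `rdcss` event identifies the
event and its descriptor (`rdcssAlloc_unique`). A descriptor pointer gets into a data cell only by
the CAS `c₁` of its owner (`rdcssCas_of_heap`), at most once (`rdcssCas_unique`), and the next rep
event that stores into the cell is the final CAS `c₂` of some run of `complete(d)`
(`complete_of_stores`). Hence between `c₁` and `c₂` the cell holds `d`, and no other span of the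
pointer, which has to see a client value, fits in between: spans of a pointer are linearly ordered
(`span_trichotomy`). The read `r` of the control pointer that decides about `c₂` directly precedes
`c₂` in its thread, and lies after `c₁`, since a thread calls `complete(d)` only when it has found
`d` in memory or is the owner just after `c₁` (`rdcssCas_before_read`). If the owner terminates, its
own run of `complete(d)` is over, and `c₂` is not later than the last CAS of that run
(`PairDen.pos_le`), although `c₂` and `r` may belong to another thread.

A client value in a cell was written by the last write span before (`exists_last_wspan`): a
successful store outside the `rdcss` protocol is a write span itself, the pair `(c₁, c₂)` is one
when `c₂` succeeds, and when `c₂` undoes, it restores the value that `c₁` has overwritten. Every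
write span belongs to the denotation of an event that attempts to write the value in question
(`exists_den_of_wspan`). Together these translate between values found in memory and observed
events (`exists_obs`, `eq_of_obs`), which gives the postcondition and the characterization of the
successful writers.

Denotations are unique because an event has at most one rep event outside `complete` that is
followed only by the way to its return (`Final.eq`), and `c₁` determines `c₂` and `r`.
-/

namespace RDCSS

/-! ### Control flow inside one event -/

section ControlFlow

variable {Ptr Dat : Type*}

/-- The control points at which the code goes on after a call of `complete` in the execution of
a given exported procedure. -/
inductive LoopPc : Call Ptr Dat → Pc Ptr Dat → Prop
  | rdcss (d : Ptr) (δ : Desc Ptr Dat) : LoopPc (.rdcss δ) (.rdcssCas d δ)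
  | rread (p : Ptr) : LoopPc (.rread p) (.rreadRead p)
  | rcas (p : Ptr) (e n : Word Ptr Dat) : LoopPc (.rcas p e n) (.rcasCas p e n)
  | rwrite (p : Ptr) (v : Word Ptr Dat) : LoopPc (.rwrite p v) (.rwriteRead p v)
  | ret (δ : Desc Ptr Dat) : LoopPc (.rdcss δ) (.ret δ.exp2)

/-- The control points that can occur in the execution of a given exported procedure. -/
inductive CodePc [PtrTags Ptr] : Call Ptr Dat → Pc Ptr Dat → Prop
  | rdcssAlloc (δ : Desc Ptr Dat) : CodePc (.rdcss δ) (.rdcssAlloc δ)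
  | loop (C : Call Ptr Dat) (k : Pc Ptr Dat) (hk : LoopPc C k) : CodePc C k
  | ret (C : Call Ptr Dat) (w : Word Ptr Dat) : CodePc C (.ret w)
  | completeRead (C : Call Ptr Dat) (d : Ptr) (k : Pc Ptr Dat) (hk : LoopPc C k) :
      CodePc C (.completeRead d k)
  | completePt1 (C : Call Ptr Dat) (d : Ptr) (δ : Desc Ptr Dat) (k : Pc Ptr Dat)
      (hk : LoopPc C k) : CodePc C (.completePt1 d δ k)
  | completeSucc (C : Call Ptr Dat) (d : Ptr) (δ : Desc Ptr Dat) (k : Pc Ptr Dat)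
      (hk : LoopPc C k) : CodePc C (.completeSucc d δ k)
  | completeUndo (C : Call Ptr Dat) (d : Ptr) (δ : Desc Ptr Dat) (k : Pc Ptr Dat)
      (hk : LoopPc C k) : CodePc C (.completeUndo d δ k)
  | rwriteCas (p : Ptr) (v old : Word Ptr Dat) (ho : ¬ old.isRdesc) :
      CodePc (.rwrite p v) (.rwriteCas p v old)
  | rreadc (p : Ptr) : CodePc (.rreadc p) (.rreadcRead p)
  | rcasc (p : Ptr) (e n : Word Ptr Dat) : CodePc (.rcasc p e n) (.rcascCas p e n)
  | rwritec (p : Ptr) (v : Word Ptr Dat) : CodePc (.rwritec p v) (.rwritecWrite p v)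
  | rallocC (v : Word Ptr Dat) : CodePc (.ralloc v .cptr) (.rallocC v)
  | rallocD (v : Word Ptr Dat) : CodePc (.ralloc v .dptr) (.rallocD v)

/-- The control point to which the innermost running call of `complete` returns; outside
`complete`, the control point itself. -/
def Pc.cont : Pc Ptr Dat → Pc Ptr Dat
  | .completeRead _ k => k
  | .completePt1 _ _ k => k
  | .completeSucc _ _ k => k
  | .completeUndo _ _ k => k
  | pc => pc

theorem LoopPc.cont_eq {C : Call Ptr Dat} {k : Pc Ptr Dat} (h : LoopPc C k) : k.cont = k := by
  cases h <;> rfl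

theorem Call.entry_ne_ret (C : Call Ptr Dat) (w : Word Ptr Dat) : C.entry ≠ .ret w := by
  cases C with
  | ralloc v k => cases k <;> simp [Call.entry]
  | _ => simp [Call.entry]

theorem Call.line_entry (C : Call Ptr Dat) :
    C.entry.line ≠ some .completeRead ∧ C.entry.line ≠ some .completePt1 ∧
    C.entry.line ≠ some .completeSucc ∧ C.entry.line ≠ some .completeUndo ∧
    C.entry.line ≠ some .rwriteCas := by
  cases C with
  | ralloc v k => cases k <;> simp [Call.entry, Pc.line]
  | _ => simp [Call.entry, Pc.line]

variable [PtrTags Ptr]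

theorem Call.codePc_entry (C : Call Ptr Dat) : CodePc C C.entry := by
  cases C with
  | ralloc v k =>
    cases k with
    | cptr => exact .rallocC v
    | dptr => exact .rallocD v
  | rdcss δ => exact .rdcssAlloc δ
  | rcas p e n => exact .loop _ _ (.rcas p e n)
  | rwrite p v => exact .loop _ _ (.rwrite p v)
  | rread p => exact .loop _ _ (.rread p)
  | rcasc p e n => exact .rcasc p e n
  | rwritec p v => exact .rwritec p v
  | rreadc p => exact .rreadc p

theorem CodePc.next {C : Call Ptr Dat} {pc pc' : Pc Ptr Dat} {c : Cell Ptr Dat}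
    (h : CodePc C pc) (hn : Next pc c pc') : CodePc C pc' := by
  cases hn with
  | rdcssAlloc δ d => cases h with
    | rdcssAlloc => exact .loop _ _ (.rdcss d δ)
    | loop _ _ hk => cases hk
  | rdcssHelp d δ q hq => cases h with
    | loop _ _ hk => exact .completeRead _ _ _ hk
  | rdcssSelf d δ old ho he => cases h with
    | loop _ _ hk => cases hk; subst he; exact .completeRead _ _ _ (.ret _)
  | completeRead d k δ => cases h with
    | loop _ _ hk => cases hk
    | completeRead _ _ _ hk => exact .completePt1 _ _ _ _ hk
  | completeMatch d δ k x hx => cases h with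
    | loop _ _ hk => cases hk
    | completePt1 _ _ _ _ hk => exact .completeSucc _ _ _ _ hk
  | completeMismatch d δ k x hx => cases h with
    | loop _ _ hk => cases hk
    | completePt1 _ _ _ _ hk => exact .completeUndo _ _ _ _ hk
  | completeSucc d δ k w => cases h with
    | loop _ _ hk => cases hk
    | completeSucc _ _ _ _ hk => exact .loop _ _ hk
  | completeUndo d δ k w => cases h with
    | loop _ _ hk => cases hk
    | completeUndo _ _ _ _ hk => exact .loop _ _ hk
  | rreadHelp p q hq => cases h with
    | loop _ _ hk => exact .completeRead _ _ _ hk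
  | rcasHelp p e n q hq => cases h with
    | loop _ _ hk => exact .completeRead _ _ _ hk
  | rwriteHelp p v q hq => cases h with
    | loop _ _ hk => exact .completeRead _ _ _ hk
  | rwriteTry p v old ho => cases h with
    | loop _ _ hk => cases hk; exact .rwriteCas _ _ _ ho
  | rwriteAgain p v old x hx => cases h with
    | loop _ _ hk => cases hk
    | rwriteCas => exact .loop _ _ (.rwrite p v)
  | rdcssFail | rreadDone | rcasDone | rwriteDone | rreadc | rcasc | rwritec | rallocC
  | rallocD => exact .ret _ _

/-- The invocation that executes a control point outside `complete`, as far as the local variables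
determine it. -/
def Pc.caller : Pc Ptr Dat → Option (Call Ptr Dat)
  | .rdcssAlloc δ => some (.rdcss δ)
  | .rdcssCas _ δ => some (.rdcss δ)
  | .rreadRead p => some (.rread p)
  | .rcasCas p e n => some (.rcas p e n)
  | .rwriteRead p v => some (.rwrite p v)
  | .rwriteCas p v _ => some (.rwrite p v)
  | .rreadcRead p => some (.rreadc p)
  | .rcascCas p e n => some (.rcasc p e n)
  | .rwritecWrite p v => some (.rwritec p v)
  | .rallocC v => some (.ralloc v .cptr)
  | .rallocD v => some (.ralloc v .dptr)
  | _ => none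

theorem CodePc.caller_eq {C C' : Call Ptr Dat} {pc : Pc Ptr Dat} (h : CodePc C pc)
    (hc : pc.caller = some C') : C = C' := by
  cases h with
  | loop _ _ hk => cases hk <;> simp_all [Pc.caller]
  | _ => simp_all [Pc.caller]

/-- Once the innermost `complete` is to be followed by a return, this remains so. -/
theorem Next.cont_ret {pc pc' : Pc Ptr Dat} {c : Cell Ptr Dat} {w : Word Ptr Dat}
    (hn : Next pc c pc') (h : pc.cont = .ret w) : pc'.cont = .ret w := by
  cases hn <;> simp_all [Pc.cont]

theorem Run.lt_start {pc : Pc Ptr Dat} {t : ℕ} {l : List (RepRec Ptr Dat)}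
    {r : Option (ℕ × Word Ptr Dat)} (h : Run pc t l r) :
    ∀ j (hj : j < l.length), t < l[j].start := by
  induction h with
  | cut | ret => intro j hj; simp at hj
  | pending pc t s hpc hs => intro j hj; simpa using hs
  | step pc pc' t s e c l r hs he hn hr ih =>
    rintro (_ | j) hj
    · simpa using hs
    · have := ih j (by simpa using hj)
      simp only [List.getElem_cons_succ]
      omega

theorem Run.pc_zero {pc : Pc Ptr Dat} {t : ℕ} {l : List (RepRec Ptr Dat)}
    {r : Option (ℕ × Word Ptr Dat)} (h : Run pc t l r) (hj : 0 < l.length) : l[0].pc = pc := by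
  cases h with
  | cut | ret => simp at hj
  | pending | step => rfl

theorem Run.start_le {pc : Pc Ptr Dat} {t : ℕ} {l : List (RepRec Ptr Dat)}
    {r : Option (ℕ × Word Ptr Dat)} (h : Run pc t l r) :
    ∀ a ∈ l, ∀ e c, a.resp = some (e, c) → a.start ≤ e := by
  induction h with
  | cut | ret => simp
  | pending pc t s hpc hs => simp
  | step pc pc' t s e c l r hs he hn hr ih =>
    intro a ha e' c' hac
    rcases List.mem_cons.1 ha with rfl | ha
    · simp only [Option.some.injEq, Prod.mk.injEq] at hac
      obtain ⟨rfl, -⟩ := hac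
      exact he
    · exact ih a ha e' c' hac

theorem Run.next {pc : Pc Ptr Dat} {t : ℕ} {l : List (RepRec Ptr Dat)}
    {r : Option (ℕ × Word Ptr Dat)} (h : Run pc t l r) :
    ∀ j (hj : j + 1 < l.length), ∃ e c, l[j].resp = some (e, c) ∧ e < l[j + 1].start ∧
      Next l[j].pc c l[j + 1].pc := by
  induction h with
  | cut | ret => intro j hj; simp at hj
  | pending pc t s hpc hs => intro j hj; simp at hj
  | step pc pc' t s e c l r hs he hn hr ih =>
    rintro (_ | j) hj
    · have hj' : 0 < l.length := by simpa using hj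
      have h0 := hr.pc_zero hj'
      exact ⟨e, c, rfl, hr.lt_start 0 hj', by simpa [h0] using hn⟩
    · exact ih j (by simpa using hj)

theorem Run.last {pc : Pc Ptr Dat} {t : ℕ} {l : List (RepRec Ptr Dat)}
    {r : Option (ℕ × Word Ptr Dat)} (h : Run pc t l r) :
    ∀ t' w, r = some (t', w) → t ≤ t' ∧ ((l = [] ∧ pc = .ret w) ∨
      ∃ j, ∃ hj : j < l.length, j + 1 = l.length ∧ ∃ e c, l[j].resp = some (e, c) ∧ e ≤ t' ∧
        Next l[j].pc c (.ret w)) := by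
  induction h with
  | cut | pending => intro t' w h; cases h
  | ret w t e he =>
    intro t' w' h
    simp only [Option.some.injEq, Prod.mk.injEq] at h
    obtain ⟨rfl, rfl⟩ := h
    exact ⟨he, .inl ⟨rfl, rfl⟩⟩
  | step pc pc' t s e c l r hs he hn hr ih =>
    intro t' w h
    obtain ⟨hle, hor⟩ := ih t' w h
    refine ⟨by omega, .inr ?_⟩
    rcases hor with ⟨rfl, rfl⟩ | ⟨j, hj, hj', e', c', h1, h2, h3⟩
    · exact ⟨0, by simp, rfl, e, c, rfl, hle, hn⟩
    · exact ⟨j + 1, by simpa using hj, by simpa using hj', e', c', h1, h2, h3⟩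

end ControlFlow

/-! ### Program order in a history -/

namespace History

variable {Ptr Dat Thr Ev : Type*} (H : History Ptr Dat Thr Ev)

/-- The control point at which a rep event is executed. -/
def pc (a : H.Rp) : Pc Ptr Dat := (H.rep a).pc

theorem op_eq (a : H.Rp) : H.op a = (H.pc a).op := rfl

theorem line_eq (a : H.Rp) : H.line a = (H.pc a).line := rfl

/-- `b` is executed next after `a` within the same event. -/
def NextRep (a b : H.Rp) : Prop := a.1 = b.1 ∧ (a.2 : ℕ) + 1 = b.2

variable {H}

theorem rp_ext {a b : H.Rp} (h : a.1 = b.1) (h' : (a.2 : ℕ) = b.2) : a = b := by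
  obtain ⟨x, i⟩ := a
  obtain ⟨y, j⟩ := b
  obtain rfl : x = y := h
  obtain rfl : i = j := Fin.ext h'
  rfl

theorem exists_pred (a : H.Rp) (h : (a.2 : ℕ) ≠ 0) : ∃ b, H.NextRep b a :=
  ⟨⟨a.1, ⟨a.2 - 1, by have := a.2.2; omega⟩⟩, rfl, by simp only; omega⟩

variable [PtrTags Ptr]

namespace IsExecution

theorem pc_zero (hH : H.IsExecution) {a : H.Rp} (h : (a.2 : ℕ) = 0) :
    H.pc a = (H.call a.1).entry := by
  obtain ⟨x, ⟨j, hj⟩⟩ := a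
  obtain rfl : j = 0 := h
  exact (hH.run x).pc_zero hj

theorem start_lt (hH : H.IsExecution) (a : H.Rp) : H.start a.1 < H.rstart a :=
  (hH.run a.1).lt_start a.2 a.2.2

theorem rstart_le (hH : H.IsExecution) {a : H.Rp} {e : ℕ} (h : H.rend a = some e) :
    H.rstart a ≤ e := by
  obtain ⟨⟨e', c⟩, h1, rfl⟩ := Option.map_eq_some_iff.1 h
  exact (hH.run a.1).start_le _ (List.getElem_mem _) e' c h1

theorem out_of_resp (hH : H.IsExecution) {a : H.Rp} {e : ℕ} {c : Cell Ptr Dat}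
    (h : (H.rep a).resp = some (e, c)) : H.Out a c := hH.lin_finished a e c h

theorem next (hH : H.IsExecution) {a b : H.Rp} (h : H.NextRep a b) :
    ∃ e c, H.rend a = some e ∧ e < H.rstart b ∧ H.Out a c ∧ Next (H.pc a) c (H.pc b) := by
  obtain ⟨x, ⟨j, hj⟩⟩ := a
  obtain ⟨y, ⟨j', hj'⟩⟩ := b
  obtain ⟨rfl, h2⟩ := h
  obtain rfl : j + 1 = j' := h2
  obtain ⟨e, c, h1, h2, h3⟩ := (hH.run x).next j hj'
  exact ⟨e, c, by simp only [rend, rep, List.get_eq_getElem, h1, Option.map_some], h2,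
    hH.out_of_resp h1, h3⟩

/-- Within an event the rep events are executed one after another. -/
theorem rend_lt_rstart (hH : H.IsExecution) {a b : H.Rp} (h : a.1 = b.1)
    (hab : (a.2 : ℕ) < b.2) : ∃ e, H.rend a = some e ∧ e < H.rstart b := by
  obtain ⟨n, hn⟩ : ∃ n, (a.2 : ℕ) + n + 1 = b.2 := ⟨b.2 - a.2 - 1, by omega⟩
  induction n generalizing b with
  | zero =>
    obtain ⟨e, c, h1, h2, -⟩ := hH.next (a := a) (b := b) ⟨h, by omega⟩
    exact ⟨e, h1, h2⟩
  | succ n ih =>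
    obtain ⟨b', hb'⟩ := exists_pred b (by omega)
    obtain ⟨e, h1, h2⟩ := ih (b := b') (by rw [h, hb'.1]) (by have := hb'.2; omega)
      (by have := hb'.2; omega)
    obtain ⟨e', c, h3, h4, -⟩ := hH.next hb'
    have := hH.rstart_le h3
    exact ⟨e, h1, by omega⟩

theorem rstart_lt_rstart (hH : H.IsExecution) {a b : H.Rp} (h : a.1 = b.1)
    (hab : (a.2 : ℕ) < b.2) : H.rstart a < H.rstart b := by
  obtain ⟨e, h1, h2⟩ := hH.rend_lt_rstart h hab
  have := hH.rstart_le h1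
  omega

/-- All rep events of a terminated event are finished. -/
theorem finished (hH : H.IsExecution) {a : H.Rp} {t : ℕ} (h : H.fin a.1 = some t) :
    ∃ e, H.rend a = some e ∧ e ≤ t := by
  obtain ⟨⟨t', w⟩, h1, h2⟩ := Option.map_eq_some_iff.1 h
  obtain rfl : t' = t := h2
  obtain ⟨-, hor⟩ := (hH.run a.1).last t' w h1
  rcases hor with ⟨h0, -⟩ | ⟨j, hj, hj', e, c, h2, h3, -⟩
  · have := a.2.2
    simp only [h0, List.length_nil] at this
    omega
  · have hb : H.rend ⟨a.1, ⟨j, hj⟩⟩ = some e := by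
      simp only [rend, rep, List.get_eq_getElem, h2, Option.map_some]
    rcases Nat.lt_or_ge a.2 j with hlt | hge
    · obtain ⟨e', h4, h5⟩ := hH.rend_lt_rstart (a := a) (b := ⟨a.1, ⟨j, hj⟩⟩) rfl hlt
      have := hH.rstart_le hb
      exact ⟨e', h4, by omega⟩
    · have := a.2.2
      have ha : a = ⟨a.1, ⟨j, hj⟩⟩ := rp_ext rfl (by simp only; omega)
      exact ⟨e, by rw [ha]; exact hb, h3⟩

/-- The last rep event of a terminated event leads to the return of its output. -/
theorem exists_last (hH : H.IsExecution) {x : Ev} {w : Word Ptr Dat} (h : H.out x = some w) :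
    ∃ a : H.Rp, a.1 = x ∧ ∃ c, H.Out a c ∧ Next (H.pc a) c (.ret w) := by
  obtain ⟨⟨t', w'⟩, h1, h2⟩ := Option.map_eq_some_iff.1 h
  obtain rfl : w' = w := h2
  obtain ⟨-, hor⟩ := (hH.run x).last t' w' h1
  rcases hor with ⟨-, h0⟩ | ⟨j, hj, hj', e, c, h2, h3, h4⟩
  · exact absurd h0 (Call.entry_ne_ret _ _)
  · exact ⟨⟨x, ⟨j, hj⟩⟩, rfl, c, hH.out_of_resp (e := e) h2, h4⟩

theorem rp_induction (hH : H.IsExecution) {P : H.Rp → Prop}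
    (zero : ∀ a, H.pc a = (H.call a.1).entry → P a)
    (succ : ∀ a b e c, H.NextRep a b → H.rend a = some e → e < H.rstart b → H.Out a c →
      Next (H.pc a) c (H.pc b) → P a → P b) (a : H.Rp) : P a := by
  obtain ⟨n, hn⟩ : ∃ n, (a.2 : ℕ) = n := ⟨_, rfl⟩
  induction n generalizing a with
  | zero => exact zero a (hH.pc_zero hn)
  | succ n ih =>
    obtain ⟨b, hb⟩ := exists_pred a (by omega)
    obtain ⟨e, c, h1, h2, h3, h4⟩ := hH.next hb
    exact succ b a e c hb h1 h2 h3 h4 (ih b (by have := hb.2; omega))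

theorem codePc (hH : H.IsExecution) (a : H.Rp) : CodePc (H.call a.1) (H.pc a) := by
  induction a using hH.rp_induction with
  | zero a h => rw [h]; exact Call.codePc_entry _
  | succ a b e c hab _ _ _ hn ih => rw [← hab.1]; exact ih.next hn

/-- A rep event that is not the first one of its event has a predecessor. -/
theorem pred_of_ne_entry (hH : H.IsExecution) {a : H.Rp} (h : H.pc a ≠ (H.call a.1).entry) :
    ∃ b e c, H.NextRep b a ∧ H.rend b = some e ∧ e < H.rstart a ∧ H.Out b c ∧
      Next (H.pc b) c (H.pc a) := by
  obtain ⟨b, hb⟩ := exists_pred a (fun h0 => h (hH.pc_zero h0))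
  obtain ⟨e, c, h'⟩ := hH.next hb
  exact ⟨b, e, c, hb, h'⟩

theorem pred_completeSucc (hH : H.IsExecution) {a : H.Rp} {d : Ptr} {δ : Desc Ptr Dat}
    {k : Pc Ptr Dat} (h : H.pc a = .completeSucc d δ k) :
    ∃ b, H.NextRep b a ∧ H.pc b = .completePt1 d δ k ∧ H.Out b (.word δ.exp1) := by
  obtain ⟨b, e, c, hb, -, -, ho, hn⟩ := hH.pred_of_ne_entry (a := a)
    (fun h' => (Call.line_entry _).2.2.1 (by rw [← h', h]; rfl))
  refine ⟨b, hb, ?_⟩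
  have hc := hH.codePc b
  generalize H.call b.1 = C at hc
  rw [h] at hn
  generalize H.pc b = pcb at hn hc ⊢
  cases hn with
  | completeMatch _ _ _ x hx => subst hx; exact ⟨rfl, ho⟩
  | completeSucc | completeUndo =>
    cases hc <;> rename_i hk <;> cases hk

theorem pred_completeUndo (hH : H.IsExecution) {a : H.Rp} {d : Ptr} {δ : Desc Ptr Dat}
    {k : Pc Ptr Dat} (h : H.pc a = .completeUndo d δ k) :
    ∃ b, H.NextRep b a ∧ H.pc b = .completePt1 d δ k ∧ ∃ v, v ≠ δ.exp1 ∧ H.Out b (.word v) := by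
  obtain ⟨b, e, c, hb, -, -, ho, hn⟩ := hH.pred_of_ne_entry (a := a)
    (fun h' => (Call.line_entry _).2.2.2.1 (by rw [← h', h]; rfl))
  refine ⟨b, hb, ?_⟩
  have hc := hH.codePc b
  generalize H.call b.1 = C at hc
  rw [h] at hn
  generalize H.pc b = pcb at hn hc ⊢
  cases hn with
  | completeMismatch _ _ _ x hx => exact ⟨rfl, x, hx, ho⟩
  | completeSucc | completeUndo =>
    cases hc <;> rename_i hk <;> cases hk

theorem pred_completePt1 (hH : H.IsExecution) {a : H.Rp} {d : Ptr} {δ : Desc Ptr Dat}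
    {k : Pc Ptr Dat} (h : H.pc a = .completePt1 d δ k) :
    ∃ b e, H.NextRep b a ∧ H.rend b = some e ∧ e < H.rstart a ∧ H.pc b = .completeRead d k ∧
      H.Out b (.desc δ) := by
  obtain ⟨b, e, c, hb, he, hlt, ho, hn⟩ := hH.pred_of_ne_entry (a := a)
    (fun h' => (Call.line_entry _).2.1 (by rw [← h', h]; rfl))
  refine ⟨b, e, hb, he, hlt, ?_⟩
  have hc := hH.codePc b
  generalize H.call b.1 = C at hc
  rw [h] at hn
  generalize H.pc b = pcb at hn hc ⊢
  cases hn with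
  | completeRead => exact ⟨rfl, ho⟩
  | completeSucc | completeUndo =>
    cases hc <;> rename_i hk <;> cases hk

/-- `complete(d)` is called either by a thread that has found the descriptor pointer `d` in the
memory, or by the owner of `d` after its successful CAS. -/
theorem pred_completeRead (hH : H.IsExecution) {a : H.Rp} {d : Ptr} {k : Pc Ptr Dat}
    (h : H.pc a = .completeRead d k) :
    ∃ b e, H.NextRep b a ∧ H.rend b = some e ∧ e < H.rstart a ∧
      ((H.Out b (.word (.ptr d)) ∧ PtrTags.rdesc d ∧
          (H.line b = some .rdcssCas ∨ H.line b = some .rreadRead ∨ H.line b = some .rcasCas ∨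
            H.line b = some .rwriteRead) ∧ ∀ w, k ≠ .ret w) ∨
        ∃ δ, H.pc b = .rdcssCas d δ ∧ H.Out b (.word δ.exp2)) := by
  obtain ⟨b, e, c, hb, he, hlt, ho, hn⟩ := hH.pred_of_ne_entry (a := a)
    (fun h' => (Call.line_entry _).1 (by rw [← h', h]; rfl))
  refine ⟨b, e, hb, he, hlt, ?_⟩
  have hc := hH.codePc b
  generalize H.call b.1 = C at hc
  rw [line_eq]
  rw [h] at hn
  generalize H.pc b = pcb at hn hc ⊢
  cases hn with
  | rdcssSelf _ δ old ho' he => subst he; exact .inr ⟨δ, rfl, ho⟩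
  | rdcssHelp _ _ _ hq => exact .inl ⟨ho, hq, by simp [Pc.line], by simp⟩
  | rreadHelp _ _ hq => exact .inl ⟨ho, hq, by simp [Pc.line], by simp⟩
  | rcasHelp _ _ _ _ hq => exact .inl ⟨ho, hq, by simp [Pc.line], by simp⟩
  | rwriteHelp _ _ _ hq => exact .inl ⟨ho, hq, by simp [Pc.line], by simp⟩
  | completeSucc | completeUndo =>
    cases hc <;> rename_i hk <;> cases hk

theorem pred_rwriteCas (hH : H.IsExecution) {a : H.Rp} {p : Ptr} {v old : Word Ptr Dat}
    (h : H.pc a = .rwriteCas p v old) :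
    ∃ b, H.NextRep b a ∧ H.pc b = .rwriteRead p v ∧ H.Out b (.word old) := by
  obtain ⟨b, e, c, hb, he, hlt, ho, hn⟩ := hH.pred_of_ne_entry (a := a) 
    (fun h' => (Call.line_entry _).2.2.2.2 (by rw [← h', h]; rfl))
  refine ⟨b, hb, ?_⟩
  have hc := hH.codePc b
  generalize H.call b.1 = C at hc
  rw [h] at hn
  generalize H.pc b = pcb at hn hc ⊢
  cases hn with
  | rwriteTry => exact ⟨rfl, ho⟩
  | completeSucc | completeUndo =>
    cases hc <;> rename_i hk <;> cases hk

/-- The loop of `rdcss` works with the descriptor pointer allocated by the same event. -/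
theorem alloc_of_cont_rdcssCas (hH : H.IsExecution) {a : H.Rp} {d : Ptr} {δ : Desc Ptr Dat}
    (h : (H.pc a).cont = .rdcssCas d δ) :
    ∃ i : H.Rp, i.1 = a.1 ∧ H.pc i = .rdcssAlloc δ ∧ H.Out i (.word (.ptr d)) ∧
      ∃ e, H.rend i = some e ∧ e < H.rstart a := by
  induction a using hH.rp_induction with
  | zero a h0 =>
    rw [h0] at h
    generalize H.call a.1 = C at h
    cases C with
    | ralloc v k => cases k <;> simp [Call.entry, Pc.cont] at h
    | _ => simp [Call.entry, Pc.cont] at h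
  | succ a b e c hab he hlt ho hn ih =>
    have key : (H.pc a).cont = .rdcssCas d δ → ∃ i : H.Rp, i.1 = b.1 ∧ H.pc i = .rdcssAlloc δ ∧
        H.Out i (.word (.ptr d)) ∧ ∃ e, H.rend i = some e ∧ e < H.rstart b := by
      intro h'
      obtain ⟨i, h1, h2, h3, e', h4, h5⟩ := ih h'
      have := hH.rstart_le he
      exact ⟨i, h1.trans hab.1, h2, h3, e', h4, by omega⟩
    by_cases hz : (H.pc a).cont = .rdcssCas d δ
    · exact key hz
    have hc := hH.codePc a
    generalize H.call a.1 = C at hc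
    rcases hpa : H.pc a with _ | _ | _ | _ | _ | _ | _ | _ | _ | _ | _ | _ | _ | _ | _ | _ <;>
      rw [hpa] at hn hz hc <;> generalize hpb : H.pc b = pcb at hn h <;> cases hn <;>
      simp_all [Pc.cont, -Sigma.exists]
    · refine ⟨a, hab.1, hpa, ho, e, he, hlt⟩
    all_goals
      cases hc <;> rename_i hk
      · cases hk
      · exact absurd (hk.cont_eq ▸ h) hz

theorem alloc_of_rdcssCas (hH : H.IsExecution) {a : H.Rp} {d : Ptr} {δ : Desc Ptr Dat}
    (h : H.pc a = .rdcssCas d δ) :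
    ∃ i : H.Rp, i.1 = a.1 ∧ H.pc i = .rdcssAlloc δ ∧ H.Out i (.word (.ptr d)) ∧
      ∃ e, H.rend i = some e ∧ e < H.rstart a :=
  hH.alloc_of_cont_rdcssCas (by rw [h]; rfl)

/-! ### Threads -/

/-- Two rep events of a thread that start at the same time are equal. -/
theorem eq_of_rstart_eq (hH : H.IsExecution) {a b : H.Rp} (ht : H.thr a = H.thr b)
    (h : H.rstart a = H.rstart b) : a = b := by
  have aux : ∀ a b : H.Rp, H.before a.1 b.1 → H.rstart a < H.rstart b := by
    rintro a b ⟨t, h1, h2⟩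
    obtain ⟨e, h3, h4⟩ := hH.finished h1
    have := hH.rstart_le h3
    have := hH.start_lt b
    omega
  by_cases hab : a.1 = b.1
  · rcases Nat.lt_trichotomy a.2 b.2 with h1 | h1 | h1
    · have := hH.rstart_lt_rstart hab h1; omega
    · exact rp_ext hab h1
    · have := hH.rstart_lt_rstart hab.symm h1; omega
  · rcases hH.sequential _ _ hab ht with h1 | h1
    · have := aux _ _ h1; omega
    · have := aux _ _ h1; omega

theorem lastRead_unique (hH : H.IsExecution) {r r' c : H.Rp} (h : H.LastRead r c)
    (h' : H.LastRead r' c) : r = r' := by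
  obtain ⟨⟨⟨p, h1⟩, h2, h3⟩, h4⟩ := h
  obtain ⟨⟨⟨p', h1'⟩, h2', h3'⟩, h4'⟩ := h'
  have := h4 r' p' h1' h2' h3'
  have := h4' r p h1 h2 h3
  exact hH.eq_of_rstart_eq (h2.trans h2'.symm) (by omega)

/-- A read that immediately precedes `c` in the program is the last read before `c`. -/
theorem lastRead_of_nextRep (hH : H.IsExecution) {r c : H.Rp} {p : Ptr} (h : H.NextRep r c)
    (hr : H.op r = some (.deref p)) : H.LastRead r c := by
  have ht : H.thr r = H.thr c := by simp only [thr, h.1]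
  refine ⟨⟨⟨p, hr⟩, ht, hH.rstart_lt_rstart h.1 (by have := h.2; omega)⟩, ?_⟩
  intro s q hs hst hlt
  by_cases hsc : s.1 = c.1
  · have h1 : (s.2 : ℕ) < c.2 := by
      rcases Nat.lt_trichotomy s.2 c.2 with h1 | h1 | h1
      · exact h1
      · obtain rfl := rp_ext hsc h1; omega
      · have := hH.rstart_lt_rstart hsc.symm h1; omega
    rcases Nat.lt_or_ge s.2 r.2 with h2 | h2
    · exact (hH.rstart_lt_rstart (hsc.trans h.1.symm) h2).le
    · obtain rfl : s = r := rp_ext (hsc.trans h.1.symm) (by have := h.2; omega)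
      exact le_rfl
  · rcases hH.sequential _ _ hsc hst with ⟨t, h1, h2⟩ | ⟨t, h1, h2⟩
    · obtain ⟨e, h3, h4⟩ := hH.finished h1
      have := hH.rstart_le h3
      have := hH.start_lt r
      rw [h.1] at this
      omega
    · obtain ⟨e, h3, h4⟩ := hH.finished h1
      have := hH.rstart_le h3
      have := hH.start_lt s
      omega

end IsExecution

end History

namespace History

/-! ### Positions in the linearization -/

variable {Ptr Dat Thr Ev : Type*} {H : History Ptr Dat Thr Ev}

open Classical in
/-- The position of a rep event in the linearization (junk outside its domain). -/
noncomputable def pos (H : History Ptr Dat Thr Ev) (a : H.Rp) : ℕ :=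
  (H.lin.map Prod.fst).idxOf a

theorem Out.dom {a : H.Rp} {c : Cell Ptr Dat} (h : H.Out a c) : a ∈ H.dom := ⟨c, h⟩

/-- `Mutates pc p c c'`: a primitive executed at `pc` with output `c` stores `c'` into `p`. -/
inductive Mutates : Pc Ptr Dat → Ptr → Cell Ptr Dat → Cell Ptr Dat → Prop
  | rdcssAlloc (δ : Desc Ptr Dat) (p : Ptr) :
      Mutates (.rdcssAlloc δ) p (.word (.ptr p)) (.desc δ)
  | rdcssCas (d : Ptr) (δ : Desc Ptr Dat) :
      Mutates (.rdcssCas d δ) δ.pt2 (.word δ.exp2) (.word (.ptr d))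
  | completeSucc (d : Ptr) (δ : Desc Ptr Dat) (k : Pc Ptr Dat) :
      Mutates (.completeSucc d δ k) δ.pt2 (.word (.ptr d)) (.word δ.new2)
  | completeUndo (d : Ptr) (δ : Desc Ptr Dat) (k : Pc Ptr Dat) :
      Mutates (.completeUndo d δ k) δ.pt2 (.word (.ptr d)) (.word δ.exp2)
  | rcasCas (p : Ptr) (e n : Word Ptr Dat) : Mutates (.rcasCas p e n) p (.word e) (.word n)
  | rwriteCas (p : Ptr) (v old : Word Ptr Dat) :
      Mutates (.rwriteCas p v old) p (.word old) (.word v)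
  | rcascCas (p : Ptr) (e n : Word Ptr Dat) : Mutates (.rcascCas p e n) p (.word e) (.word n)
  | rwritecWrite (p : Ptr) (v : Word Ptr Dat) (c : Cell Ptr Dat) :
      Mutates (.rwritecWrite p v) p c (.word v)
  | rallocC (p : Ptr) (v : Word Ptr Dat) : Mutates (.rallocC v) p (.word (.ptr p)) (.word v)
  | rallocD (p : Ptr) (v : Word Ptr Dat) : Mutates (.rallocD v) p (.word (.ptr p)) (.word v)

/-- `a` stores `c` into the cell of `p`, by a successful CAS, a write, or an allocation. -/
def Stores (H : History Ptr Dat Thr Ev) (a : H.Rp) (p : Ptr) (c : Cell Ptr Dat) : Prop :=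
  ∃ o, H.Out a o ∧ Mutates (H.pc a) p o c

theorem Stores.dom {a : H.Rp} {p : Ptr} {c : Cell Ptr Dat} (h : H.Stores a p c) : a ∈ H.dom :=
  h.choose_spec.1.dom

theorem stores_iff {a : H.Rp} {p : Ptr} :
    (∃ c, H.Stores a p c) ↔ H.Writes a p ∨ H.Allocs a p := by
  unfold Stores Writes Allocs CasOk
  rw [op_eq]
  constructor
  · rintro ⟨c, o, ho, hm⟩
    generalize H.pc a = pca at hm ⊢
    cases hm with
    | rdcssAlloc | rallocC | rallocD => exact .inr ⟨⟨_, _, rfl⟩, ho⟩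
    | rwritecWrite => exact .inl (.inr ⟨_, rfl, ho.dom⟩)
    | _ => exact .inl (.inl ⟨_, _, rfl, ho⟩)
  · generalize H.pc a = pca
    rintro ((⟨e, n, h, ho⟩ | ⟨w, h, c, ho⟩) | ⟨⟨c, k, h⟩, ho⟩)
    · cases pca <;> simp only [Pc.op, Option.some.injEq, Op.cas.injEq, reduceCtorEq] at h <;>
        obtain ⟨rfl, rfl, rfl⟩ := h <;> exact ⟨_, _, ho, by constructor⟩
    · cases pca <;> simp only [Pc.op, Option.some.injEq, Op.write.injEq, reduceCtorEq] at h
      obtain ⟨rfl, rfl⟩ := h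
      exact ⟨_, _, ho, by constructor⟩
    · cases pca <;> simp only [Pc.op, Option.some.injEq, Op.alloc.injEq, reduceCtorEq] at h <;>
        exact ⟨_, _, ho, by constructor⟩

theorem allocs_of_rdcssAlloc {i : H.Rp} {δ : Desc Ptr Dat} {d : Ptr}
    (h : H.pc i = .rdcssAlloc δ) (ho : H.Out i (.word (.ptr d))) : H.Allocs i d :=
  ⟨⟨.desc δ, .dptr, by rw [op_eq, h]; rfl⟩, ho⟩

variable [PtrTags Ptr]

namespace IsExecution

theorem out_unique (hH : H.IsExecution) {a : H.Rp} {c c' : Cell Ptr Dat} (h : H.Out a c)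
    (h' : H.Out a c') : c = c' := by
  have := List.inj_on_of_nodup_map hH.lin_nodup h h' rfl
  exact (Prod.mk.inj this).2

theorem word_unique (hH : H.IsExecution) {a : H.Rp} {v v' : Word Ptr Dat}
    (h : H.Out a (.word v)) (h' : H.Out a (.word v')) : v = v' :=
  Cell.word.inj (hH.out_unique h h')

theorem ptr_unique (hH : H.IsExecution) {a : H.Rp} {p p' : Ptr}
    (h : H.Out a (.word (.ptr p))) (h' : H.Out a (.word (.ptr p'))) : p = p' :=
  Word.ptr.inj (hH.word_unique h h')

theorem pos_of_get (hH : H.IsExecution) {a : H.Rp} {c : Cell Ptr Dat} {i : ℕ}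
    (h : H.lin[i]? = some (a, c)) : H.pos a = i := by
  classical
  obtain ⟨hi, h1⟩ := List.getElem?_eq_some_iff.1 h
  have hi' : i < (H.lin.map Prod.fst).length := by simpa using hi
  have h2 : (H.lin.map Prod.fst)[i] = a := by simp [h1]
  have h3 := hH.lin_nodup.idxOf_getElem i hi'
  rw [h2] at h3
  unfold pos
  convert h3

theorem get_pos (hH : H.IsExecution) {a : H.Rp} {c : Cell Ptr Dat} (h : H.Out a c) :
    H.lin[H.pos a]? = some (a, c) := by
  obtain ⟨i, hi⟩ := List.mem_iff_getElem?.1 h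
  rw [hH.pos_of_get hi]
  exact hi

theorem lt_iff (hH : H.IsExecution) {a b : H.Rp} :
    H.lt a b ↔ a ∈ H.dom ∧ b ∈ H.dom ∧ H.pos a < H.pos b := by
  constructor
  · rintro ⟨i, j, c, c', hij, h1, h2⟩
    rw [hH.pos_of_get h1, hH.pos_of_get h2]
    exact ⟨⟨c, List.mem_of_getElem? h1⟩, ⟨c', List.mem_of_getElem? h2⟩, hij⟩
  · rintro ⟨⟨c, h1⟩, ⟨c', h2⟩, hlt⟩
    exact ⟨_, _, c, c', hlt, hH.get_pos h1, hH.get_pos h2⟩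

theorem pos_inj (hH : H.IsExecution) {a b : H.Rp} (ha : a ∈ H.dom) (hb : b ∈ H.dom)
    (h : H.pos a = H.pos b) : a = b := by
  obtain ⟨c, h1⟩ := ha
  obtain ⟨c', h2⟩ := hb
  have h3 := hH.get_pos h1
  rw [h, hH.get_pos h2] at h3
  simp only [Option.some.injEq, Prod.mk.injEq] at h3
  exact h3.1.symm

theorem le_iff (hH : H.IsExecution) {a b : H.Rp} :
    H.le a b ↔ a ∈ H.dom ∧ b ∈ H.dom ∧ H.pos a ≤ H.pos b := by
  unfold le
  rw [hH.lt_iff]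
  constructor
  · rintro (⟨h1, h2, h3⟩ | ⟨rfl, h⟩)
    · exact ⟨h1, h2, h3.le⟩
    · exact ⟨h, h, le_rfl⟩
  · rintro ⟨h1, h2, h3⟩
    rcases h3.lt_or_eq with h | h
    · exact .inl ⟨h1, h2, h⟩
    · exact .inr ⟨hH.pos_inj h1 h2 h, h1⟩

theorem pos_lt_of_rend (hH : H.IsExecution) {a b : H.Rp} {e : ℕ} (h : H.rend a = some e)
    (hlt : e < H.rstart b) (hb : b ∈ H.dom) : H.pos a < H.pos b :=
  (hH.lt_iff.1 (hH.lin_realtime a b e h hlt hb)).2.2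

/-- If every continuation after `a` is on its way to a return, so is every later control point of
the same event. -/
theorem cont_ret_of_lt (hH : H.IsExecution) {a b : H.Rp} {c : Cell Ptr Dat} (h : a.1 = b.1)
    (hab : (a.2 : ℕ) < b.2) (ho : H.Out a c)
    (hret : ∀ pc', Next (H.pc a) c pc' → ∃ w, pc'.cont = .ret w) :
    ∃ w, (H.pc b).cont = .ret w := by
  obtain ⟨n, hn⟩ : ∃ n, (a.2 : ℕ) + n + 1 = b.2 := ⟨b.2 - a.2 - 1, by omega⟩
  induction n generalizing b with
  | zero =>
    obtain ⟨e, c', -, -, h3, h4⟩ := hH.next (a := a) (b := b) ⟨h, by omega⟩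
    rw [hH.out_unique h3 ho] at h4
    exact hret _ h4
  | succ n ih =>
    obtain ⟨b', hb'⟩ := exists_pred b (by omega)
    obtain ⟨w, hw⟩ := ih (b := b') (by rw [h, hb'.1]) (by have := hb'.2; omega)
      (by have := hb'.2; omega)
    obtain ⟨e, c', -, -, -, h4⟩ := hH.next hb'
    exact ⟨w, h4.cont_ret hw⟩

/-- Two rep events of an event that are both outside `complete` and both followed by nothing but
the way to a return are equal. -/
theorem eq_of_final (hH : H.IsExecution) {a b : H.Rp} {c c' : Cell Ptr Dat} (h : a.1 = b.1)
    (ho : H.Out a c) (ho' : H.Out b c')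
    (hret : ∀ pc', Next (H.pc a) c pc' → ∃ w, pc'.cont = .ret w)
    (hret' : ∀ pc', Next (H.pc b) c' pc' → ∃ w, pc'.cont = .ret w)
    (hc : ∀ w, (H.pc a).cont ≠ .ret w) (hc' : ∀ w, (H.pc b).cont ≠ .ret w) : a = b := by
  rcases Nat.lt_trichotomy a.2 b.2 with h1 | h1 | h1
  · obtain ⟨w, hw⟩ := hH.cont_ret_of_lt h h1 ho hret
    exact absurd hw (hc' w)
  · exact rp_ext h h1
  · obtain ⟨w, hw⟩ := hH.cont_ret_of_lt h.symm h1 ho' hret'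
    exact absurd hw (hc w)

end IsExecution

/-! ### The memory along the linearization -/

theorem Legal.exists_heaps {R : Type*} {op : R → Option (Op Ptr Dat)} {h : Heap Ptr Dat}
    {l : List (R × Cell Ptr Dat)} (hl : Legal op h l) :
    ∃ hs : ℕ → Heap Ptr Dat, hs 0 = h ∧
      (∀ k a c, l[k]? = some (a, c) → ∃ o, op a = some o ∧ MemStep (hs k) o c (hs (k + 1))) ∧
      ∀ k, l[k]? = none → hs (k + 1) = hs k := by
  induction hl with
  | nil h => exact ⟨fun _ => h, rfl, by simp, fun _ _ => rfl⟩
  | cons h h' a o c l ho hm hl ih =>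
    obtain ⟨hs, h0, h1, h2⟩ := ih
    refine ⟨fun k => Nat.casesOn k h hs, rfl, ?_, ?_⟩
    · rintro (_ | k) a' c' hk
      · simp only [List.getElem?_cons_zero, Option.some.injEq, Prod.mk.injEq] at hk
        obtain ⟨rfl, rfl⟩ := hk
        exact ⟨o, ho, by simpa [h0] using hm⟩
      · exact h1 k a' c' (by simpa using hk)
    · rintro (_ | k) hk
      · simp at hk
      · exact h2 k (by simpa using hk)

namespace IsExecution

/-- The heap after the first `k` linearized rep events. -/
noncomputable def heap (hH : H.IsExecution) : ℕ → Heap Ptr Dat :=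
  (Legal.exists_heaps hH.lin_sound).choose

theorem heap_zero (hH : H.IsExecution) : hH.heap 0 = fun _ => none :=
  (Legal.exists_heaps hH.lin_sound).choose_spec.1

theorem memStep (hH : H.IsExecution) {a : H.Rp} {c : Cell Ptr Dat} (h : H.Out a c) :
    ∃ o, H.op a = some o ∧ MemStep (hH.heap (H.pos a)) o c (hH.heap (H.pos a + 1)) :=
  (Legal.exists_heaps hH.lin_sound).choose_spec.2.1 _ _ _ (hH.get_pos h)

theorem heap_deref (hH : H.IsExecution) {a : H.Rp} {p : Ptr} {c : Cell Ptr Dat}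
    (ho : H.op a = some (.deref p)) (h : H.Out a c) : hH.heap (H.pos a) p = some c := by
  obtain ⟨o, h1, h2⟩ := hH.memStep h
  rw [ho, Option.some.injEq] at h1
  subst h1
  generalize hH.heap (H.pos a + 1) = h' at h2
  cases h2
  assumption

theorem heap_cas (hH : H.IsExecution) {a : H.Rp} {p : Ptr} {e n : Word Ptr Dat}
    {c : Cell Ptr Dat} (ho : H.op a = some (.cas p e n)) (h : H.Out a c) :
    hH.heap (H.pos a) p = some c ∧ ∃ w, c = .word w := by
  obtain ⟨o, h1, h2⟩ := hH.memStep h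
  rw [ho, Option.some.injEq] at h1
  subst h1
  generalize hH.heap (H.pos a + 1) = h' at h2
  cases h2 <;> exact ⟨by assumption, _, rfl⟩

theorem heap_write (hH : H.IsExecution) {a : H.Rp} {p : Ptr} {w : Word Ptr Dat}
    (ho : H.op a = some (.write p w)) (h : a ∈ H.dom) : hH.heap (H.pos a) p ≠ none := by
  obtain ⟨c, h⟩ := h
  obtain ⟨o, h1, h2⟩ := hH.memStep h
  rw [ho, Option.some.injEq] at h1
  subst h1
  generalize hH.heap (H.pos a + 1) = h' at h2
  cases h2
  assumption

theorem heap_alloc (hH : H.IsExecution) {a : H.Rp} {cell c : Cell Ptr Dat} {k : PtKind}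
    (ho : H.op a = some (.alloc cell k)) (h : H.Out a c) :
    ∃ p, c = .word (.ptr p) ∧ hH.heap (H.pos a) p = none ∧ PtrTags.kind p = k ∧
      (PtrTags.rdesc p ↔ ∃ δ, cell = .desc δ) := by
  obtain ⟨o, h1, h2⟩ := hH.memStep h
  rw [ho, Option.some.injEq] at h1
  subst h1
  generalize hH.heap (H.pos a + 1) = h' at h2
  cases h2
  exact ⟨_, rfl, by assumption, by assumption, by assumption⟩

theorem heap_stores (hH : H.IsExecution) {a : H.Rp} {p : Ptr} {c : Cell Ptr Dat}
    (h : H.Stores a p c) : hH.heap (H.pos a + 1) p = some c := by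
  obtain ⟨out, h1, hm⟩ := h
  obtain ⟨o, h2, h3⟩ := hH.memStep h1
  rw [op_eq] at h2
  generalize H.pc a = pca at hm h2
  generalize hH.heap (H.pos a + 1) = h' at h3 ⊢
  cases hm <;> simp only [Pc.op, Option.some.injEq] at h2 <;> subst h2 <;> cases h3 <;>
    first
    | contradiction
    | simp [Heap.set]

theorem heap_succ (hH : H.IsExecution) (k : ℕ) (p : Ptr) :
    (∃ a c, H.Stores a p c ∧ H.pos a = k) ∨ hH.heap (k + 1) p = hH.heap k p := by
  by_contra! hcon
  obtain ⟨hno, hne⟩ := hcon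
  cases hk : H.lin[k]? with
  | none =>
    exact hne (congrFun ((Legal.exists_heaps hH.lin_sound).choose_spec.2.2 k hk) p)
  | some ac =>
    obtain ⟨a, c⟩ := ac
    have hpos := hH.pos_of_get hk
    have hout : H.Out a c := List.mem_of_getElem? hk
    have hmut : ¬ (H.Writes a p ∨ H.Allocs a p) := by
      rw [← stores_iff]
      rintro ⟨c', hc'⟩
      exact hno a c' hc' hpos
    obtain ⟨o, h1, h2⟩ := hH.memStep hout
    subst hpos
    generalize hH.heap (H.pos a + 1) = h' at h2 hne
    cases h2 with
    | deref | casFail => exact hne rfl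
    | casOk q e n hp =>
      by_cases hq : p = q
      · subst hq; exact hmut (.inl (.inl ⟨e, n, h1, hout⟩))
      · exact hne (by simp [Heap.set, hq])
    | write q w hp =>
      by_cases hq : p = q
      · subst hq; exact hmut (.inl (.inr ⟨w, h1, hout.dom⟩))
      · exact hne (by simp [Heap.set, hq])
    | alloc q c k hp hk' hr =>
      by_cases hq : p = q
      · subst hq; exact hmut (.inr ⟨⟨c, k, h1⟩, hout⟩)
      · exact hne (by simp [Heap.set, hq])

/-- The contents of a cell were stored by the last rep event that stored into it. -/
theorem exists_last_store (hH : H.IsExecution) {k : ℕ} {p : Ptr} {c : Cell Ptr Dat}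
    (h : hH.heap k p = some c) :
    ∃ a, H.Stores a p c ∧ H.pos a < k ∧
      ∀ b c', H.Stores b p c' → H.pos b < k → H.pos b ≤ H.pos a := by
  induction k with
  | zero => simp [hH.heap_zero] at h
  | succ k ih =>
    by_cases hs : ∃ a c, H.Stores a p c ∧ H.pos a = k
    · obtain ⟨a, c', h1, rfl⟩ := hs
      have := hH.heap_stores h1
      rw [h, Option.some.injEq] at this
      subst this
      exact ⟨a, h1, by omega, fun b c' _ h2 => by omega⟩
    · obtain ⟨a, h1, h2, h3⟩ := ih (((hH.heap_succ k p).resolve_left hs).symm.trans h)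
      refine ⟨a, h1, by omega, fun b c' hb hlt => h3 b c' hb ?_⟩
      have : H.pos b ≠ k := fun he => hs ⟨b, c', hb, he⟩
      omega

theorem heap_ne_none_mono (hH : H.IsExecution) {k k' : ℕ} {p : Ptr} (h : hH.heap k p ≠ none)
    (hk : k ≤ k') : hH.heap k' p ≠ none := by
  induction hk with
  | refl => exact h
  | @step m _ ih =>
    rcases hH.heap_succ m p with ⟨a, c, h1, rfl⟩ | h1
    · rw [Nat.succ_eq_add_one, hH.heap_stores h1]; simp
    · rw [Nat.succ_eq_add_one, h1]; exact ih

/-- A cell keeps its contents as long as nothing is stored into it. -/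
theorem heap_eq_of_no_store (hH : H.IsExecution) {k k' : ℕ} {p : Ptr} (hk : k ≤ k')
    (h : ∀ a c, H.Stores a p c → ¬ (k ≤ H.pos a ∧ H.pos a < k')) :
    hH.heap k' p = hH.heap k p := by
  induction hk with
  | refl => rfl
  | step hk ih =>
    rw [← ih fun a c ha hlt => h a c ha ⟨hlt.1, by omega⟩]
    refine (hH.heap_succ _ p).resolve_left ?_
    rintro ⟨a, c, ha, rfl⟩
    exact h a c ha ⟨hk, by omega⟩

/-! ### Allocation -/

theorem heap_allocs (hH : H.IsExecution) {a : H.Rp} {p : Ptr} (h : H.Allocs a p) :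
    hH.heap (H.pos a) p = none ∧ hH.heap (H.pos a + 1) p ≠ none := by
  constructor
  · obtain ⟨⟨c, k, h1⟩, h2⟩ := h
    obtain ⟨q, h3, h4, -⟩ := hH.heap_alloc h1 h2
    cases h3
    exact h4
  · obtain ⟨c, hc⟩ := stores_iff.2 (.inr h)
    rw [hH.heap_stores hc]
    simp

theorem allocs_unique (hH : H.IsExecution) {a b : H.Rp} {p : Ptr} (ha : H.Allocs a p)
    (hb : H.Allocs b p) : a = b := by
  refine hH.pos_inj ha.2.dom hb.2.dom ?_
  have h1 := hH.heap_allocs ha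
  have h2 := hH.heap_allocs hb
  by_contra hne
  rcases Nat.lt_or_gt_of_ne hne with h | h
  · exact hH.heap_ne_none_mono h1.2 h h2.1
  · exact hH.heap_ne_none_mono h2.2 h h1.1

theorem allocs_pos_lt (hH : H.IsExecution) {a : H.Rp} {p : Ptr} {k : ℕ} (ha : H.Allocs a p)
    (h : hH.heap k p ≠ none) : H.pos a < k := by
  by_contra hlt
  exact hH.heap_ne_none_mono h (Nat.le_of_not_lt hlt) (hH.heap_allocs ha).1

theorem call_of_pc (hH : H.IsExecution) {a : H.Rp} {C : Call Ptr Dat}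
    (h : (H.pc a).caller = some C) : H.call a.1 = C :=
  (hH.codePc a).caller_eq h

theorem rdesc_of_rdcssAlloc (hH : H.IsExecution) {i : H.Rp} {δ : Desc Ptr Dat} {d : Ptr}
    (h : H.pc i = .rdcssAlloc δ) (ho : H.Out i (.word (.ptr d))) : PtrTags.rdesc d := by
  obtain ⟨p, h1, -, -, h2⟩ := hH.heap_alloc (cell := .desc δ) (k := .dptr)
    (by rw [op_eq, h]; rfl) ho
  cases h1
  exact h2.2 ⟨δ, rfl⟩

/-- Descriptors get into the memory only by their allocation in `rdcss`. -/
theorem alloc_of_heap_desc (hH : H.IsExecution) {k : ℕ} {d : Ptr} {δ : Desc Ptr Dat}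
    (h : hH.heap k d = some (.desc δ)) :
    ∃ i, H.pc i = .rdcssAlloc δ ∧ H.Out i (.word (.ptr d)) ∧ H.pos i < k := by
  obtain ⟨a, ⟨o, h1, h2⟩, h3, -⟩ := hH.exists_last_store h
  generalize hp : H.pc a = pca at h2
  cases h2
  exact ⟨a, hp, h1, h3⟩

/-- Distinct descriptors, and distinct `rdcss` events, have distinct descriptor pointers. -/
theorem rdcssAlloc_unique (hH : H.IsExecution) {i j : H.Rp} {δ δ' : Desc Ptr Dat} {d : Ptr}
    (h : H.pc i = .rdcssAlloc δ) (ho : H.Out i (.word (.ptr d)))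
    (h' : H.pc j = .rdcssAlloc δ') (ho' : H.Out j (.word (.ptr d))) : i = j ∧ δ = δ' := by
  obtain rfl := hH.allocs_unique (allocs_of_rdcssAlloc h ho) (allocs_of_rdcssAlloc h' ho')
  rw [h] at h'
  exact ⟨rfl, Pc.rdcssAlloc.inj h'⟩

end IsExecution

end History

/-! ### Client pointers and helping -/

/-- The descriptor pointer and the descriptor with which `complete` works after its first line. -/
def Pc.helps {Ptr Dat : Type*} : Pc Ptr Dat → Option (Ptr × Desc Ptr Dat)
  | .completePt1 d δ _ => some (d, δ)
  | .completeSucc d δ _ => some (d, δ)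
  | .completeUndo d δ _ => some (d, δ)
  | _ => none

namespace History

variable {Ptr Dat Thr Ev : Type*} {H : History Ptr Dat Thr Ev}

theorem pc_of_line_rdcssCas {a : H.Rp} (h : H.line a = some .rdcssCas) :
    ∃ d δ, H.pc a = .rdcssCas d δ := by
  rw [line_eq] at h
  generalize H.pc a = pca at h
  cases pca <;> simp_all [Pc.line]

theorem pc_of_line_completeSucc {a : H.Rp} (h : H.line a = some .completeSucc) :
    ∃ d δ k, H.pc a = .completeSucc d δ k := by
  rw [line_eq] at h
  generalize H.pc a = pca at h
  cases pca <;> simp_all [Pc.line]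

theorem pc_of_line_completeUndo {a : H.Rp} (h : H.line a = some .completeUndo) :
    ∃ d δ k, H.pc a = .completeUndo d δ k := by
  rw [line_eq] at h
  generalize H.pc a = pca at h
  cases pca <;> simp_all [Pc.line]

/-- `a` is a linearized rep event that accesses or allocates `p`. -/
def Accesses (H : History Ptr Dat Thr Ev) (a : H.Rp) (p : Ptr) : Prop :=
  a ∈ H.dom ∧ (H.op a = some (.deref p) ∨ (∃ e n, H.op a = some (.cas p e n)) ∨
    (∃ w, H.op a = some (.write p w)) ∨ H.Allocs a p)

theorem allocs_of_line {b : H.Rp} {p : Ptr}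
    (hl : H.line b = some .rallocC ∨ H.line b = some .rallocD) (ho : H.Out b (.word (.ptr p))) :
    H.Allocs b p := by
  refine ⟨?_, ho⟩
  rw [op_eq]
  rw [line_eq] at hl
  generalize H.pc b = pcb at hl
  cases pcb <;> simp [Pc.line, Pc.op] at hl ⊢

theorem op_of_accesses {a : H.Rp} {p : Ptr} (h : H.Accesses a p) :
    (∃ c k, H.op a = some (.alloc c k)) ∨ H.op a = some (.deref p) ∨
      (∃ e n, H.op a = some (.cas p e n)) ∨ ∃ w, H.op a = some (.write p w) := by
  obtain ⟨-, h⟩ := h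
  rcases h with h | h | h | h
  · exact .inr (.inl h)
  · exact .inr (.inr (.inl h))
  · exact .inr (.inr (.inr h))
  · exact .inl h.1

theorem terminated_of_out {x : Ev} {w : Word Ptr Dat} (ho : H.out x = some w) :
    x ∈ H.terminated := by
  obtain ⟨r, hr, -⟩ := Option.map_eq_some_iff.1 ho
  simp [terminated, fin, hr]

variable [PtrTags Ptr]

/-- `p` has been handed out to the clients: it has an alloc span. -/
def Client (H : History Ptr Dat Thr Ev) (p : Ptr) : Prop := ∃ i, (i, i) ∈ H.aspansR p

namespace IsExecution

theorem rwriteCas_old_val (hH : H.IsExecution) {a : H.Rp} {p : Ptr} {v old : Word Ptr Dat}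
    (h : H.pc a = .rwriteCas p v old) : ¬ old.isRdesc := by
  have hc := hH.codePc a
  rw [h] at hc
  generalize H.call a.1 = C at hc
  cases hc with
  | loop _ _ hk => cases hk
  | rwriteCas _ _ _ ho => exact ho

/-- The last rep event of a terminated `ralloc` event is its allocation. -/
theorem last_of_ralloc (hH : H.IsExecution) {x : Ev} {v w : Word Ptr Dat} {k : PtKind}
    (hx : H.call x = .ralloc v k) (ho : H.out x = some w) :
    ∃ i, i.1 = x ∧ H.Out i (.word w) ∧
      (H.pc i = .rallocC v ∧ k = .cptr ∨ H.pc i = .rallocD v ∧ k = .dptr) := by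
  obtain ⟨i, rfl, c, h1, h2⟩ := hH.exists_last ho
  have hc := hH.codePc i
  rw [hx] at hc
  generalize hp : H.pc i = pci at hc h2
  refine ⟨i, rfl, ?_⟩
  cases hc with
  | loop _ _ hk => cases hk
  | ret => cases h2
  | completeRead _ _ _ hk | completePt1 _ _ _ _ hk | completeSucc _ _ _ _ hk
  | completeUndo _ _ _ _ hk => cases hk
  | rallocC => cases h2; exact ⟨h1, .inl ⟨hp, rfl⟩⟩
  | rallocD => cases h2; exact ⟨h1, .inr ⟨hp, rfl⟩⟩

/-- An event of `ralloc` that has returned `p` has executed an alloc span of `p`. -/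
theorem aspan_of_ralloc (hH : H.IsExecution) {x : Ev} {v : Word Ptr Dat} {k : PtKind} {p : Ptr}
    (hx : H.call x = .ralloc v k) (ho : H.out x = some (.ptr p)) :
    ∃ i, i.1 = x ∧ (i, i) ∈ H.aspansR p := by
  obtain ⟨i, rfl, h1, ⟨hp, -⟩ | ⟨hp, -⟩⟩ := hH.last_of_ralloc hx ho
  · have hop : H.op i = some (.alloc (.word v) .cptr) := by rw [op_eq, hp]; rfl
    have hl : H.line i = some .rallocC := by rw [line_eq, hp]; rfl
    obtain ⟨q, hq, -, hk, -⟩ := hH.heap_alloc hop h1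
    cases hq
    have ha : H.Allocs i p := ⟨⟨_, _, hop⟩, h1⟩
    exact ⟨i, rfl, ⟨.rallocC i hk hl (terminated_of_out ho) h1, .inl ⟨i, rfl, .inr ha⟩⟩, i, rfl, ha,
      .inl hl⟩
  · have hop : H.op i = some (.alloc (.word v) .dptr) := by rw [op_eq, hp]; rfl
    have hl : H.line i = some .rallocD := by rw [line_eq, hp]; rfl
    obtain ⟨q, hq, -, hk, -⟩ := hH.heap_alloc hop h1
    cases hq
    have ha : H.Allocs i p := ⟨⟨_, _, hop⟩, h1⟩
    exact ⟨i, rfl, ⟨.rallocD i hk hl (terminated_of_out ho) h1, .inl ⟨i, rfl, .inr ha⟩⟩, i, rfl,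
      ha, .inr hl⟩

theorem client_of_mem_ptrs (hH : H.IsExecution) {x : Ev} {C : Call Ptr Dat} (hC : H.call x = C)
    {q : Ptr × PtKind} (h : q ∈ C.ptrs) : H.Client q.1 ∧ PtrTags.kind q.1 = q.2 := by
  subst hC
  refine ⟨?_, hH.input_kind x q h⟩
  obtain ⟨y, v, k, h1, h2, -⟩ := hH.input_alloc x q h
  obtain ⟨i, -, hi⟩ := hH.aspan_of_ralloc h1 h2
  exact ⟨i, hi⟩

theorem not_rdesc_of_mem_vals (hH : H.IsExecution) {x : Ev} {C : Call Ptr Dat}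
    (hC : H.call x = C) {v : Word Ptr Dat} (h : v ∈ C.vals) : ¬ v.isRdesc := by
  subst hC
  exact hH.input_val x v h

/-- `complete` works with a descriptor that an `rdcss` event has stored in its pointer. -/
theorem alloc_of_helps (hH : H.IsExecution) {a : H.Rp} {d : Ptr} {δ : Desc Ptr Dat}
    (h : (H.pc a).helps = some (d, δ)) :
    ∃ i, H.pc i = .rdcssAlloc δ ∧ H.Out i (.word (.ptr d)) ∧ H.rstart i < H.rstart a := by
  have main : ∀ a k, H.pc a = .completePt1 d δ k →
      ∃ i, H.pc i = .rdcssAlloc δ ∧ H.Out i (.word (.ptr d)) ∧ H.rstart i < H.rstart a := by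
    intro a k h
    obtain ⟨b, e, hb, he, hlt, hpb, ho⟩ := hH.pred_completePt1 h
    obtain ⟨i, h1, h2, h3⟩ := hH.alloc_of_heap_desc
      (hH.heap_deref (p := d) (by rw [op_eq, hpb]; rfl) ho)
    refine ⟨i, h1, h2, lt_of_not_ge fun hge => ?_⟩
    have := hH.pos_lt_of_rend he (by omega) h2.dom
    omega
  have step : ∀ b, H.NextRep b a → (∃ k, H.pc b = .completePt1 d δ k) →
      ∃ i, H.pc i = .rdcssAlloc δ ∧ H.Out i (.word (.ptr d)) ∧ H.rstart i < H.rstart a := by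
    rintro b hb ⟨k, hk⟩
    obtain ⟨i, h1, h2, h3⟩ := main b k hk
    have := hH.rstart_lt_rstart (a := b) (b := a) hb.1 (by have := hb.2; omega)
    exact ⟨i, h1, h2, by omega⟩
  cases hp : H.pc a <;> rw [hp] at h <;>
    simp only [Pc.helps, Option.some.injEq, Prod.mk.injEq, reduceCtorEq] at h <;>
    obtain ⟨rfl, rfl⟩ := h
  · exact main _ _ hp
  · obtain ⟨b, hb, h1, -⟩ := hH.pred_completeSucc hp
    exact step b hb ⟨_, h1⟩
  · obtain ⟨b, hb, h1, -⟩ := hH.pred_completeUndo hp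
    exact step b hb ⟨_, h1⟩

theorem call_of_helps (hH : H.IsExecution) {a : H.Rp} {d : Ptr} {δ : Desc Ptr Dat}
    (h : (H.pc a).helps = some (d, δ)) : ∃ x, H.call x = .rdcss δ := by
  obtain ⟨i, h1, -, -⟩ := hH.alloc_of_helps h
  exact ⟨i.1, hH.call_of_pc (by rw [h1]; rfl)⟩

/-- A descriptor pointer found in the memory was stored there by the CAS of its owner, and
nothing has been stored since. -/
theorem rdcssCas_of_heap (hH : H.IsExecution) {k : ℕ} {p d : Ptr} (hd : PtrTags.rdesc d)
    (h : hH.heap k p = some (.word (.ptr d))) :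
    ∃ c δ, H.pc c = .rdcssCas d δ ∧ δ.pt2 = p ∧ H.Out c (.word δ.exp2) ∧ H.pos c < k ∧
      ∀ b c', H.Stores b p c' → H.pos b < k → H.pos b ≤ H.pos c := by
  obtain ⟨a, ⟨o, h1, h2⟩, h3, h4⟩ := hH.exists_last_store h
  have hv : ∀ {x C}, H.call x = C → (.ptr d : Word Ptr Dat) ∉ C.vals :=
    fun hC hm => hH.not_rdesc_of_mem_vals hC hm hd
  generalize hp : H.pc a = pca at h2
  have hcall := fun C => hH.call_of_pc (a := a) (C := C)
  have hhelp := fun d' δ => hH.call_of_helps (a := a) (d := d') (δ := δ)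
  rw [hp] at hcall hhelp
  generalize hw : (Word.ptr d : Word Ptr Dat) = w at h2 hv
  cases h2 with
  | rdcssCas d' δ =>
    cases hw
    exact ⟨a, δ, hp, rfl, h1, h3, h4⟩
  | completeSucc d' δ k =>
    obtain ⟨x, hx⟩ := hhelp d' δ rfl
    exact absurd (by simp [Call.vals]) (hv hx)
  | completeUndo d' δ k =>
    obtain ⟨x, hx⟩ := hhelp d' δ rfl
    exact absurd (by simp [Call.vals]) (hv hx)
  | rcasCas | rwriteCas | rcascCas | rwritecWrite | rallocC | rallocD =>
    exact absurd (by simp [Call.vals]) (hv (hcall _ rfl))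

/-! ### Spans -/

theorem accesses_unique (hH : H.IsExecution) {a : H.Rp} {p q : Ptr} (hp : H.Accesses a p)
    (hq : H.Accesses a q) : p = q := by
  obtain ⟨-, hp⟩ := hp
  obtain ⟨-, hq⟩ := hq
  rcases hp with hp | ⟨e, n, hp⟩ | ⟨w, hp⟩ | ⟨⟨c, k, hp⟩, ho⟩ <;>
    rcases hq with hq | ⟨e', n', hq⟩ | ⟨w', hq⟩ | ⟨⟨c', k', hq⟩, ho'⟩ <;>
    rw [hp, Option.some.injEq] at hq <;> cases hq <;> first
    | rfl
    | exact hH.ptr_unique ho ho'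

theorem accesses_of_span {p : Ptr} {s : H.Rp × H.Rp} (h : H.IsSpan p s) :
    H.Accesses s.1 p ∧ H.Accesses s.2 p := by
  have alloc : ∀ b : H.Rp, H.Allocs b p → H.Accesses b p :=
    fun b h => ⟨h.2.dom, .inr (.inr (.inr h))⟩
  have cas : ∀ b e n w, H.op b = some (.cas p e n) → H.Out b w → H.Accesses b p :=
    fun b e n w h ho => ⟨ho.dom, .inr (.inl ⟨e, n, h⟩)⟩
  cases h with
  | rdcssFail b _ _ _ hb =>
    obtain ⟨e, n, h1, w, -, h2⟩ := hb
    exact ⟨cas b _ _ _ h1 h2, cas b _ _ _ h1 h2⟩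
  | rdcssSucc b c _ _ _ _ _ _ hbc =>
    obtain ⟨e, n, v, -, h1, h2⟩ := hbc
    exact ⟨cas b _ _ _ h1.1 h1.2, cas c _ _ _ h2.1 h2.2⟩
  | rdcssUndo b c _ _ _ _ _ _ hbc =>
    obtain ⟨e, n, -, h1, h2⟩ := hbc
    exact ⟨cas b _ _ _ h1.1 h1.2, cas c _ _ _ h2.1 h2.2⟩
  | completePt1 b _ _ hd hb => exact ⟨⟨hd, .inl hb⟩, hd, .inl hb⟩
  | rread b _ _ ho hb =>
    obtain ⟨w, h1, -⟩ := ho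
    exact ⟨⟨h1.dom, .inl hb⟩, h1.dom, .inl hb⟩
  | rcas b _ _ ho hb =>
    obtain ⟨w, h1, -⟩ := ho
    obtain ⟨e, n, h2⟩ := hb
    exact ⟨cas b _ _ _ h2 h1, cas b _ _ _ h2 h1⟩
  | rwrite b _ _ _ hb =>
    obtain ⟨e, n, h1, h2⟩ := hb
    exact ⟨cas b _ _ _ h1 h2, cas b _ _ _ h1 h2⟩
  | rreadc b _ _ hd hb => exact ⟨⟨hd, .inl hb⟩, hd, .inl hb⟩
  | rcasc b _ _ hd hb => exact ⟨⟨hd, .inr (.inl hb)⟩, hd, .inr (.inl hb)⟩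
  | rwritec b _ _ hd hb => exact ⟨⟨hd, .inr (.inr (.inl hb))⟩, hd, .inr (.inr (.inl hb))⟩
  | rallocC b _ hl _ hb =>
    have h := alloc b (allocs_of_line (.inl hl) hb)
    exact ⟨h, h⟩
  | rallocD b _ hl _ hb =>
    have h := alloc b (allocs_of_line (.inr hl) hb)
    exact ⟨h, h⟩

theorem span_ptr_unique (hH : H.IsExecution) {p q : Ptr} {s : H.Rp × H.Rp} (hp : H.IsSpan p s)
    (hq : H.IsSpan q s) : p = q :=
  hH.accesses_unique (accesses_of_span hp).1 (accesses_of_span hq).1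

theorem heap_of_accesses (hH : H.IsExecution) {a : H.Rp} {p : Ptr} (h : H.Accesses a p) :
    H.Allocs a p ∨ hH.heap (H.pos a) p ≠ none := by
  obtain ⟨⟨c, hc⟩, h⟩ := h
  rcases h with h | ⟨e, n, h⟩ | ⟨w, h⟩ | h
  · rw [hH.heap_deref h hc]; simp
  · rw [(hH.heap_cas h hc).1]; simp
  · exact .inr (hH.heap_write h (Out.dom hc))
  · exact .inl h

/-- Every pointer that has a span has been handed out by `ralloc`. -/
theorem client_of_span (hH : H.IsExecution) {p : Ptr} {s : H.Rp × H.Rp} (h : H.IsSpan p s) :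
    H.Client p := by
  have hacc := (accesses_of_span h).1
  by_cases hl : H.line s.1 = some .rallocC ∨ H.line s.1 = some .rallocD
  · cases h with
    | rallocC b _ hl' _ hb | rallocD b _ hl' _ hb =>
      have ha : H.Allocs b p := allocs_of_line hl hb
      refine ⟨b, ⟨?_, .inl ⟨b, rfl, .inr ha⟩⟩, b, rfl, ha, hl⟩
      first
      | exact .rallocC b (by assumption) (by assumption) (by assumption) hb
      | exact .rallocD b (by assumption) (by assumption) (by assumption) hb
    | _ => simp_all
  have hop := op_of_accesses hacc
  have hl' : H.line s.1 ≠ some .rdcssAlloc ∧ H.line s.1 ≠ some .completeRead := by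
    cases h <;> simp_all
  have hcl : ∀ C k, (H.pc s.1).caller = some C → (p, k) ∈ C.ptrs → H.Client p :=
    fun C k hC hm => (hH.client_of_mem_ptrs (hH.call_of_pc hC) hm).1
  have hhelp : ∀ d δ k, (H.pc s.1).helps = some (d, δ) → (p, k) ∈ (Call.rdcss δ).ptrs →
      H.Client p := by
    intro d δ k hC hm
    obtain ⟨x, hx⟩ := hH.call_of_helps hC
    exact (hH.client_of_mem_ptrs hx hm).1
  rw [op_eq] at hop
  rw [line_eq] at hl hl'
  generalize H.pc s.1 = pcs at hop hl hl' hcl hhelp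
  cases pcs <;> simp [Pc.line, Pc.op] at hop hl hl'
  case rdcssCas d δ => exact hcl _ .dptr rfl (by simp [Call.ptrs, hop])
  case completePt1 d δ k => exact hhelp d δ .cptr rfl (by simp [Call.ptrs, hop])
  case completeSucc d δ k => exact hhelp d δ .dptr rfl (by simp [Call.ptrs, hop])
  case completeUndo d δ k => exact hhelp d δ .dptr rfl (by simp [Call.ptrs, hop])
  all_goals
    subst hop
    exact hcl _ _ rfl (List.mem_singleton.2 rfl)

end IsExecution

end History

/-! ### The order of spans -/

namespace History

variable {Ptr Dat Thr Ev : Type*} {H : History Ptr Dat Thr Ev}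

theorem stores_of_casOk {b : H.Rp} {p : Ptr} {e n : Word Ptr Dat} (h : H.CasOk b p e n) :
    ∃ o, H.Stores b p o :=
  stores_iff.2 (.inl (.inl ⟨e, n, h⟩))

theorem stores_rdcssCas {b : H.Rp} {d : Ptr} {δ : Desc Ptr Dat} (h : H.pc b = .rdcssCas d δ)
    (ho : H.Out b (.word δ.exp2)) : H.Stores b δ.pt2 (.word (.ptr d)) :=
  ⟨_, ho, by rw [h]; constructor⟩

variable [PtrTags Ptr]

namespace IsExecution

/-- The facts about a two-element span `(b, c)`: in between, the cell holds the descriptor pointer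
that `b` has put there. -/
structure PairSpan (hH : H.IsExecution) (p : Ptr) (b c : H.Rp) (d : Ptr) (δ : Desc Ptr Dat) :
    Prop where
  pc : H.pc b = .rdcssCas d δ
  out : H.Out b (.word δ.exp2)
  ptr : δ.pt2 = p
  kind : PtrTags.kind p = .dptr
  rdesc : PtrTags.rdesc d
  val : ¬ δ.exp2.isRdesc
  lt : H.pos b < H.pos c
  line : H.line c = some .completeSucc ∨ H.line c = some .completeUndo
  stores : ∃ o, H.Stores c p o
  before : hH.heap (H.pos b) p = some (.word δ.exp2)
  between : ∀ k, H.pos b < k → k ≤ H.pos c → hH.heap k p = some (.word (.ptr d))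

theorem val_of_rdcssCas (hH : H.IsExecution) {b : H.Rp} {d : Ptr} {δ : Desc Ptr Dat}
    (h : H.pc b = .rdcssCas d δ) : ¬ δ.exp2.isRdesc :=
  hH.not_rdesc_of_mem_vals (hH.call_of_pc (by rw [h]; rfl)) (C := .rdcss δ) (by simp [Call.vals])

theorem rdesc_of_rdcssCas (hH : H.IsExecution) {b : H.Rp} {d : Ptr} {δ : Desc Ptr Dat}
    (h : H.pc b = .rdcssCas d δ) : PtrTags.rdesc d := by
  obtain ⟨i, -, h1, h2, -⟩ := hH.alloc_of_rdcssCas h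
  exact hH.rdesc_of_rdcssAlloc h1 h2

theorem pairSpan_of_casOk (hH : H.IsExecution) {p : Ptr} {b c : H.Rp} {e n v v' : Word Ptr Dat}
    (hp : PtrTags.kind p = .dptr) (hl : H.line b = some .rdcssCas)
    (hl' : H.line c = some .completeSucc ∨ H.line c = some .completeUndo)
    (hlt : H.lt b c) (hno : ∀ a, H.Writes a p → ¬ (H.lt b a ∧ H.lt a c))
    (hb : H.CasOk b p e n) (hc : H.CasOk c p v v') : ∃ d δ, PairSpan hH p b c d δ := by
  obtain ⟨d, δ, hpc⟩ := pc_of_line_rdcssCas hl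
  obtain ⟨hbo, hb'⟩ := hb
  rw [op_eq, hpc] at hbo
  simp only [Pc.op, Option.some.injEq, Op.cas.injEq] at hbo
  obtain ⟨rfl, rfl, rfl⟩ := hbo
  have hlt' := (hH.lt_iff.1 hlt).2.2
  have hbef : hH.heap (H.pos b) δ.pt2 = some (.word δ.exp2) :=
    (hH.heap_cas (e := δ.exp2) (n := .ptr d) (by rw [op_eq, hpc]; rfl) hb').1
  refine ⟨d, δ, hpc, hb', rfl, hp, hH.rdesc_of_rdcssCas hpc, hH.val_of_rdcssCas hpc, hlt', hl',
    stores_of_casOk hc, hbef, ?_⟩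
  intro k hk1 hk2
  rw [← hH.heap_stores (stores_rdcssCas hpc hb')]
  refine hH.heap_eq_of_no_store hk1 fun a o ha hak => ?_
  rcases stores_iff.1 ⟨o, ha⟩ with hw | hw
  · exact hno a hw ⟨hH.lt_iff.2 ⟨hb'.dom, ha.dom, by omega⟩,
      hH.lt_iff.2 ⟨ha.dom, hc.2.dom, by omega⟩⟩
  · have := hH.allocs_pos_lt hw (k := H.pos b) (by rw [hbef]; simp)
    omega

/-- Spans of `p` are either pairs of a CAS of `rdcss` and the CAS that removes the descriptor, or
single rep events that do not see a descriptor pointer in `p`. -/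
theorem span_shape (hH : H.IsExecution) {p : Ptr} {s : H.Rp × H.Rp} (h : H.IsSpan p s) :
    (∃ b, s = (b, b) ∧ (H.line b = some .rdcssCas → ∃ e n, H.CasFail b p e n) ∧
      H.line b ≠ some .completeSucc ∧ H.line b ≠ some .completeUndo ∧
      (PtrTags.kind p = .dptr → ∀ d, PtrTags.rdesc d →
        hH.heap (H.pos b) p ≠ some (.word (.ptr d)))) ∨
    ∃ d δ, PairSpan hH p s.1 s.2 d δ := by
  have cas : ∀ {b e n}, H.OutVal b → H.op b = some (.cas p e n) → ∀ d, PtrTags.rdesc d →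
      hH.heap (H.pos b) p ≠ some (.word (.ptr d)) := by
    rintro b e n ⟨w, h1, h2⟩ h d hd heq
    rw [(hH.heap_cas h h1).1] at heq
    cases heq
    exact h2 hd
  have alloc : ∀ {b}, H.line b = some .rallocC ∨ H.line b = some .rallocD →
      H.Out b (.word (.ptr p)) → ∀ d, PtrTags.rdesc d →
      hH.heap (H.pos b) p ≠ some (.word (.ptr d)) := by
    intro b hl ho d _ heq
    rw [(hH.heap_allocs (allocs_of_line hl ho)).1] at heq
    cases heq
  cases h with
  | rdcssFail b hp hl ho hb =>
    obtain ⟨e, n, hb'⟩ := hb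
    exact .inl ⟨b, rfl, fun _ => ⟨e, n, hb'⟩, by simp [hl], by simp [hl], fun _ => cas ho hb'.1⟩
  | rdcssSucc b c hp hl hl' ho hlt hno hbc =>
    obtain ⟨e, n, v, -, h1, h2⟩ := hbc
    exact .inr (hH.pairSpan_of_casOk hp hl (.inl hl') hlt hno h1 h2)
  | rdcssUndo b c hp hl hl' ho hlt hno hbc =>
    obtain ⟨e, n, -, h1, h2⟩ := hbc
    exact .inr (hH.pairSpan_of_casOk hp hl (.inr hl') hlt hno h1 h2)
  | rread b hp hl ho hb =>
    refine .inl ⟨b, rfl, by simp [hl], by simp [hl], by simp [hl], fun _ d hd heq => ?_⟩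
    obtain ⟨w, h1, h2⟩ := ho
    rw [hH.heap_deref hb h1] at heq
    cases heq
    exact h2 hd
  | rcas b hp hl ho hb =>
    obtain ⟨e, n, hb⟩ := hb
    exact .inl ⟨b, rfl, by simp [hl], by simp [hl], by simp [hl], fun _ => cas ho hb⟩
  | rwrite b hp hl ho hb =>
    obtain ⟨e, n, hb⟩ := hb
    exact .inl ⟨b, rfl, by simp [hl], by simp [hl], by simp [hl], fun _ => cas ho hb.1⟩
  | rallocC b hp hl ht hb =>
    exact .inl ⟨b, rfl, by simp [hl], by simp [hl], by simp [hl], fun _ => alloc (.inl hl) hb⟩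
  | rallocD b hp hl ht hb =>
    exact .inl ⟨b, rfl, by simp [hl], by simp [hl], by simp [hl], fun _ => alloc (.inr hl) hb⟩
  | completePt1 b hp hl | rreadc b hp hl | rcasc b hp hl | rwritec b hp hl =>
    exact .inl ⟨b, rfl, by simp [hl], by simp [hl], by simp [hl], by simp [hp]⟩

theorem span_dom {p : Ptr} {s : H.Rp × H.Rp} (h : H.IsSpan p s) : s.1 ∈ H.dom ∧ s.2 ∈ H.dom :=
  ⟨(accesses_of_span h).1.1, (accesses_of_span h).2.1⟩

theorem span_pos_le (hH : H.IsExecution) {p : Ptr} {s : H.Rp × H.Rp} (h : H.IsSpan p s) :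
    H.pos s.1 ≤ H.pos s.2 := by
  rcases hH.span_shape h with ⟨b, rfl, -⟩ | ⟨d, δ, hp⟩
  · exact le_rfl
  · exact hp.lt.le

theorem not_writes_of_casFail (hH : H.IsExecution) {b : H.Rp} {p : Ptr} {e n : Word Ptr Dat}
    (h : H.CasFail b p e n) (q : Ptr) : ¬ (H.Writes b q ∨ H.Allocs b q) := by
  obtain ⟨h1, w, hw, h2⟩ := h
  rintro ((⟨e', n', h3, h4⟩ | ⟨w', h3, -⟩) | ⟨⟨c, k, h3⟩, -⟩) <;>
    rw [h1, Option.some.injEq] at h3 <;> cases h3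
  exact hw (hH.word_unique h2 h4)

/-- The spans of a pointer are linearly ordered. -/
theorem span_trichotomy (hH : H.IsExecution) {p : Ptr} {s t : H.Rp × H.Rp} (hs : H.IsSpan p s)
    (ht : H.IsSpan p t) : H.sbefore s t ∨ H.sbefore t s ∨ s = t := by
  unfold sbefore
  simp only [hH.lt_iff, span_dom hs, span_dom ht, true_and]
  -- A single rep event that lies within a pair would see the descriptor pointer.
  have mixed : ∀ (b : H.Rp) (s : H.Rp × H.Rp) d δ, PairSpan hH p s.1 s.2 d δ → b ∈ H.dom →
      (H.line b = some .rdcssCas → ∃ e n, H.CasFail b p e n) →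
      (PtrTags.kind p = .dptr → ∀ d, PtrTags.rdesc d →
        hH.heap (H.pos b) p ≠ some (.word (.ptr d))) →
      H.pos b < H.pos s.1 ∨ H.pos s.2 < H.pos b := by
    intro b s d δ hp hb h1 h2
    by_contra! hcon
    rcases hcon.1.lt_or_eq with hlt | heq
    · exact h2 hp.kind d hp.rdesc (hp.between _ hlt hcon.2)
    · obtain rfl : s.1 = b := hH.pos_inj hp.out.dom hb heq
      obtain ⟨e, n, hf⟩ := h1 (by rw [line_eq, hp.pc]; rfl)
      refine hH.not_writes_of_casFail hf p (.inl (.inl ⟨δ.exp2, .ptr d, ?_, hp.out⟩))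
      rw [op_eq, hp.pc, ← hp.ptr]; rfl
  rcases hH.span_shape hs with ⟨b, rfl, h1, -, -, h2⟩ | ⟨d, δ, hp⟩
  · rcases hH.span_shape ht with ⟨b', rfl, h1', -, -, h2'⟩ | ⟨d', δ', hp'⟩
    · rcases Nat.lt_trichotomy (H.pos b) (H.pos b') with h | h | h
      · exact .inl h
      · obtain rfl : b = b' := hH.pos_inj (span_dom hs).1 (span_dom ht).1 h
        exact .inr (.inr rfl)
      · exact .inr (.inl h)
    · rcases mixed b t d' δ' hp' (span_dom hs).1 h1 h2 with h | h
      · exact .inl h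
      · exact .inr (.inl h)
  · rcases hH.span_shape ht with ⟨b', rfl, h1', -, -, h2'⟩ | ⟨d', δ', hp'⟩
    · rcases mixed b' s d δ hp (span_dom ht).1 h1' h2' with h | h
      · exact .inr (.inl h)
      · exact .inl h
    · by_contra! hcon
      obtain ⟨h3, h4, h5⟩ := hcon
      have hv : ∀ d δ, PtrTags.rdesc d → ¬ δ.exp2.isRdesc → ∀ k,
          hH.heap k p = some (.word (.ptr d)) → hH.heap k p ≠ some (.word (Desc.exp2 δ)) := by
        intro d δ hd hv k h1 h2
        rw [h1] at h2
        simp only [Option.some.injEq, Cell.word.injEq] at h2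
        rw [← h2] at hv
        exact hv hd
      rcases Nat.lt_trichotomy (H.pos s.1) (H.pos t.1) with h | h | h
      · exact hv d δ' hp.rdesc hp'.val _ (hp.between _ h h3) hp'.before
      · have h6 : s.1 = t.1 := hH.pos_inj (span_dom hs).1 (span_dom ht).1 h
        have hd : d' = d := by
          have := hp.pc
          rw [h6, hp'.pc] at this
          cases this; rfl
        -- After the first removal the descriptor pointer is gone.
        have gone : ∀ (s t : H.Rp × H.Rp) d δ δ', PairSpan hH p s.1 s.2 d δ →
            PairSpan hH p t.1 t.2 d δ' → s.1 = t.1 → H.IsSpan p s → ¬ H.pos s.2 < H.pos t.2 := by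
          intro s t d δ δ' hp hp' h1 hs hlt
          have hlt' := hp.lt
          have h2 := hp'.between (H.pos s.2 + 1) (by rw [← h1]; omega) (by omega)
          obtain ⟨o, ho⟩ := hp.stores
          rw [hH.heap_stores ho] at h2
          obtain ⟨c, δ'', h3, h4, h5, h6, h7⟩ :=
            hH.rdcssCas_of_heap hp.rdesc ((hH.heap_stores ho).trans h2)
          have := h7 s.2 o ho (by omega)
          have h8 : c = s.2 := hH.pos_inj h5.dom (span_dom hs).2 (by omega)
          rcases hp.line with hl | hl <;> rw [← h8, line_eq, h3] at hl <;> simp [Pc.line] at hl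
        subst hd
        have h7 := gone s t d' δ δ' hp hp' h6 hs
        have h8 := gone t s d' δ' δ hp' hp h6.symm ht
        exact h5 (Prod.ext h6 (hH.pos_inj (span_dom hs).2 (span_dom ht).2 (by omega)))
      · exact hv d' δ hp'.rdesc hp.val _ (hp'.between _ h h4) hp.before

/-! ### Write spans -/

theorem stores_of_wspan (hH : H.IsExecution) {p : Ptr} {s : H.Rp × H.Rp} (h : s ∈ H.wspansR p) :
    (∃ v, H.Stores s.2 p (.word v)) ∧ H.line s.2 ≠ some .rdcssCas ∧
      H.line s.2 ≠ some .completeUndo := by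
  obtain ⟨hs, hw⟩ := h
  have hl : H.line s.2 ≠ some .rdcssAlloc := by cases hs <;> simp_all
  have hst : ∃ o, H.Stores s.2 p o := by
    rcases hw with ⟨b, rfl, hb⟩ | hl'
    · exact stores_iff.2 hb
    · rcases hH.span_shape hs with ⟨b, rfl, -, h1, -⟩ | ⟨d, δ, hp⟩
      · exact absurd hl' h1
      · exact hp.stores
  refine ⟨?_, ?_⟩
  · obtain ⟨o, c, hc, hm⟩ := hst
    suffices hv : ∃ v, o = .word v by
      obtain ⟨v, rfl⟩ := hv
      exact ⟨v, c, hc, hm⟩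
    rw [line_eq] at hl
    generalize H.pc s.2 = pcs at hm hl
    cases hm with
    | rdcssAlloc => exact absurd rfl hl
    | _ => exact ⟨_, rfl⟩
  · rcases hw with ⟨b, rfl, hb⟩ | hl'
    · rcases hH.span_shape hs with ⟨b', h0, h1, -, h2, -⟩ | ⟨d, δ, hp⟩
      · cases h0
        refine ⟨fun hl' => ?_, h2⟩
        obtain ⟨e, n, hf⟩ := h1 hl'
        exact hH.not_writes_of_casFail hf p hb
      · exact absurd hp.lt (lt_irrefl _)
    · simp [hl']

theorem wspan_of_stores (hH : H.IsExecution) {a : H.Rp} {p : Ptr} {v : Word Ptr Dat}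
    (hp : H.Client p) (h : H.Stores a p (.word v)) (h1 : H.line a ≠ some .rdcssCas)
    (h2 : H.line a ≠ some .completeSucc) (h3 : H.line a ≠ some .completeUndo) :
    (a, a) ∈ H.wspansR p := by
  have hwa := stores_iff.1 ⟨_, h⟩
  refine (?_ : H.IsSpan p (a, a) ∨ (a, a) ∈ H.aspansR p).elim
    (fun h => ⟨h, .inl ⟨a, rfl, hwa⟩⟩) (fun h => h.1)
  obtain ⟨i, hi⟩ := hp
  have halloc : ∀ {v k}, H.op a = some (.alloc v k) → (a, a) ∈ H.aspansR p := by
    intro v k hop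
    obtain ⟨j, hj, hia, -⟩ := hi.2
    cases hj
    rcases hwa with (⟨e, n, hc, -⟩ | ⟨w, hc, -⟩) | hw
    · rw [hop] at hc; cases hc
    · rw [hop] at hc; cases hc
    · rw [hH.allocs_unique hw hia]; exact hi
  obtain ⟨o, ho, hm⟩ := h
  rw [line_eq] at h1 h2 h3
  rw [op_eq] at halloc
  generalize hc : (.word v : Cell Ptr Dat) = c at hm
  have hk : ∀ C q k, (H.pc a).caller = some C → (q, k) ∈ C.ptrs → PtrTags.kind q = k :=
    fun C q k hC hm => (hH.client_of_mem_ptrs (hH.call_of_pc hC) hm).2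
  have hv : ∀ C w, (H.pc a).caller = some C → w ∈ C.vals → ¬ w.isRdesc :=
    fun C w hC => hH.not_rdesc_of_mem_vals (hH.call_of_pc hC)
  have hwv : ∀ p v old, H.pc a = .rwriteCas p v old → ¬ old.isRdesc :=
    fun p v old h => hH.rwriteCas_old_val h
  have hop := H.op_eq a
  have hln := H.line_eq a
  generalize H.pc a = pca at *
  cases hm with
  | rdcssAlloc => cases hc
  | rdcssCas => exact absurd rfl h1
  | completeSucc => exact absurd rfl h2
  | completeUndo => exact absurd rfl h3
  | rcasCas p e n =>
    exact .inl (.rcas a (hk _ p _ rfl (by simp [Call.ptrs])) hln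
      ⟨e, ho, hv _ e rfl (by simp [Call.vals])⟩ ⟨e, n, hop⟩)
  | rwriteCas p w old =>
    exact .inl (.rwrite a (hk _ p _ rfl (by simp [Call.ptrs])) hln
      ⟨old, ho, hwv _ _ _ rfl⟩ ⟨old, w, hop, ho⟩)
  | rcascCas p e n =>
    exact .inl (.rcasc a (hk _ p _ rfl (by simp [Call.ptrs])) hln ho.dom ⟨e, n, hop⟩)
  | rwritecWrite p w =>
    exact .inl (.rwritec a (hk _ p _ rfl (by simp [Call.ptrs])) hln ho.dom ⟨w, hop⟩)
  | rallocC | rallocD => exact .inr (halloc rfl)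

theorem not_rdesc_of_client (hH : H.IsExecution) {p : Ptr} (hp : H.Client p) :
    ¬ PtrTags.rdesc p := by
  obtain ⟨i, -, j, hj, ⟨⟨c, k, hc⟩, ho⟩, hl⟩ := hp
  obtain ⟨q, h1, -, -, h2⟩ := hH.heap_alloc hc ho
  cases h1
  rw [h2]
  rintro ⟨δ, rfl⟩
  rw [op_eq] at hc
  rw [line_eq] at hl
  generalize H.pc j = pcj at hc hl
  cases pcj <;> simp [Pc.op, Pc.line] at hc hl

/-- The CAS that removes the descriptor of `c₁` from memory completes a span. -/
theorem isSpan_of_last_store (hH : H.IsExecution) {c₁ c₂ : H.Rp} {d : Ptr} {δ : Desc Ptr Dat}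
    (h : H.pc c₁ = .rdcssCas d δ) (ho : H.Out c₁ (.word δ.exp2)) (hlt : H.pos c₁ < H.pos c₂)
    (hlast : ∀ b c', H.Stores b δ.pt2 c' → H.pos b < H.pos c₂ → H.pos b ≤ H.pos c₁)
    (hc : (∃ k, H.pc c₂ = .completeSucc d δ k) ∨ ∃ k, H.pc c₂ = .completeUndo d δ k)
    (ho' : H.Out c₂ (.word (.ptr d))) : H.IsSpan δ.pt2 (c₁, c₂) := by
  have hcall : H.call c₁.1 = .rdcss δ := hH.call_of_pc (by rw [h]; rfl)
  have hk : PtrTags.kind δ.pt2 = .dptr :=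
    (hH.client_of_mem_ptrs hcall (q := (δ.pt2, .dptr)) (by simp [Call.ptrs])).2
  have hl : H.line c₁ = some .rdcssCas := by rw [line_eq, h]; rfl
  have hop : H.op c₁ = some (.cas δ.pt2 δ.exp2 (.ptr d)) := by rw [op_eq, h]; rfl
  have hval : H.OutVal c₁ := ⟨_, ho, hH.val_of_rdcssCas h⟩
  have hno : ∀ a, H.Writes a δ.pt2 → ¬ (H.lt c₁ a ∧ H.lt a c₂) := by
    rintro a ha ⟨h1, h2⟩
    obtain ⟨o, hs⟩ := stores_iff.2 (.inl ha)
    have := hlast a o hs (hH.lt_iff.1 h2).2.2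
    have := (hH.lt_iff.1 h1).2.2
    omega
  have hlt' : H.lt c₁ c₂ := hH.lt_iff.2 ⟨ho.dom, ho'.dom, hlt⟩
  have hr : (Word.ptr d : Word Ptr Dat).isRdesc := hH.rdesc_of_rdcssCas h
  rcases hc with ⟨k, hc⟩ | ⟨k, hc⟩
  · exact .rdcssSucc c₁ c₂ hk hl (by rw [line_eq, hc]; rfl) hval hlt' hno
      ⟨_, _, δ.new2, hr, ⟨hop, ho⟩, by rw [op_eq, hc]; rfl, ho'⟩
  · exact .rdcssUndo c₁ c₂ hk hl (by rw [line_eq, hc]; rfl) hval hlt' hno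
      ⟨_, _, hr, ⟨hop, ho⟩, by rw [op_eq, hc]; rfl, ho'⟩

/-- A rep event of `complete(d)` that expects `d` and finds it makes a span with the CAS that has
put `d` there. -/
theorem exists_span_of_complete (hH : H.IsExecution) {c₂ : H.Rp} {d : Ptr} {δ : Desc Ptr Dat}
    (hc : (∃ k, H.pc c₂ = .completeSucc d δ k) ∨ ∃ k, H.pc c₂ = .completeUndo d δ k)
    (ho : H.Out c₂ (.word (.ptr d))) :
    ∃ c₁, H.pc c₁ = .rdcssCas d δ ∧ H.Out c₁ (.word δ.exp2) ∧ H.pos c₁ < H.pos c₂ ∧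
      (∀ b c', H.Stores b δ.pt2 c' → H.pos b < H.pos c₂ → H.pos b ≤ H.pos c₁) ∧
      H.IsSpan δ.pt2 (c₁, c₂) := by
  have hh : (H.pc c₂).helps = some (d, δ) := by
    rcases hc with ⟨k, hc⟩ | ⟨k, hc⟩ <;> rw [hc] <;> rfl
  obtain ⟨i, hi, hio, -⟩ := hH.alloc_of_helps hh
  have hheap : hH.heap (H.pos c₂) δ.pt2 = some (.word (.ptr d)) := by
    rcases hc with ⟨k, hc⟩ | ⟨k, hc⟩
    · exact (hH.heap_cas (e := .ptr d) (n := δ.new2) (by rw [op_eq, hc]; rfl) ho).1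
    · exact (hH.heap_cas (e := .ptr d) (n := δ.exp2) (by rw [op_eq, hc]; rfl) ho).1
  obtain ⟨c₁, δ', h1, h2, h3, h4, h5⟩ := hH.rdcssCas_of_heap (hH.rdesc_of_rdcssAlloc hi hio) hheap
  obtain ⟨j, -, hj, hjo, -⟩ := hH.alloc_of_rdcssCas h1
  obtain ⟨-, rfl⟩ := hH.rdcssAlloc_unique hi hio hj hjo
  exact ⟨c₁, h1, h3, h4, h5, hH.isSpan_of_last_store h1 h3 h4 h5 hc ho⟩

/-- The word in the cell of a client pointer, unless it is a pointer to a descriptor, was written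
by the last write span before. An undone CAS of `rdcss` restores the value that it has
overwritten, so that the last write span before it remains the last one. -/
theorem exists_last_wspan (hH : H.IsExecution) {p : Ptr} (hp : H.Client p) {k : ℕ}
    {v : Word Ptr Dat} (hv : ¬ v.isRdesc) (h : hH.heap k p = some (.word v)) :
    ∃ s ∈ H.wspansR p, H.pos s.2 < k ∧ H.Stores s.2 p (.word v) ∧
      ∀ t ∈ H.wspansR p, H.pos t.2 < k → H.pos t.2 ≤ H.pos s.2 := by
  induction k using Nat.strong_induction_on with
  | _ k ih =>
    obtain ⟨a, hs, hlt, hlast⟩ := hH.exists_last_store h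
    have hlast' : ∀ t ∈ H.wspansR p, H.pos t.2 < k → H.pos t.2 ≤ H.pos a := by
      intro t ht htk
      obtain ⟨⟨w, hw⟩, -⟩ := hH.stores_of_wspan ht
      exact hlast _ _ hw htk
    by_cases h1 : H.line a = some .rdcssCas
    · obtain ⟨d, δ, hpc⟩ := pc_of_line_rdcssCas h1
      obtain ⟨o, ho, hm⟩ := hs
      rw [hpc] at hm
      cases hm
      exact absurd (hH.rdesc_of_rdcssCas hpc) hv
    by_cases h2 : H.line a = some .completeSucc
    · obtain ⟨d, δ, k', hpc⟩ := pc_of_line_completeSucc h2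
      obtain ⟨o, ho, hm⟩ := id hs
      rw [hpc] at hm
      cases hm
      obtain ⟨c₁, -, -, -, -, hsp⟩ := hH.exists_span_of_complete (.inl ⟨k', hpc⟩) ho
      exact ⟨(c₁, a), ⟨hsp, .inr h2⟩, hlt, hs, hlast'⟩
    by_cases h3 : H.line a = some .completeUndo
    · obtain ⟨d, δ, k', hpc⟩ := pc_of_line_completeUndo h3
      obtain ⟨o, ho, hm⟩ := hs
      rw [hpc] at hm
      cases hm
      obtain ⟨c₁, hc1, ho1, hlt1, hlast1, -⟩ := hH.exists_span_of_complete (.inr ⟨k', hpc⟩) ho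
      obtain ⟨s, hs, hsk, hst, hsl⟩ := ih (H.pos c₁) (by omega)
        (hH.heap_cas (e := δ.exp2) (n := .ptr d) (by rw [op_eq, hc1]; rfl) ho1).1
      refine ⟨s, hs, by omega, hst, fun t ht htk => hsl t ht ?_⟩
      obtain ⟨⟨w, hw⟩, hl1, hl2⟩ := hH.stores_of_wspan ht
      have hne1 : H.pos t.2 ≠ H.pos a := by
        intro heq
        rw [hH.pos_inj hw.dom ho.dom heq] at hl2
        exact hl2 h3
      have hne2 : H.pos t.2 ≠ H.pos c₁ := by
        intro heq
        rw [hH.pos_inj hw.dom ho1.dom heq, line_eq, hc1] at hl1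
        exact hl1 rfl
      have := hlast' t ht htk
      have := hlast1 _ _ hw (by omega)
      omega
    exact ⟨(a, a), hH.wspan_of_stores hp hs h1 h2 h3, hlt, hs, hlast'⟩

end IsExecution

end History

namespace History

variable {Ptr Dat Thr Ev : Type*} {H : History Ptr Dat Thr Ev} [PtrTags Ptr]

namespace IsExecution

/-! ### The descriptor protocol -/

/-- The rep events that determine the denotation of an `rdcss` event `x` whose descriptor has been
put into memory by `c₁` and removed by `c₂`; `r` is the read of `pt1` that decides on success. -/
structure PairDen (H : History Ptr Dat Thr Ev) (x : Ev) (d : Ptr) (δ : Desc Ptr Dat)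
    (k : Pc Ptr Dat) (r c₁ c₂ : H.Rp) : Prop where
  fst : c₁.1 = x
  pc : H.pc c₁ = .rdcssCas d δ
  out : H.Out c₁ (.word δ.exp2)
  span : H.IsSpan δ.pt2 (c₁, c₂)
  read : H.pc r = .completePt1 d δ k
  next : H.NextRep r c₂
  dom : r ∈ H.dom
  choice : H.pc c₂ = .completeSucc d δ k ∧ H.Out r (.word δ.exp1) ∨
    H.pc c₂ = .completeUndo d δ k ∧ ∃ v, v ≠ δ.exp1 ∧ H.Out r (.word v)

theorem PairDen.call (hH : H.IsExecution) {x : Ev} {d : Ptr} {δ : Desc Ptr Dat} {k : Pc Ptr Dat}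
    {r c₁ c₂ : H.Rp} (h : PairDen H x d δ k r c₁ c₂) : H.call x = .rdcss δ := by
  rw [← h.fst]
  exact hH.call_of_pc (by rw [h.pc]; rfl)

theorem PairDen.isSpan_read (hH : H.IsExecution) {x : Ev} {d : Ptr} {δ : Desc Ptr Dat}
    {k : Pc Ptr Dat} {r c₁ c₂ : H.Rp} (h : PairDen H x d δ k r c₁ c₂) :
    H.IsSpan δ.pt1 (r, r) := by
  have hk := (hH.client_of_mem_ptrs (h.call hH) (q := (δ.pt1, .cptr)) (by simp [Call.ptrs])).2
  exact .completePt1 r hk (by rw [line_eq, h.read]; rfl) h.dom (by rw [op_eq, h.read]; rfl)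

theorem PairDen.pairSpan (hH : H.IsExecution) {x : Ev} {d : Ptr} {δ : Desc Ptr Dat}
    {k : Pc Ptr Dat} {r c₁ c₂ : H.Rp} (h : PairDen H x d δ k r c₁ c₂) :
    PairSpan hH δ.pt2 c₁ c₂ d δ := by
  rcases hH.span_shape h.span with ⟨b, hb, -, h1, h2, -⟩ | ⟨d', δ', hp⟩
  · cases hb
    exact absurd h.pc (by rcases h.choice with ⟨h, -⟩ | ⟨h, -⟩ <;> simp [h])
  · have := hp.pc
    rw [h.pc] at this
    cases this
    exact hp

theorem exists_pairDen (hH : H.IsExecution) {p d : Ptr} {δ : Desc Ptr Dat} {c₁ c₂ : H.Rp}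
    (hs : H.IsSpan p (c₁, c₂)) (h : PairSpan hH p c₁ c₂ d δ) :
    ∃ k r, PairDen H c₁.1 d δ k r c₁ c₂ := by
  obtain ⟨i, -, hi, hio, -⟩ := hH.alloc_of_rdcssCas h.pc
  have huniq : ∀ {d' δ'}, (H.pc c₂).helps = some (d', δ') → d' = d → δ' = δ := by
    rintro d' δ' hh rfl
    obtain ⟨j, hj, hjo, -⟩ := hH.alloc_of_helps hh
    exact (hH.rdcssAlloc_unique hj hjo hi hio).2
  have hheap := h.between (H.pos c₂) h.lt le_rfl
  obtain ⟨o', o, ho, hm⟩ := h.stores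
  have hp := h.ptr
  have hcas : ∀ e n, H.op c₂ = some (.cas p e n) → o = .word (.ptr d) := by
    intro e n hop
    have := (hH.heap_cas hop ho).1
    rw [hheap, Option.some.injEq] at this
    exact this.symm
  rw [op_eq] at hcas
  rcases h.line with hl | hl
  · obtain ⟨d', δ', k, hpc⟩ := pc_of_line_completeSucc hl
    rw [hpc] at huniq hm hcas
    cases hm
    have hd := hcas _ _ rfl
    simp only [Cell.word.injEq, Word.ptr.injEq] at hd
    subst hd
    obtain rfl := huniq rfl rfl
    obtain ⟨r, hr, hrp, hro⟩ := hH.pred_completeSucc hpc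
    exact ⟨k, r, rfl, h.pc, h.out, hs, hrp, hr, hro.dom, .inl ⟨hpc, hro⟩⟩
  · obtain ⟨d', δ', k, hpc⟩ := pc_of_line_completeUndo hl
    rw [hpc] at huniq hm hcas
    cases hm
    have hd := hcas _ _ rfl
    simp only [Cell.word.injEq, Word.ptr.injEq] at hd
    subst hd
    obtain rfl := huniq rfl rfl
    obtain ⟨r, hr, hrp, v, hv, hro⟩ := hH.pred_completeUndo hpc
    exact ⟨k, r, rfl, h.pc, h.out, hs, hrp, hr, hro.dom, .inr ⟨hpc, v, hv, hro⟩⟩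

theorem wspan_of_completeSucc {p : Ptr} {d : Ptr} {δ : Desc Ptr Dat} {k : Pc Ptr Dat}
    {c₁ c₂ : H.Rp} (hs : H.IsSpan p (c₁, c₂)) (h : H.pc c₂ = .completeSucc d δ k) :
    (c₁, c₂) ∈ H.wspansR p :=
  ⟨hs, .inr (by simp only [line_eq, h]; rfl)⟩

theorem PairDen.isDen (hH : H.IsExecution) {x : Ev} {d : Ptr} {δ : Desc Ptr Dat} {k : Pc Ptr Dat}
    {r c₁ c₂ : H.Rp} (h : PairDen H x d δ k r c₁ c₂) :
    H.IsDen x ({(r, r), (c₁, c₂)}, some δ.exp2) := by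
  obtain ⟨i, hi, hpi, hio, -⟩ := hH.alloc_of_rdcssCas h.pc
  have hop : H.op r = some (.deref δ.pt1) := by rw [op_eq, h.read]; rfl
  have hlast := hH.lastRead_of_nextRep h.next hop
  have hx := h.call hH
  have hr := h.isSpan_read hH
  rcases h.choice with ⟨h2, -⟩ | ⟨h2, -⟩
  · exact .rdcssSucc δ d i r c₁ c₂ hx (hi.trans h.fst) (by rw [line_eq, hpi]; rfl)
      (by rw [op_eq, hpi]; rfl) hio hr (wspan_of_completeSucc h.span h2)
      (by rw [line_eq, h.read]; rfl) hop (by rw [line_eq, h.pc]; rfl)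
      (by rw [op_eq, h.pc]; rfl) (by rw [line_eq, h2]; rfl) (by rw [op_eq, h2]; rfl) hlast
  · exact .rdcssUndo δ d i r c₁ c₂ hx (hi.trans h.fst) (by rw [line_eq, hpi]; rfl)
      (by rw [op_eq, hpi]; rfl) hio hr h.span
      (by rw [line_eq, h.read]; rfl) hop (by rw [line_eq, h.pc]; rfl)
      (by rw [op_eq, h.pc]; rfl) (by rw [line_eq, h2]; rfl) (by rw [op_eq, h2]; rfl) hlast

/-- A linearized rep event after which its event does nothing more than, possibly, a last run of
`complete`. -/
def Final (H : History Ptr Dat Thr Ev) (a : H.Rp) : Prop :=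
  ∃ c, H.Out a c ∧ (∀ pc', Next (H.pc a) c pc' → ∃ w, pc'.cont = .ret w) ∧
    ∀ w, (H.pc a).cont ≠ .ret w

theorem Final.eq (hH : H.IsExecution) {a b : H.Rp} (ha : Final H a) (hb : Final H b)
    (h : a.1 = b.1) : a = b := by
  obtain ⟨c, h1, h2, h3⟩ := ha
  obtain ⟨c', h1', h2', h3'⟩ := hb
  exact hH.eq_of_final h h1 h1' h2 h2' h3 h3'

theorem final_of_rdcssCas {a : H.Rp} {d : Ptr} {δ : Desc Ptr Dat} {v : Word Ptr Dat}
    (h : H.pc a = .rdcssCas d δ) (ho : H.Out a (.word v)) (hv : ¬ v.isRdesc) : Final H a := by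
  refine ⟨_, ho, ?_, by rw [h]; simp [Pc.cont]⟩
  intro pc' hn
  rw [h] at hn
  cases hn with
  | rdcssHelp _ _ q hq => exact absurd hq hv
  | _ => exact ⟨_, rfl⟩

theorem final_of_ralloc {a : H.Rp} {c : Cell Ptr Dat} {v : Word Ptr Dat}
    (h : H.pc a = .rallocC v ∨ H.pc a = .rallocD v) (ho : H.Out a c) : Final H a := by
  refine ⟨_, ho, ?_, ?_⟩ <;> rcases h with h | h <;> rw [h]
  · rintro pc' ⟨⟩; exact ⟨_, rfl⟩
  · rintro pc' ⟨⟩; exact ⟨_, rfl⟩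
  · simp [Pc.cont]
  · simp [Pc.cont]

/-- A descriptor pointer is put into memory at most once. -/
theorem rdcssCas_unique (hH : H.IsExecution) {a b : H.Rp} {d : Ptr} {δ δ' : Desc Ptr Dat}
    (ha : H.pc a = .rdcssCas d δ) (hao : H.Out a (.word δ.exp2))
    (hb : H.pc b = .rdcssCas d δ') (hbo : H.Out b (.word δ'.exp2)) : a = b := by
  obtain ⟨i, hia, hi, hio, -⟩ := hH.alloc_of_rdcssCas ha
  obtain ⟨j, hjb, hj, hjo, -⟩ := hH.alloc_of_rdcssCas hb
  obtain ⟨rfl, rfl⟩ := hH.rdcssAlloc_unique hi hio hj hjo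
  exact (final_of_rdcssCas ha hao (hH.val_of_rdcssCas ha)).eq hH
    (final_of_rdcssCas hb hbo (hH.val_of_rdcssCas hb)) (hia.symm.trans hjb)

/-- `complete(d)` reads `pt1` only after `d` has been put into memory, since it is called only by
threads that know this. -/
theorem rdcssCas_before_read (hH : H.IsExecution) {r : H.Rp} {d : Ptr} {δ : Desc Ptr Dat}
    {k : Pc Ptr Dat} (h : H.pc r = .completePt1 d δ k) (hr : r ∈ H.dom) :
    ∃ c δ', H.pc c = .rdcssCas d δ' ∧ H.Out c (.word δ'.exp2) ∧ H.pos c < H.pos r := by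
  obtain ⟨b, e, hbr, he, hlt, hb, hbo⟩ := hH.pred_completePt1 h
  obtain ⟨a, e', hab, he', hlt', hor⟩ := hH.pred_completeRead hb
  have h1 := hH.pos_lt_of_rend he hlt hr
  have h2 := hH.pos_lt_of_rend he' hlt' hbo.dom
  rcases hor with ⟨ho, hd, hl, -⟩ | ⟨δ', hpa, ho⟩
  · have hheap : ∃ p, hH.heap (H.pos a) p = some (.word (.ptr d)) := by
      have h3 := fun p => hH.heap_deref (a := a) (p := p) (h := ho)
      have h4 := fun p e n h => (hH.heap_cas (a := a) (p := p) (e := e) (n := n) h ho).1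
      rw [op_eq] at h3 h4
      rw [line_eq] at hl
      generalize H.pc a = pca at hl h3 h4
      cases pca <;> simp only [Pc.line, reduceCtorEq, Option.some.injEq, or_self] at hl
      · exact ⟨_, h4 _ _ _ rfl⟩
      · exact ⟨_, h3 _ rfl⟩
      · exact ⟨_, h4 _ _ _ rfl⟩
      · exact ⟨_, h3 _ rfl⟩
    obtain ⟨p, hp⟩ := hheap
    obtain ⟨c, δ', h3, -, h4, h5, -⟩ := hH.rdcssCas_of_heap hd hp
    exact ⟨c, δ', h3, h4, by omega⟩
  · exact ⟨a, δ', hpa, ho, by omega⟩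

theorem PairDen.pos_lt (hH : H.IsExecution) {x : Ev} {d : Ptr} {δ : Desc Ptr Dat} {k : Pc Ptr Dat}
    {r c₁ c₂ : H.Rp} (h : PairDen H x d δ k r c₁ c₂) :
    H.pos c₁ < H.pos r ∧ H.pos r < H.pos c₂ := by
  constructor
  · obtain ⟨c, δ', h1, h2, h3⟩ := hH.rdcssCas_before_read h.read h.dom
    rwa [hH.rdcssCas_unique h.pc h.out h1 h2]
  · obtain ⟨e, -, h1, h2, -⟩ := hH.next h.next
    exact hH.pos_lt_of_rend h1 h2 (span_dom h.span).2

/-! ### Denotations are unique -/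

/-- The output that a denotation with the single span `(c, c)` prescribes. -/
def Result (H : History Ptr Dat Thr Ev) (c : H.Rp) (v : Word Ptr Dat) : Prop :=
  (H.line c = some .rwriteCas ∨ H.line c = some .rwritecWrite) ∧ v = .tt ∨
    (H.line c ≠ some .rwriteCas ∧ H.line c ≠ some .rwritecWrite) ∧ H.Out c (.word v)

/-- The two forms of denotations: a single rep event of `x` itself, after which `x` executes no
other candidate, or the rep events of a descriptor that has been in memory. -/
inductive DenShape (H : History Ptr Dat Thr Ev) (x : Ev) :
    Set (H.Rp × H.Rp) × Option (Word Ptr Dat) → Prop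
  | single (c : H.Rp) (p : Ptr) (v : Word Ptr Dat) (hc : c.1 = x) (hs : H.IsSpan p (c, c))
      (hf : Final H c) (hl : H.line c ≠ some .completePt1) (hr : Result H c v) :
      DenShape H x ({(c, c)}, some v)
  | pair (d : Ptr) (δ : Desc Ptr Dat) (k : Pc Ptr Dat) (r c₁ c₂ : H.Rp)
      (h : PairDen H x d δ k r c₁ c₂) : DenShape H x ({(r, r), (c₁, c₂)}, some δ.exp2)

theorem outVal_of_span {p : Ptr} {c : H.Rp} (hs : H.IsSpan p (c, c))
    (h : H.line c = some .rdcssCas ∨ H.line c = some .rreadRead ∨ H.line c = some .rcasCas) :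
    H.OutVal c := by
  cases hs <;> simp_all

/-- A CAS of `rdcss` with the descriptor pointer `d` belongs to the event that has allocated
`d`. -/
theorem owner (hH : H.IsExecution) {i c : H.Rp} {d p : Ptr} {δ : Desc Ptr Dat}
    {e : Word Ptr Dat} (hil : H.line i = some .rdcssAlloc)
    (hio : H.op i = some (.alloc (.desc δ) .dptr)) (hid : H.Out i (.word (.ptr d)))
    (hcl : H.line c = some .rdcssCas) (hco : H.op c = some (.cas p e (.ptr d))) :
    H.pc c = .rdcssCas d δ ∧ c.1 = i.1 := by
  have hi : H.pc i = .rdcssAlloc δ := by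
    rw [op_eq] at hio
    rw [line_eq] at hil
    generalize H.pc i = pci at hio hil
    cases pci <;> simp_all [Pc.line, Pc.op]
  obtain ⟨d', δ', hc⟩ := pc_of_line_rdcssCas hcl
  rw [op_eq, hc] at hco
  cases hco
  obtain ⟨j, hjc, hj, hjo, -⟩ := hH.alloc_of_rdcssCas hc
  obtain ⟨rfl, rfl⟩ := hH.rdcssAlloc_unique hi hid hj hjo
  exact ⟨hc, hjc.symm⟩

/-- The rep events named in the two `rdcss` cases with a descriptor in memory belong together. -/
theorem pairDen_of_lastRead (hH : H.IsExecution) {x : Ev} {d : Ptr} {δ : Desc Ptr Dat}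
    {i r c₁ c₂ : H.Rp} (hi : i.1 = x) (hil : H.line i = some .rdcssAlloc)
    (hio : H.op i = some (.alloc (.desc δ) .dptr)) (hid : H.Out i (.word (.ptr d)))
    (hs : H.IsSpan δ.pt2 (c₁, c₂)) (hl1 : H.line c₁ = some .rdcssCas)
    (hop : H.op c₁ = some (.cas δ.pt2 δ.exp2 (.ptr d)))
    (hl2 : H.line c₂ = some .completeSucc ∨ H.line c₂ = some .completeUndo)
    (hlast : H.LastRead r c₂) : ∃ k, PairDen H x d δ k r c₁ c₂ := by
  obtain ⟨hpc, hc⟩ := hH.owner hil hio hid hl1 hop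
  rcases hH.span_shape hs with ⟨b, hb, -, h1, h2, -⟩ | ⟨d', δ', hp⟩
  · cases hb
    rcases hl2 with hl2 | hl2
    · exact absurd hl2 h1
    · exact absurd hl2 h2
  · have h1 := hp.pc
    rw [hpc] at h1
    cases h1
    obtain ⟨k, r', hd⟩ := hH.exists_pairDen hs hp
    obtain rfl : r = r' := hH.lastRead_unique hlast
      (hH.lastRead_of_nextRep hd.next (p := δ.pt1) (by rw [op_eq, hd.read]; rfl))
    rw [hc, hi] at hd
    exact ⟨k, hd⟩

theorem denShape (hH : H.IsExecution) {x : Ev} {D : Set (H.Rp × H.Rp) × Option (Word Ptr Dat)}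
    (h : H.IsDen x D) : DenShape H x D := by
  cases h with
  | rdcssFail δ d i c v hx hi hil hio hid hc hcl hco hcv hv =>
    obtain ⟨hpc, hci⟩ := hH.owner hil hio hid hcl hco
    obtain ⟨w, hw, hwv⟩ := outVal_of_span hc (.inl hcl)
    exact .single c _ v (hci.trans hi) hc (final_of_rdcssCas hpc hw hwv) (by simp [hcl])
      (.inr ⟨by simp [hcl], hcv⟩)
  | rdcssSucc δ d i r c₁ c₂ hx hi hil hio hid hr hc hrl hro hc1l hc1o hc2l hc2o hlast =>
    obtain ⟨k, hp⟩ := hH.pairDen_of_lastRead hi hil hio hid hc.1 hc1l hc1o (.inl hc2l) hlast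
    exact .pair d δ k r c₁ c₂ hp
  | rdcssUndo δ d i r c₁ c₂ hx hi hil hio hid hr hc hrl hro hc1l hc1o hc2l hc2o hlast =>
    obtain ⟨k, hp⟩ := hH.pairDen_of_lastRead hi hil hio hid hc hc1l hc1o (.inr hc2l) hlast
    exact .pair d δ k r c₁ c₂ hp
  | rread p r v hx hs hr hrl hro hrv =>
    obtain ⟨w, hw, hwv⟩ := outVal_of_span hs (.inr (.inl hrl))
    refine .single r p v hr hs ⟨_, hw, ?_, ?_⟩ (by simp [hrl]) (.inr ⟨by simp [hrl], hrv⟩) <;>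
      rw [line_eq] at hrl <;> generalize H.pc r = pcr at hrl <;>
      cases pcr <;> simp [Pc.line] at hrl
    · intro pc' hn
      cases hn with
      | rreadHelp _ q hq => exact absurd hq hwv
      | rreadDone => exact ⟨_, rfl⟩
    · simp [Pc.cont]
  | rcas p e n c v hx hs hc hcl hco hcv =>
    obtain ⟨w, hw, hwv⟩ := outVal_of_span hs (.inr (.inr hcl))
    refine .single c p v hc hs ⟨_, hw, ?_, ?_⟩ (by simp [hcl]) (.inr ⟨by simp [hcl], hcv⟩) <;>
      rw [line_eq] at hcl <;> generalize H.pc c = pcc at hcl <;>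
      cases pcc <;> simp [Pc.line] at hcl
    · intro pc' hn
      cases hn with
      | rcasHelp _ _ _ q hq => exact absurd hq hwv
      | rcasDone => exact ⟨_, rfl⟩
    · simp [Pc.cont]
  | rwrite p v w r c hx hs hc hrl hro hrv hcl hco hlast =>
    have hcw : H.Out c (.word w) := by
      obtain ⟨⟨u, hu⟩, -, -⟩ := hH.stores_of_wspan hs
      rcases stores_iff.1 ⟨_, hu⟩ with (⟨e, n, h1, h2⟩ | ⟨w', h1, -⟩) | ⟨⟨c', k, h1⟩, -⟩ <;>
        rw [hco] at h1 <;> cases h1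
      exact h2
    refine .single c p _ hc hs.1 ⟨_, hcw, ?_, ?_⟩ (by simp [hcl]) (.inl ⟨.inl hcl, rfl⟩) <;>
      rw [line_eq] at hcl <;> rw [op_eq] at hco <;> generalize H.pc c = pcc at hcl hco <;>
      cases pcc <;> simp [Pc.line] at hcl
    · cases hco
      intro pc' hn
      cases hn with
      | rwriteAgain _ _ _ _ hx => exact absurd rfl hx
      | rwriteDone => exact ⟨_, rfl⟩
    · simp [Pc.cont]
  | rreadc p r v hx hs hr hrl hro hrv =>
    refine .single r p v hr hs ⟨_, hrv, ?_, ?_⟩ (by simp [hrl]) (.inr ⟨by simp [hrl], hrv⟩) <;>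
      rw [line_eq] at hrl <;> generalize H.pc r = pcr at hrl <;>
      cases pcr <;> simp [Pc.line] at hrl
    · rintro pc' ⟨⟩
      exact ⟨_, rfl⟩
    · simp [Pc.cont]
  | rcasc p e n c v hx hs hc hcl hco hcv =>
    refine .single c p v hc hs ⟨_, hcv, ?_, ?_⟩ (by simp [hcl]) (.inr ⟨by simp [hcl], hcv⟩) <;>
      rw [line_eq] at hcl <;> generalize H.pc c = pcc at hcl <;>
      cases pcc <;> simp [Pc.line] at hcl
    · rintro pc' ⟨⟩
      exact ⟨_, rfl⟩
    · simp [Pc.cont]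
  | rwritec p v c hx hs hc hcl hco =>
    obtain ⟨o, ho⟩ := (span_dom hs.1).1
    refine .single c p _ hc hs.1 ⟨_, ho, ?_, ?_⟩ (by simp [hcl]) (.inl ⟨.inr hcl, rfl⟩) <;>
      rw [line_eq] at hcl <;> generalize H.pc c = pcc at hcl <;>
      cases pcc <;> simp [Pc.line] at hcl
    · rintro pc' ⟨⟩
      exact ⟨_, rfl⟩
    · simp [Pc.cont]
  | rallocC v w p i hx ht hp hs hi hil hio hiw | rallocD v w p i hx ht hp hs hi hil hio hiw =>
    refine .single i p w hi hs.1 ⟨_, hiw, ?_, ?_⟩ (by simp [hil]) (.inr ⟨by simp [hil], hiw⟩) <;>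
      rw [line_eq] at hil <;> generalize H.pc i = pci at hil <;>
      cases pci <;> simp [Pc.line] at hil
    · rintro pc' ⟨⟩
      exact ⟨_, rfl⟩
    · simp [Pc.cont]

theorem not_single_pair (hH : H.IsExecution) {x : Ev} {d p : Ptr} {δ : Desc Ptr Dat}
    {k : Pc Ptr Dat} {r c₁ c₂ : H.Rp} (h : PairDen H x d δ k r c₁ c₂) :
    ¬ H.IsSpan p (c₁, c₁) := by
  intro hs
  rcases hH.span_shape hs with ⟨b, hb, h1, -⟩ | ⟨d', δ', hp⟩
  · cases hb
    obtain ⟨e, n, hf⟩ := h1 (by rw [line_eq, h.pc]; rfl)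
    refine hH.not_writes_of_casFail hf δ.pt2 (.inl (.inl ⟨δ.exp2, .ptr d, ?_, h.out⟩))
    rw [op_eq, h.pc]; rfl
  · exact absurd hp.lt (lt_irrefl _)

/-- The denotation of an event is well defined. -/
theorem isDen_unique (hH : H.IsExecution) {x : Ev}
    {D D' : Set (H.Rp × H.Rp) × Option (Word Ptr Dat)} (h : H.IsDen x D) (h' : H.IsDen x D') :
    D = D' := by
  have mixed : ∀ {d p δ k r c₁ c₂ c}, PairDen H x d δ k r c₁ c₂ → c.1 = x →
      H.IsSpan p (c, c) → ¬ Final H c := by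
    intro d p δ k r c₁ c₂ c hp hc hs hf
    have := hf.eq hH (final_of_rdcssCas hp.pc hp.out (hH.val_of_rdcssCas hp.pc))
      (hc.trans hp.fst.symm)
    subst this
    exact hH.not_single_pair hp hs
  cases hH.denShape h with
  | single c p v hc hs hf hl hr =>
    cases hH.denShape h' with
    | single c' p' v' hc' hs' hf' hl' hr' =>
      obtain rfl := hf.eq hH hf' (hc.trans hc'.symm)
      obtain rfl : v = v' := by
        rcases hr with ⟨h1, rfl⟩ | ⟨h1, h2⟩ <;> rcases hr' with ⟨h1', rfl⟩ | ⟨h1', h2'⟩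
        · rfl
        · exact absurd h1 (by simp [h1'])
        · exact absurd h1' (by simp [h1])
        · exact hH.word_unique h2 h2'
      rfl
    | pair d δ k r c₁ c₂ hp => exact absurd hf (mixed hp hc hs)
  | pair d δ k r c₁ c₂ hp =>
    cases hH.denShape h' with
    | single c p v hc hs hf hl hr => exact absurd hf (mixed hp hc hs)
    | pair d' δ' k' r' c₁' c₂' hp' =>
      obtain rfl := (final_of_rdcssCas hp.pc hp.out (hH.val_of_rdcssCas hp.pc)).eq hH
        (final_of_rdcssCas hp'.pc hp'.out (hH.val_of_rdcssCas hp'.pc)) (hp.fst.trans hp'.fst.symm)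
      have h1 := hp.pc
      rw [hp'.pc] at h1
      cases h1
      have h2 := (hp.pairSpan hH).lt
      have h3 := (hp'.pairSpan hH).lt
      obtain rfl : c₂ = c₂' := by
        rcases hH.span_trichotomy hp.span hp'.span with h4 | h4 | h4
        · have := (hH.lt_iff.1 h4).2.2; simp only at this; omega
        · have := (hH.lt_iff.1 h4).2.2; simp only at this; omega
        · exact (Prod.mk.inj h4).2
      obtain rfl : r = r' := by
        have h5 := hp.next
        have h6 := hp'.next
        exact rp_ext (h5.1.trans h6.1.symm) (by have := h5.2; have := h6.2; omega)
      rfl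

theorem den_eq (hH : H.IsExecution) {x : Ev}
    {D : Set (H.Rp × H.Rp) × Option (Word Ptr Dat)} (h : H.IsDen x D) : H.denR x = D := by
  unfold denR
  have hex : ∃ D, H.IsDen x D := ⟨D, h⟩
  rw [dif_pos hex]
  exact hH.isDen_unique hex.choose_spec h

theorem isDen_of_nonempty {x : Ev} (h : (H.denR x).1.Nonempty) : H.IsDen x (H.denR x) := by
  unfold denR at h ⊢
  split at h
  · rename_i hex
    rw [dif_pos hex]
    exact hex.choose_spec
  · exact absurd h (by simp)

/-- No span belongs to the denotations of two events. -/
theorem den_injective (hH : H.IsExecution) {x y : Ev}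
    {D D' : Set (H.Rp × H.Rp) × Option (Word Ptr Dat)} (h : H.IsDen x D) (h' : H.IsDen y D')
    {s : H.Rp × H.Rp} (hs : s ∈ D.1) (hs' : s ∈ D'.1) : x = y := by
  have mixed : ∀ {x d δ k r c₁ c₂ c}, PairDen H x d δ k r c₁ c₂ →
      H.line c ≠ some .completePt1 → (c, c) ≠ (r, r) ∧ (c, c) ≠ (c₁, c₂) := by
    intro x d δ k r c₁ c₂ c hp hl
    constructor
    · rintro ⟨⟩
      exact hl (by rw [line_eq, hp.read]; rfl)
    · rintro ⟨⟩
      exact lt_irrefl _ (hp.pairSpan hH).lt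
  have hrc : ∀ {x d δ k r c₁ c₂ r'}, PairDen H x d δ k r c₁ c₂ → (r', r') ≠ (c₁, c₂) := by
    rintro x d δ k r c₁ c₂ r' hp ⟨⟩
    exact lt_irrefl _ (hp.pairSpan hH).lt
  cases hH.denShape h with
  | single c p v hc hsp hf hl hr =>
    cases hH.denShape h' with
    | single c' p' v' hc' hsp' hf' hl' hr' =>
      obtain rfl := Set.mem_singleton_iff.1 hs
      have := Set.mem_singleton_iff.1 hs'
      cases this
      exact hc.symm.trans hc'
    | pair d δ k r c₁ c₂ hp =>
      obtain rfl := Set.mem_singleton_iff.1 hs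
      rcases hs' with h1 | h1
      · exact absurd h1 (mixed hp hl).1
      · exact absurd h1 (mixed hp hl).2
  | pair d δ k r c₁ c₂ hp =>
    cases hH.denShape h' with
    | single c p v hc hsp hf hl hr =>
      obtain rfl := Set.mem_singleton_iff.1 hs'
      rcases hs with h1 | h1
      · exact absurd h1 (mixed hp hl).1
      · exact absurd h1 (mixed hp hl).2
    | pair d' δ' k' r' c₁' c₂' hp' =>
      rcases hs with rfl | rfl
      · rcases hs' with h1 | h1
        · cases h1
          have h2 := hp.read
          rw [hp'.read] at h2
          cases h2
          obtain rfl := hH.rdcssCas_unique hp.pc hp.out hp'.pc hp'.out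
          exact hp.fst.symm.trans hp'.fst
        · exact absurd h1 (hrc hp')
      · rcases hs' with h1 | h1
        · exact absurd h1.symm (hrc hp)
        · cases h1
          exact hp.fst.symm.trans hp'.fst

end IsExecution

end History

namespace History

variable {Ptr Dat Thr Ev : Type*} {H : History Ptr Dat Thr Ev}

theorem writer_unique {x : Ev} {p : Ptr} {u v : Word Ptr Dat} (hu : H.writer x p u)
    (hv : H.writer x p v) : u = v := by
  unfold writer at hu hv
  cases hC : H.call x <;> simp only [hC] at hu hv
  · exact hu.2.trans hv.2.symm
  · exact hu.1.trans hv.1.symm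
  all_goals exact hu.2.trans hv.2.symm

variable [PtrTags Ptr]

namespace IsExecution

/-! ### Write spans belong to denotations -/

/-- Every write span belongs to the denotation of an event, and that event attempts to write what
the span has written. -/
theorem exists_den_of_wspan (hH : H.IsExecution) {p : Ptr} {s : H.Rp × H.Rp} {v : Word Ptr Dat}
    (hs : s ∈ H.wspansR p) (hv : H.Stores s.2 p (.word v)) :
    ∃ x D, H.IsDen x D ∧ s ∈ D.1 ∧ H.writer x p v := by
  have hsp := hs.1
  rcases hH.span_shape hsp with ⟨b, rfl, -⟩ | ⟨d, δ, hp⟩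
  · have hl := (hH.stores_of_wspan hs).2
    have hlS : H.line b ≠ some .completeSucc := by
      rcases hH.span_shape hsp with ⟨b', h0, -, h1, -⟩ | ⟨d, δ, hp⟩
      · cases h0; exact h1
      · exact absurd hp.lt (lt_irrefl _)
    obtain ⟨o, ho, hm⟩ := hv
    have hcall : ∀ C, (H.pc b).caller = some C → H.call b.1 = C := fun C => hH.call_of_pc
    have hlast : ∀ p v old, H.pc b = .rwriteCas p v old → ∃ r, H.line r = some .rwriteRead ∧
        H.op r = some (.deref p) ∧ H.Out r (.word old) ∧ H.LastRead r b := by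
      intro p v old h
      obtain ⟨r, hr, h1, h2⟩ := hH.pred_rwriteCas h
      have hop : H.op r = some (.deref p) := by rw [op_eq, h1]; rfl
      exact ⟨r, by rw [line_eq, h1]; rfl, hop, h2, hH.lastRead_of_nextRep hr hop⟩
    have hop := H.op_eq b
    have hln := H.line_eq b
    -- The spans of an allocation require that its event has terminated, and the allocation is the
    -- last rep event of its event.
    have hret : ∀ v, H.pc b = .rallocC v ∨ H.pc b = .rallocD v → H.Out b (.word (.ptr p)) →
        H.fin b.1 ≠ none ∧ H.out b.1 = some (.ptr p) := by
      intro v hpc ho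
      have ht : b.1 ∈ H.terminated := by
        rcases hpc with h | h <;> rw [line_eq, h] at hln <;> cases hsp <;>
          simp_all [line_eq, Pc.line]
      refine ⟨ht, ?_⟩
      obtain ⟨⟨t, w⟩, hr⟩ : ∃ r, (H.ev b.1).resp = some r :=
        Option.ne_none_iff_exists'.1 fun h => ht (by simp [fin, h])
      have hout : H.out b.1 = some w := by simp [out, hr]
      obtain ⟨v', k, hx⟩ : ∃ v k, H.call b.1 = .ralloc v k := by
        rcases hpc with h | h
        · exact ⟨_, _, hcall _ (by rw [h]; rfl)⟩
        · exact ⟨_, _, hcall _ (by rw [h]; rfl)⟩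
      obtain ⟨a, hab, hao, hap⟩ := hH.last_of_ralloc hx hout
      obtain rfl : a = b := Final.eq hH
        (final_of_ralloc (hap.imp And.left And.left) hao) (final_of_ralloc hpc ho) hab
      rw [hout, hH.word_unique hao ho]
    simp only [line_eq] at hl hlS
    generalize hc : (Cell.word v : Cell Ptr Dat) = cell at hm
    generalize hpc : H.pc b = pcb at hop hln hm hcall hlast hret hl hlS
    cases hm with
    | rdcssAlloc => cases hc
    | rdcssCas => exact absurd rfl hl.1
    | completeSucc => exact absurd rfl hlS
    | completeUndo => exact absurd rfl hl.2
    | rcasCas p e n =>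
      cases hc
      have hx := hcall _ rfl
      exact ⟨_, _, .rcas p e v b e hx hsp rfl hln hop ho, rfl, by simp [writer, hx]⟩
    | rwriteCas p v' old =>
      cases hc
      have hx := hcall _ rfl
      obtain ⟨r, h1, h2, h3, h4⟩ := hlast _ _ _ rfl
      exact ⟨_, _, .rwrite p v old r b hx hs rfl h1 h2 h3 hln hop h4, rfl, by simp [writer, hx]⟩
    | rcascCas p e n =>
      cases hc
      have hx := hcall _ rfl
      exact ⟨_, _, .rcasc p e v b e hx hsp rfl hln hop ho, rfl, by simp [writer, hx]⟩
    | rwritecWrite p v' c =>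
      cases hc
      have hx := hcall _ rfl
      exact ⟨_, _, .rwritec p v b hx hs rfl hln hop, rfl, by simp [writer, hx]⟩
    | rallocC p v' =>
      cases hc
      have hx := hcall _ rfl
      obtain ⟨h1, h2⟩ := hret v (.inl rfl) ho
      exact ⟨_, _, .rallocC v _ p b hx h1 h2 hs rfl hln hop ho, rfl, by simp [writer, hx, h1, h2]⟩
    | rallocD p v' =>
      cases hc
      have hx := hcall _ rfl
      obtain ⟨h1, h2⟩ := hret v (.inr rfl) ho
      exact ⟨_, _, .rallocD v _ p b hx h1 h2 hs rfl hln hop ho, rfl, by simp [writer, hx, h1, h2]⟩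
  · obtain ⟨c₁, c₂⟩ := s
    obtain ⟨k, r, hd⟩ := hH.exists_pairDen hsp hp
    refine ⟨_, _, hd.isDen hH, .inr rfl, ?_⟩
    have hx := hd.call hH
    have hpt := hp.ptr
    rcases hd.choice with ⟨h2, -⟩ | ⟨h2, -⟩
    · obtain ⟨o, ho, hm⟩ := hv
      simp only [h2] at hm
      cases hm
      simp [writer, hx]
    · exact absurd (by simp only [line_eq, h2]; rfl) (hH.stores_of_wspan hs).2.2

/-! ### Observations -/

/-- If a span of `x` finds the word `v` in the cell of `p`, then `x` observes an event that
attempts to write `v` into `p`. -/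
theorem exists_obs (hH : H.IsExecution) {x : Ev} {D : Set (H.Rp × H.Rp) × Option (Word Ptr Dat)}
    (h : H.IsDen x D) {s : H.Rp × H.Rp} (hs : s ∈ D.1) {p : Ptr} (hsp : H.IsSpan p s)
    {v : Word Ptr Dat} (hv : ¬ v.isRdesc) (hheap : hH.heap (H.pos s.1) p = some (.word v)) :
    ∃ z, H.obs H.spanR p z x ∧ H.writer z p v := by
  obtain ⟨t, ht, htk, htv, hlast⟩ := hH.exists_last_wspan (hH.client_of_span hsp) hv hheap
  obtain ⟨z, E, hz, htE, hw⟩ := hH.exists_den_of_wspan ht htv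
  refine ⟨z, ⟨t, ⟨?_, ht.1⟩, s, ⟨?_, hsp⟩, ⟨ht, ?_⟩, ?_⟩, hw⟩
  · change t ∈ (H.denR z).1
    rw [hH.den_eq hz]; exact htE
  · change s ∈ (H.denR x).1
    rw [hH.den_eq h]; exact hs
  · exact hH.lt_iff.2 ⟨(span_dom ht.1).2, (span_dom hsp).1, htk⟩
  · intro u hu hus
    rcases hH.span_trichotomy hu.1 ht.1 with h1 | h1 | h1
    · exact .inl h1
    · have h2 := hlast u hu (hH.lt_iff.1 hus).2.2
      have h3 := (hH.lt_iff.1 h1).2.2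
      have h4 := hH.span_pos_le hu.1
      omega
    · exact .inr h1

/-- If all the spans of `x` on `p` find `v` in the cell of `p`, then `x` observes only events that
attempt to write `v`. -/
theorem eq_of_obs (hH : H.IsExecution) {x z : Ev}
    {D : Set (H.Rp × H.Rp) × Option (Word Ptr Dat)} (h : H.IsDen x D) {p : Ptr}
    {v u : Word Ptr Dat} (hv : ¬ v.isRdesc)
    (hheap : ∀ s ∈ D.1, H.IsSpan p s → hH.heap (H.pos s.1) p = some (.word v))
    (hobs : H.obs H.spanR p z x) (hw : H.writer z p u) : u = v := by
  obtain ⟨b, ⟨hbz, hb⟩, s, ⟨hsx, hsp⟩, ⟨hbw, hbs⟩, hmax⟩ := hobs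
  change b ∈ (H.denR z).1 at hbz
  change s ∈ (H.denR x).1 at hsx
  rw [hH.den_eq h] at hsx
  obtain ⟨t, ht, htk, htv, hlast⟩ :=
    hH.exists_last_wspan (hH.client_of_span hsp) hv (hheap s hsx hsp)
  obtain ⟨z', E, hz', htE, hw'⟩ := hH.exists_den_of_wspan ht htv
  have h1 := hlast b hbw (hH.lt_iff.1 hbs).2.2
  rcases hmax t ht (hH.lt_iff.2 ⟨(span_dom ht.1).2, (span_dom hsp).1, htk⟩) with h2 | rfl
  · have := (hH.lt_iff.1 h2).2.2
    have := hH.span_pos_le hb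
    omega
  · obtain rfl := hH.den_injective (isDen_of_nonempty ⟨t, hbz⟩) hz' hbz htE
    exact writer_unique hw hw'

/-- The cells of control pointers never hold pointers to descriptors. -/
theorem val_of_cptr (hH : H.IsExecution) {p : Ptr} (hk : PtrTags.kind p = .cptr) {n : ℕ}
    {v : Word Ptr Dat} (h : hH.heap n p = some (.word v)) : ¬ v.isRdesc := by
  intro hv
  cases v with
  | tt | dat => exact hv
  | ptr d =>
    obtain ⟨c, δ, hc, rfl, -⟩ := hH.rdcssCas_of_heap hv h
    have := (hH.client_of_mem_ptrs (hH.call_of_pc (a := c) (C := .rdcss δ) (by rw [hc]; rfl))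
      (q := (δ.pt2, .dptr)) (by simp [Call.ptrs])).2
    rw [hk] at this
    cases this

/-! ### Terminated events -/

/-- The last rep event of a terminated `rdcss` event is its failed CAS or, if the event has put its
descriptor into memory, the final CAS of its own run of `complete`. -/
theorem last_of_rdcss (hH : H.IsExecution) {x : Ev} {δ : Desc Ptr Dat} {w : Word Ptr Dat}
    (hx : H.call x = .rdcss δ) (ho : H.out x = some w) :
    (∃ a d, a.1 = x ∧ H.pc a = .rdcssCas d δ ∧ H.Out a (.word w) ∧ w ≠ δ.exp2 ∧ ¬ w.isRdesc) ∨
      w = δ.exp2 ∧ ∃ a c₁ d, a.1 = x ∧ c₁.1 = x ∧ a ∈ H.dom ∧ H.pc c₁ = .rdcssCas d δ ∧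
        H.Out c₁ (.word δ.exp2) ∧ H.pos c₁ < H.pos a ∧
        ((∃ k, H.pc a = .completeSucc d δ k) ∨ ∃ k, H.pc a = .completeUndo d δ k) := by
  obtain ⟨a, rfl, c, hac, hn⟩ := hH.exists_last ho
  have hc := hH.codePc a
  rw [hx] at hc
  -- Inside `complete`, with a return as continuation, the descriptor pointer is the thread's own.
  have key : ∀ r d δ', H.pc r = .completePt1 d δ' (.ret w) → r.1 = a.1 → (r.2 : ℕ) < a.2 →
      δ' = δ ∧ ∃ c₁, c₁.1 = a.1 ∧ H.pc c₁ = .rdcssCas d δ ∧ H.Out c₁ (.word δ.exp2) ∧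
        H.pos c₁ < H.pos a := by
    intro r d δ' hr hra hlt
    obtain ⟨b, e, hbr, -, -, hb, hbo⟩ := hH.pred_completePt1 hr
    obtain ⟨c₁, e', hcb, -, -, hor⟩ := hH.pred_completeRead hb
    rcases hor with ⟨-, -, -, h⟩ | ⟨δ₁, hpc, hco⟩
    · exact absurd rfl (h w)
    have h1 : c₁.1 = a.1 := hcb.1.trans (hbr.1.trans hra)
    have h2 := hH.call_of_pc (a := c₁) (C := .rdcss δ₁) (by rw [hpc]; rfl)
    rw [h1, hx] at h2
    cases h2
    obtain ⟨i, hi, hio, -⟩ := hH.alloc_of_helps (a := r) (d := d) (δ := δ') (by rw [hr]; rfl)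
    obtain ⟨j, -, hj, hjo, -⟩ := hH.alloc_of_rdcssCas hpc
    obtain ⟨e, h3, h4⟩ := hH.rend_lt_rstart (a := c₁) (b := a) h1
      (by have := hcb.2; have := hbr.2; omega)
    exact ⟨(hH.rdcssAlloc_unique hi hio hj hjo).2, c₁, h1, hpc, hco,
      hH.pos_lt_of_rend h3 h4 hac.dom⟩
  have hk : ∀ k d δ', H.pc a = .completeSucc d δ' k ∨ H.pc a = .completeUndo d δ' k →
      LoopPc (.rdcss δ) k → k = .ret w → w = δ.exp2 := by
    rintro k d δ' - h1 rfl
    cases h1; rfl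
  generalize hpc : H.pc a = pca at hc hn
  cases hn with
  | rdcssFail d δ' old hv he =>
    have h1 := hH.call_of_pc (a := a) (C := .rdcss δ') (by rw [hpc]; rfl)
    rw [hx] at h1
    cases h1
    exact .inl ⟨a, d, rfl, hpc, hac, he, hv⟩
  | completeSucc d δ' _ v =>
    obtain ⟨r, hra, hr, -⟩ := hH.pred_completeSucc hpc
    obtain ⟨rfl, c₁, h1, h2, h3, h4⟩ := key r d δ' hr hra.1 (by have := hra.2; omega)
    cases hc with
    | loop _ _ hk => cases hk
    | completeSucc _ _ _ _ hk' =>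
      exact .inr ⟨hk _ d δ' (.inl hpc) hk' rfl, a, c₁, d, rfl, h1, hac.dom, h2, h3, h4,
        .inl ⟨_, hpc⟩⟩
  | completeUndo d δ' _ v =>
    obtain ⟨r, hra, hr, -⟩ := hH.pred_completeUndo hpc
    obtain ⟨rfl, c₁, h1, h2, h3, h4⟩ := key r d δ' hr hra.1 (by have := hra.2; omega)
    cases hc with
    | loop _ _ hk => cases hk
    | completeUndo _ _ _ _ hk' =>
      exact .inr ⟨hk _ d δ' (.inr hpc) hk' rfl, a, c₁, d, rfl, h1, hac.dom, h2, h3, h4,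
        .inr ⟨_, hpc⟩⟩
  | rreadDone | rcasDone => cases hc; rename_i hk; cases hk
  | rwriteDone | rreadc | rcasc | rwritec | rallocC | rallocD => cases hc; rename_i hk; cases hk

/-- By the time at which the owner of a descriptor finishes `complete`, the descriptor has been
removed. -/
theorem PairDen.pos_le (hH : H.IsExecution) {x : Ev} {d : Ptr} {δ : Desc Ptr Dat}
    {k : Pc Ptr Dat} {r c₁ c₂ a : H.Rp} (h : PairDen H x d δ k r c₁ c₂) (ha : a ∈ H.dom)
    (hlt : H.pos c₁ < H.pos a)
    (hpc : (∃ k, H.pc a = .completeSucc d δ k) ∨ ∃ k, H.pc a = .completeUndo d δ k) :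
    H.pos c₂ ≤ H.pos a := by
  by_contra! hcon
  have hp := h.pairSpan hH
  have h1 := hp.between (H.pos a) hlt hcon.le
  have h2 := hp.between (H.pos a + 1) (by omega) hcon
  obtain ⟨c, hc⟩ := ha
  have hvals : ∀ v ∈ (Call.rdcss δ).vals, ¬ v.isRdesc :=
    fun v => hH.not_rdesc_of_mem_vals (h.call hH)
  -- Between `c₁` and `c₂` the CAS `a` would find `d`, and so replace it.
  have contra : ∀ n, H.op a = some (.cas δ.pt2 (.ptr d) n) →
      (c = .word (.ptr d) → H.Stores a δ.pt2 (.word n)) → n ∈ (Call.rdcss δ).vals → False := by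
    intro n hop hst hn
    have h3 := (hH.heap_cas hop hc).1
    rw [h1, Option.some.injEq] at h3
    have h4 := hH.heap_stores (hst h3.symm)
    rw [h2] at h4
    cases h4
    exact hvals _ hn hp.rdesc
  rcases hpc with ⟨k', hpc⟩ | ⟨k', hpc⟩
  · refine contra δ.new2 (by rw [op_eq, hpc]; rfl) ?_ (by simp [Call.vals])
    rintro rfl
    exact ⟨_, hc, by rw [hpc]; constructor⟩
  · refine contra δ.exp2 (by rw [op_eq, hpc]; rfl) ?_ (by simp [Call.vals])
    rintro rfl
    exact ⟨_, hc, by rw [hpc]; constructor⟩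

/-- The first rep event that stores into `pt2` after a descriptor pointer has been put there is the
final CAS of a run of `complete` for this descriptor. -/
theorem complete_of_stores (hH : H.IsExecution) {c₁ b : H.Rp} {d : Ptr} {δ : Desc Ptr Dat}
    {o : Cell Ptr Dat} (hpc : H.pc c₁ = .rdcssCas d δ)
    (hb : H.Stores b δ.pt2 o) (hheap : hH.heap (H.pos b) δ.pt2 = some (.word (.ptr d))) :
    ((∃ k, H.pc b = .completeSucc d δ k) ∨ ∃ k, H.pc b = .completeUndo d δ k) ∧
      H.Out b (.word (.ptr d)) := by
  have hd := hH.rdesc_of_rdcssCas hpc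
  obtain ⟨i, -, hi, hio, -⟩ := hH.alloc_of_rdcssCas hpc
  have hkind := (hH.client_of_mem_ptrs (hH.call_of_pc (a := c₁) (C := .rdcss δ)
    (by rw [hpc]; rfl)) (q := (δ.pt2, .dptr)) (by simp [Call.ptrs])).2
  have hcptr : ∀ C, (H.pc b).caller = some C → (δ.pt2, .cptr) ∉ C.ptrs := by
    intro C hC hm
    have := (hH.client_of_mem_ptrs (hH.call_of_pc hC) hm).2
    simp only [hkind, reduceCtorEq] at this
  have hvals : ∀ C, (H.pc b).caller = some C → (.ptr d : Word Ptr Dat) ∉ C.vals :=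
    fun C hC hm => hH.not_rdesc_of_mem_vals (hH.call_of_pc hC) hm hd
  have hwv : ∀ p v old, H.pc b = .rwriteCas p v old → old ≠ .ptr d := by
    rintro p v old h rfl
    exact hH.rwriteCas_old_val h hd
  have hhelp : ∀ d' δ', (H.pc b).helps = some (d', δ') → d' = d → δ' = δ := by
    rintro d' δ' h rfl
    obtain ⟨j, hj, hjo, -⟩ := hH.alloc_of_helps h
    exact (hH.rdcssAlloc_unique hj hjo hi hio).2
  obtain ⟨c, hc, hm⟩ := hb
  have hcas : ∀ e n, H.op b = some (.cas δ.pt2 e n) → c = .word (.ptr d) := by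
    intro e n hop
    have := (hH.heap_cas hop hc).1
    rw [hheap, Option.some.injEq] at this
    exact this.symm
  have halloc : ¬ H.Allocs b δ.pt2 := by
    intro ha
    rw [(hH.heap_allocs ha).1] at hheap
    cases hheap
  unfold Allocs at halloc
  rw [op_eq] at hcas halloc
  generalize hp : δ.pt2 = p at *
  generalize H.pc b = pcb at *
  cases hm with
  | rdcssAlloc | rallocC | rallocD => exact absurd ⟨⟨_, _, rfl⟩, hc⟩ halloc
  | rdcssCas d' δ' =>
    exact absurd (by simp [Call.vals, ← Cell.word.inj (hcas _ _ rfl)]) (hvals _ rfl)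
  | completeSucc d' δ' k =>
    have := hcas _ _ rfl
    cases this
    obtain rfl := hhelp _ _ rfl rfl
    exact ⟨.inl ⟨k, rfl⟩, hc⟩
  | completeUndo d' δ' k =>
    have := hcas _ _ rfl
    cases this
    obtain rfl := hhelp _ _ rfl rfl
    exact ⟨.inr ⟨k, rfl⟩, hc⟩
  | rcasCas p e n =>
    cases hcas _ _ rfl
    exact absurd (by simp [Call.vals]) (hvals _ rfl)
  | rwriteCas p v old =>
    cases hcas _ _ rfl
    exact absurd rfl (hwv _ _ _ rfl)
  | rcascCas p e n =>
    cases hcas _ _ rfl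
    exact absurd (by simp [Call.vals]) (hvals _ rfl)
  | rwritecWrite p v => exact absurd (by simp [Call.ptrs]) (hcptr _ rfl)

/-- If some run of `complete(d)` has finished, then the descriptor has been removed. -/
theorem exists_span_of_finished (hH : H.IsExecution) {c₁ a : H.Rp} {d : Ptr} {δ : Desc Ptr Dat}
    (hpc : H.pc c₁ = .rdcssCas d δ) (ho : H.Out c₁ (.word δ.exp2)) (ha : a ∈ H.dom)
    (hlt : H.pos c₁ < H.pos a)
    (hpa : (∃ k, H.pc a = .completeSucc d δ k) ∨ ∃ k, H.pc a = .completeUndo d δ k) :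
    ∃ c₂, H.IsSpan δ.pt2 (c₁, c₂) := by
  have h0 := hH.heap_stores (stores_rdcssCas hpc ho)
  -- If nothing had been stored before `a`, the CAS `a` would find `d` and succeed.
  have hex : ∃ n b o, H.Stores b δ.pt2 o ∧ H.pos b = n ∧ H.pos c₁ < n := by
    by_contra! hcon
    have h1 : hH.heap (H.pos a) δ.pt2 = some (.word (.ptr d)) := by
      rw [← h0]
      refine hH.heap_eq_of_no_store hlt fun b o hb h => ?_
      have := hcon _ b o hb rfl
      omega
    obtain ⟨c, hc⟩ := ha
    have h2 : ∃ o, H.Stores a δ.pt2 o := by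
      rcases hpa with ⟨k, hpa⟩ | ⟨k, hpa⟩
      · have h3 := (hH.heap_cas (e := .ptr d) (n := δ.new2) (by rw [op_eq, hpa]; rfl) hc).1
        rw [h1] at h3
        cases h3
        exact ⟨_, _, hc, by rw [hpa]; constructor⟩
      · have h3 := (hH.heap_cas (e := .ptr d) (n := δ.exp2) (by rw [op_eq, hpa]; rfl) hc).1
        rw [h1] at h3
        cases h3
        exact ⟨_, _, hc, by rw [hpa]; constructor⟩
    obtain ⟨o, h2⟩ := h2
    have := hcon _ a o h2 rfl
    omega
  classical
  obtain ⟨b, o, hb, hbn, hbl⟩ := Nat.find_spec hex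
  have hmin : ∀ b' o', H.Stores b' δ.pt2 o' → H.pos b' < H.pos b → H.pos b' ≤ H.pos c₁ := by
    intro b' o' hb' hlt'
    by_contra! hcon
    exact Nat.find_min hex (hbn ▸ hlt') ⟨b', o', hb', rfl, hcon⟩
  have hbl' : H.pos c₁ < H.pos b := by rw [hbn]; exact hbl
  have hheap : hH.heap (H.pos b) δ.pt2 = some (.word (.ptr d)) := by
    rw [← h0]
    refine hH.heap_eq_of_no_store hbl' fun b' o' hb' h => ?_
    have := hmin b' o' hb' h.2
    omega
  obtain ⟨h1, h2⟩ := hH.complete_of_stores hpc hb hheap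
  exact ⟨b, hH.isSpan_of_last_store hpc ho hbl' hmin h1 h2⟩

end IsExecution

end History

namespace History

variable {Ptr Dat Thr Ev : Type*} {H : History Ptr Dat Thr Ev}

theorem mem_pair {a b : H.Rp × H.Rp} {P : H.Rp × H.Rp → Prop} (ha : P a) (hb : P b) :
    ∀ s ∈ ({a, b} : Set (H.Rp × H.Rp)), P s := by
  rintro s (rfl | rfl)
  · exact ha
  · exact hb

variable [PtrTags Ptr]

namespace IsExecution

/-! ### The span axioms -/

/-- A terminated event has a denotation, with the output of the event. -/
theorem exists_den_of_out (hH : H.IsExecution) {x : Ev} {w : Word Ptr Dat}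
    (ho : H.out x = some w) : ∃ S, H.IsDen x (S, some w) := by
  have hkind : ∀ {C}, H.call x = C → ∀ q k, (q, k) ∈ C.ptrs → PtrTags.kind q = k :=
    fun hC q k hm => (hH.client_of_mem_ptrs hC hm).2
  have hclient : ∀ {C}, H.call x = C → ∀ q k, (q, k) ∈ C.ptrs → H.Client q :=
    fun hC q k hm => (hH.client_of_mem_ptrs hC hm).1
  cases hx : H.call x with
  | rdcss δ =>
    rcases hH.last_of_rdcss hx ho with ⟨a, d, rfl, hpc, hao, hne, hv⟩ |
      ⟨rfl, a, c₁, d, rfl, h1, ha, hpc, hco, hlt, hpa⟩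
    · obtain ⟨i, hi, hpi, hio, -⟩ := hH.alloc_of_rdcssCas hpc
      have hl : H.line a = some .rdcssCas := by rw [line_eq, hpc]; rfl
      have hop : H.op a = some (.cas δ.pt2 δ.exp2 (.ptr d)) := by rw [op_eq, hpc]; rfl
      exact ⟨_, .rdcssFail δ d i a w hx hi (by rw [line_eq, hpi]; rfl) (by rw [op_eq, hpi]; rfl)
        hio (.rdcssFail a (hkind hx _ _ (by simp [Call.ptrs])) hl ⟨w, hao, hv⟩
          ⟨_, _, hop, w, hne, hao⟩) hl hop hao hne⟩
    · obtain ⟨c₂, hs⟩ := hH.exists_span_of_finished hpc hco ha hlt hpa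
      rcases hH.span_shape hs with ⟨b, hb, h2, -⟩ | ⟨d', δ', hp⟩
      · cases hb
        obtain ⟨e, n, hf⟩ := h2 (by rw [line_eq, hpc]; rfl)
        exact absurd (.inl (.inl ⟨δ.exp2, .ptr d, by rw [op_eq, hpc]; rfl, hco⟩))
          (hH.not_writes_of_casFail hf δ.pt2)
      · have h2 := hp.pc
        rw [hpc] at h2
        cases h2
        obtain ⟨k, r, hd⟩ := hH.exists_pairDen hs hp
        rw [h1] at hd
        exact ⟨_, hd.isDen hH⟩
  | ralloc v k =>
    obtain ⟨i, hi, hio, hpc⟩ := hH.last_of_ralloc hx ho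
    have halloc : ∃ c k, H.op i = some (.alloc c k) := by
      rcases hpc with ⟨hpc, -⟩ | ⟨hpc, -⟩ <;> rw [op_eq, hpc] <;> exact ⟨_, _, rfl⟩
    obtain ⟨c, k', hop⟩ := halloc
    obtain ⟨p, hp, -⟩ := hH.heap_alloc hop hio
    cases hp
    obtain ⟨j, -, hj⟩ := hH.aspan_of_ralloc hx ho
    obtain ⟨j', hj', hja, -⟩ := hj.2
    cases hj'
    obtain rfl : j = i := hH.allocs_unique hja ⟨⟨c, k', hop⟩, hio⟩
    have ht := terminated_of_out ho
    rcases hpc with ⟨hpc, rfl⟩ | ⟨hpc, rfl⟩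
    · exact ⟨_, .rallocC v _ p j hx ht ho hj.1 hi (by rw [line_eq, hpc]; rfl)
        (by rw [op_eq, hpc]; rfl) hio⟩
    · exact ⟨_, .rallocD v _ p j hx ht ho hj.1 hi (by rw [line_eq, hpc]; rfl)
        (by rw [op_eq, hpc]; rfl) hio⟩
  | rread p =>
    obtain ⟨a, rfl, c, hac, hn⟩ := hH.exists_last ho
    have hc := hH.codePc a
    have hln := H.line_eq a
    have hop := H.op_eq a
    rw [hx] at hc
    generalize hpc : H.pc a = pca at hc hn hln hop
    cases hn with
    | rreadDone q _ hv =>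
      cases hc with
      | loop _ _ hk =>
        cases hk
        exact ⟨_, .rread p a w hx (.rread a (hkind hx _ _ (List.mem_singleton.2 rfl)) hln
          ⟨w, hac, hv⟩ hop) rfl hln hop hac⟩
    | _ => cases hc <;> rename_i hk <;> cases hk
  | rcas p e n =>
    obtain ⟨a, rfl, c, hac, hn⟩ := hH.exists_last ho
    have hc := hH.codePc a
    have hln := H.line_eq a
    have hop := H.op_eq a
    rw [hx] at hc
    generalize hpc : H.pc a = pca at hc hn hln hop
    cases hn with
    | rcasDone _ _ _ _ hv =>
      cases hc with
      | loop _ _ hk =>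
        cases hk
        exact ⟨_, .rcas p e n a w hx (.rcas a (hkind hx _ _ (List.mem_singleton.2 rfl)) hln
          ⟨w, hac, hv⟩ ⟨e, n, hop⟩) rfl hln hop hac⟩
    | _ => cases hc <;> rename_i hk <;> cases hk
  | rwrite p v =>
    obtain ⟨a, rfl, c, hac, hn⟩ := hH.exists_last ho
    have hc := hH.codePc a
    have hln := H.line_eq a
    have hop := H.op_eq a
    rw [hx] at hc
    generalize hpc : H.pc a = pca at hc hn hln hop
    cases hn with
    | rwriteDone _ _ old _ hv =>
      cases hc with
      | loop _ _ hk => cases hk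
      | rwriteCas =>
        subst hv
        obtain ⟨r, hra, hr, hro⟩ := hH.pred_rwriteCas hpc
        have hrop : H.op r = some (.deref p) := by rw [op_eq, hr]; rfl
        refine ⟨_, .rwrite p v _ r a hx (hH.wspan_of_stores (v := v)
          (hclient hx _ _ (List.mem_singleton.2 rfl)) ⟨_, hac, ?_⟩ (by simp [hln, Pc.line])
          (by simp [hln, Pc.line]) (by simp [hln, Pc.line])) rfl (by rw [line_eq, hr]; rfl) hrop hro
          hln hop (hH.lastRead_of_nextRep hra hrop)⟩
        rw [hpc]
        constructor
    | _ => cases hc <;> rename_i hk <;> cases hk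
  | rreadc p =>
    obtain ⟨a, rfl, c, hac, hn⟩ := hH.exists_last ho
    have hc := hH.codePc a
    have hln := H.line_eq a
    have hop := H.op_eq a
    rw [hx] at hc
    generalize hpc : H.pc a = pca at hc hn hln hop
    cases hn with
    | rreadc =>
      cases hc with
      | loop _ _ hk => cases hk
      | rreadc =>
        exact ⟨_, .rreadc p a w hx (.rreadc a (hkind hx _ _ (List.mem_singleton.2 rfl)) hln
          hac.dom hop) rfl hln hop hac⟩
    | _ => cases hc <;> rename_i hk <;> cases hk
  | rcasc p e n =>
    obtain ⟨a, rfl, c, hac, hn⟩ := hH.exists_last ho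
    have hc := hH.codePc a
    have hln := H.line_eq a
    have hop := H.op_eq a
    rw [hx] at hc
    generalize hpc : H.pc a = pca at hc hn hln hop
    cases hn with
    | rcasc =>
      cases hc with
      | loop _ _ hk => cases hk
      | rcasc =>
        exact ⟨_, .rcasc p e n a w hx (.rcasc a (hkind hx _ _ (List.mem_singleton.2 rfl)) hln
          hac.dom ⟨e, n, hop⟩) rfl hln hop hac⟩
    | _ => cases hc <;> rename_i hk <;> cases hk
  | rwritec p v =>
    obtain ⟨a, rfl, c, hac, hn⟩ := hH.exists_last ho
    have hc := hH.codePc a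
    have hln := H.line_eq a
    have hop := H.op_eq a
    rw [hx] at hc
    generalize hpc : H.pc a = pca at hc hn hln hop
    cases hn with
    | rwritec =>
      cases hc with
      | loop _ _ hk => cases hk
      | rwritec =>
        refine ⟨_, .rwritec p v a hx (hH.wspan_of_stores (v := v)
          (hclient hx _ _ (List.mem_singleton.2 rfl)) ⟨_, hac, ?_⟩ (by simp [hln, Pc.line])
          (by simp [hln, Pc.line]) (by simp [hln, Pc.line])) rfl hln hop⟩
        rw [hpc]
        constructor
    | _ => cases hc <;> rename_i hk <;> cases hk

theorem pt1_ne_pt2 (hH : H.IsExecution) {x : Ev} {δ : Desc Ptr Dat} (hx : H.call x = .rdcss δ) :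
    δ.pt1 ≠ δ.pt2 := by
  intro h
  have h1 := (hH.client_of_mem_ptrs hx (q := (δ.pt1, .cptr)) (by simp [Call.ptrs])).2
  have h2 := (hH.client_of_mem_ptrs hx (q := (δ.pt2, .dptr)) (by simp [Call.ptrs])).2
  simp only [h, h2, reduceCtorEq] at h1

theorem heap_of_span (hH : H.IsExecution) {p : Ptr} {s : H.Rp × H.Rp} {v : Word Ptr Dat}
    (ho : H.Out s.1 (.word v))
    (hop : H.op s.1 = some (.deref p) ∨ ∃ e n, H.op s.1 = some (.cas p e n)) :
    hH.heap (H.pos s.1) p = some (.word v) := by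
  rcases hop with hop | ⟨e, n, hop⟩
  · exact hH.heap_deref hop ho
  · exact (hH.heap_cas hop ho).1

/-- Values found by a single span are client values. -/
theorem val_of_span (hH : H.IsExecution) {p : Ptr} {c : H.Rp} {v : Word Ptr Dat}
    (hs : H.IsSpan p (c, c)) (ho : H.Out c (.word v))
    (hop : H.op c = some (.deref p) ∨ ∃ e n, H.op c = some (.cas p e n)) : ¬ v.isRdesc := by
  intro hv
  cases v with
  | tt | dat => exact hv
  | ptr d =>
    have hheap := hH.heap_of_span (s := (c, c)) ho hop
    rcases hH.span_shape hs with ⟨b, hb, -, -, -, h⟩ | ⟨d', δ', hp⟩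
    · cases hb
      cases hk : PtrTags.kind p with
      | cptr => exact hH.val_of_cptr hk hheap hv
      | dptr => exact h hk d hv hheap
    · exact absurd hp.lt (lt_irrefl _)

theorem not_wspan_of_deref (hH : H.IsExecution) {p q : Ptr} {s : H.Rp × H.Rp}
    (h : H.op s.2 = some (.deref q)) : s ∉ H.wspansR p := by
  intro hs
  obtain ⟨⟨v, hv⟩, -⟩ := hH.stores_of_wspan hs
  rcases stores_iff.1 ⟨_, hv⟩ with (⟨e, n, h1, -⟩ | ⟨w, h1, -⟩) | ⟨⟨c, k, h1⟩, -⟩ <;>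
    rw [h] at h1 <;> cases h1

/-- An `rdcss` event whose descriptor has been in memory observes a writer of the control word that
it has read, and a writer of the expected data word. -/
theorem PairDen.exists_obs (hH : H.IsExecution) {x : Ev} {d : Ptr} {δ : Desc Ptr Dat}
    {k : Pc Ptr Dat} {r c₁ c₂ : H.Rp} (h : PairDen H x d δ k r c₁ c₂) {v : Word Ptr Dat}
    (hv : H.Out r (.word v)) :
    (∃ z, H.obs H.spanR δ.pt1 z x ∧ H.writer z δ.pt1 v) ∧
      ∃ z, H.obs H.spanR δ.pt2 z x ∧ H.writer z δ.pt2 δ.exp2 := by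
  have hop : H.op r = some (.deref δ.pt1) := by rw [op_eq, h.read]; rfl
  have hr := h.isSpan_read hH
  exact ⟨hH.exists_obs (h.isDen hH) (s := (r, r)) (.inl rfl) hr
      (hH.val_of_span hr hv (.inl hop)) (hH.heap_deref hop hv),
    hH.exists_obs (h.isDen hH) (s := (c₁, c₂)) (.inr rfl) h.span (h.pairSpan hH).val
      (h.pairSpan hH).before⟩

theorem PairDen.writes_iff (hH : H.IsExecution) {x : Ev} {d : Ptr} {δ : Desc Ptr Dat}
    {k : Pc Ptr Dat} {r c₁ c₂ : H.Rp} (h : PairDen H x d δ k r c₁ c₂) (p : Ptr) :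
    (p = δ.pt2 ∧ ∃ z₁ z₂, H.obs H.spanR δ.pt1 z₁ x ∧ H.obs H.spanR δ.pt2 z₂ x ∧
        H.writer z₁ δ.pt1 δ.exp1 ∧ H.writer z₂ δ.pt2 δ.exp2) ↔
      (({(r, r), (c₁, c₂)} : Set (H.Rp × H.Rp)) ∩ H.wspansR p).Nonempty := by
  have hop : H.op r = some (.deref δ.pt1) := by rw [op_eq, h.read]; rfl
  have hr := h.isSpan_read hH
  rcases h.choice with ⟨h2, hro⟩ | ⟨h2, v, hne, hro⟩
  · constructor
    · rintro ⟨rfl, -⟩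
      exact ⟨(c₁, c₂), .inr rfl, wspan_of_completeSucc h.span h2⟩
    · rintro ⟨s, rfl | rfl, hs⟩
      · exact absurd hs (hH.not_wspan_of_deref hop)
      · obtain ⟨⟨z₁, h3, h4⟩, z₂, h5, h6⟩ := h.exists_obs hH hro
        exact ⟨hH.span_ptr_unique hs.1 h.span, z₁, z₂, h3, h5, h4, h6⟩
  · constructor
    · rintro ⟨-, z₁, z₂, h3, -, h4, -⟩
      refine absurd (hH.eq_of_obs (h.isDen hH) (hH.val_of_span hr hro (.inl hop))
        (mem_pair ?_ ?_) h3 h4).symm hne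
      · exact fun _ => hH.heap_deref hop hro
      · exact fun hs => absurd (hH.span_ptr_unique hs h.span) (hH.pt1_ne_pt2 (h.call hH))
    · rintro ⟨s, rfl | rfl, hs⟩
      · exact absurd hs (hH.not_wspan_of_deref hop)
      · exact absurd (by simp only [line_eq, h2]; rfl) (hH.stores_of_wspan hs).2.2

/-- An event that denotes a single CAS writes iff it observes a writer of the expected word. -/
theorem cas_writes_iff (hH : H.IsExecution) {x : Ev} {q : Ptr} {e n v : Word Ptr Dat} {c : H.Rp}
    (h : H.IsDen x ({(c, c)}, some v)) (hs : H.IsSpan q (c, c))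
    (hop : H.op c = some (.cas q e n)) (ho : H.Out c (.word v)) (p : Ptr) :
    (p = q ∧ ∃ z, H.obs H.spanR q z x ∧ H.writer z q e) ↔
      (({(c, c)} : Set (H.Rp × H.Rp)) ∩ H.wspansR p).Nonempty := by
  have hv := hH.val_of_span hs ho (.inr ⟨e, n, hop⟩)
  have hheap := (hH.heap_cas hop ho).1
  constructor
  · rintro ⟨rfl, z, h1, h2⟩
    obtain rfl : e = v := by
      refine hH.eq_of_obs h hv ?_ h1 h2
      rintro s rfl -
      exact hheap
    exact ⟨(c, c), rfl, hs, .inl ⟨c, rfl, .inl (.inl ⟨e, n, hop, ho⟩)⟩⟩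
  · rintro ⟨s, rfl, hw⟩
    obtain rfl := hH.span_ptr_unique hw.1 hs
    obtain ⟨⟨u, hu⟩, -⟩ := hH.stores_of_wspan hw
    obtain rfl : v = e := by
      rcases stores_iff.1 ⟨_, hu⟩ with (⟨e', n', h1, h2⟩ | ⟨w, h1, -⟩) | ⟨⟨c', k, h1⟩, -⟩ <;>
        simp only [hop] at h1 <;> cases h1
      exact hH.word_unique ho h2
    exact ⟨rfl, hH.exists_obs h (s := (c, c)) rfl hs hv hheap⟩

theorem den_writers (hH : H.IsExecution) {x : Ev}
    {D : Set (H.Rp × H.Rp) × Option (Word Ptr Dat)} (h : H.IsDen x D) (p : Ptr) :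
    x ∈ (H.specR (H.obs H.spanR) (H.sep H.spanR)).writes p ↔ (D.1 ∩ H.wspansR p).Nonempty := by
  have single : ∀ {q : Ptr} {c : H.Rp}, (c, c) ∈ H.wspansR q →
      (p = q ↔ (({(c, c)} : Set (H.Rp × H.Rp)) ∩ H.wspansR p).Nonempty) := by
    intro q c hc
    constructor
    · rintro rfl
      exact ⟨_, rfl, hc⟩
    · rintro ⟨s, rfl, hs⟩
      exact hH.span_ptr_unique hs.1 hc.1
  cases id h with
  | rdcssFail δ d i c v hx hi hil hio hid hc hcl hco hcv hv =>
    simp only [specR, Set.mem_ofPred_eq, hx]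
    constructor
    · rintro ⟨-, z₁, z₂, ⟨b, -, s, ⟨hs, hsp⟩, -⟩, -⟩
      change s ∈ (H.denR x).1 at hs
      rw [hH.den_eq h] at hs
      cases hs
      exact absurd (hH.span_ptr_unique hsp hc) (hH.pt1_ne_pt2 hx)
    · rintro ⟨s, rfl, hs⟩
      exact absurd hcl (hH.stores_of_wspan hs).2.1
  | rdcssSucc δ d i r c₁ c₂ hx hi hil hio hid hr hc hrl hro hc1l hc1o hc2l hc2o hlast =>
    simp only [specR, Set.mem_ofPred_eq, hx]
    obtain ⟨k, hp⟩ := hH.pairDen_of_lastRead hi hil hio hid hc.1 hc1l hc1o (.inl hc2l) hlast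
    exact hp.writes_iff hH p
  | rdcssUndo δ d i r c₁ c₂ hx hi hil hio hid hr hc hrl hro hc1l hc1o hc2l hc2o hlast =>
    simp only [specR, Set.mem_ofPred_eq, hx]
    obtain ⟨k, hp⟩ := hH.pairDen_of_lastRead hi hil hio hid hc hc1l hc1o (.inr hc2l) hlast
    exact hp.writes_iff hH p
  | rread q r v hx hs hr hrl hro hrv | rreadc q r v hx hs hr hrl hro hrv =>
    simp only [specR, Set.mem_ofPred_eq, hx, false_iff]
    rintro ⟨s, rfl, hs⟩
    exact hH.not_wspan_of_deref hro hs
  | rcas q e n c v hx hs hc hcl hco hcv | rcasc q e n c v hx hs hc hcl hco hcv =>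
    simp only [specR, Set.mem_ofPred_eq, hx]
    exact hH.cas_writes_iff h hs hco hcv p
  | rwrite q v w r c hx hs =>
    simp only [specR, Set.mem_ofPred_eq, hx]
    exact single hs
  | rwritec q v c hx hs =>
    simp only [specR, Set.mem_ofPred_eq, hx]
    exact single hs
  | rallocC v w q i hx ht hq hs | rallocD v w q i hx ht hq hs =>
    simp only [specR, Set.mem_ofPred_eq, hx, ← single hs, hq, Option.some.injEq, Word.ptr.injEq]
    exact ⟨fun h => h.2.symm, fun h => ⟨ht, h.symm⟩⟩

theorem out_of_alloc_span {p : Ptr} {c : H.Rp} (hs : H.IsSpan p (c, c))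
    (hl : H.line c = some .rallocC ∨ H.line c = some .rallocD) : H.Out c (.word (.ptr p)) := by
  cases hs <;> simp_all

theorem den_allocators (hH : H.IsExecution) {x : Ev}
    {D : Set (H.Rp × H.Rp) × Option (Word Ptr Dat)} (h : H.IsDen x D) (p : Ptr) :
    x ∈ (H.specR (H.obs H.spanR) (H.sep H.spanR)).allocs p ↔ (D.1 ∩ H.aspansR p).Nonempty := by
  have no : ∀ {S : Set (H.Rp × H.Rp)}, (∀ v k, H.call x ≠ .ralloc v k) →
      (∀ s ∈ S, H.line s.2 ≠ some .rallocC ∧ H.line s.2 ≠ some .rallocD) →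
      (x ∈ (H.specR (H.obs H.spanR) (H.sep H.spanR)).allocs p ↔ (S ∩ H.aspansR p).Nonempty) := by
    intro S h1 h2
    constructor
    · rintro ⟨⟨v, k, hc⟩, -⟩
      exact absurd hc (h1 v k)
    · rintro ⟨s, hs, -, b, rfl, -, hl | hl⟩
      · exact absurd hl (h2 _ hs).1
      · exact absurd hl (h2 _ hs).2
  have alloc : ∀ {v k q i}, H.call x = .ralloc v k → H.fin x ≠ none → H.out x = some (.ptr q) →
      (i, i) ∈ H.wspansR q → H.line i = some .rallocC ∨ H.line i = some .rallocD →
      (x ∈ (H.specR (H.obs H.spanR) (H.sep H.spanR)).allocs p ↔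
        (({(i, i)} : Set (H.Rp × H.Rp)) ∩ H.aspansR p).Nonempty) := by
    intro v k q i hx ht hq hs hl
    constructor
    · rintro ⟨-, -, hp⟩
      rw [hq] at hp
      cases hp
      refine ⟨_, rfl, hs, i, rfl, allocs_of_line hl (out_of_alloc_span hs.1 hl), hl⟩
    · rintro ⟨s, rfl, hs'⟩
      obtain rfl := hH.span_ptr_unique hs'.1.1 hs.1
      exact ⟨⟨v, k, hx⟩, ht, hq⟩
  cases h with
  | rdcssFail δ d i c v hx hi hil hio hid hc hcl => exact no (by simp [hx]) (by simp [hcl])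
  | rdcssSucc δ d i r c₁ c₂ hx hi hil hio hid hr hc hrl hro hc1l hc1o hc2l =>
    exact no (by simp [hx]) (by simp [hrl, hc2l])
  | rdcssUndo δ d i r c₁ c₂ hx hi hil hio hid hr hc hrl hro hc1l hc1o hc2l =>
    exact no (by simp [hx]) (by simp [hrl, hc2l])
  | rread q r v hx hs hr hrl | rreadc q r v hx hs hr hrl =>
    exact no (by simp [hx]) (by simp [hrl])
  | rcas q e n c v hx hs hc hcl | rcasc q e n c v hx hs hc hcl =>
    exact no (by simp [hx]) (by simp [hcl])
  | rwrite q v w r c hx hs hc hrl hro hrv hcl => exact no (by simp [hx]) (by simp [hcl])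
  | rwritec q v c hx hs hc hcl => exact no (by simp [hx]) (by simp [hcl])
  | rallocC v w q i hx ht hq hs hi hil => exact alloc hx ht hq hs (.inl hil)
  | rallocD v w q i hx ht hq hs hi hil => exact alloc hx ht hq hs (.inr hil)

/-- The output of a denotation is a client value and satisfies the postcondition. -/
theorem den_post (hH : H.IsExecution) {x : Ev}
    {D : Set (H.Rp × H.Rp) × Option (Word Ptr Dat)} (h : H.IsDen x D) :
    ∃ v, D.2 = some v ∧ ¬ v.isRdesc ∧
      (H.specR (H.obs H.spanR) (H.sep H.spanR)).post x v := by
  have single : ∀ {q : Ptr} {c : H.Rp} {v : Word Ptr Dat}, H.IsDen x ({(c, c)}, some v) →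
      H.IsSpan q (c, c) → H.Out c (.word v) →
      (H.op c = some (.deref q) ∨ ∃ e n, H.op c = some (.cas q e n)) →
      ¬ v.isRdesc ∧ ∃ z, H.obs H.spanR q z x ∧ H.writer z q v := by
    intro q c v hD hs ho hop
    have hv := hH.val_of_span hs ho hop
    exact ⟨hv, hH.exists_obs hD (s := (c, c)) rfl hs hv (hH.heap_of_span (s := (c, c)) ho hop)⟩
  have pair : ∀ {d δ k r c₁ c₂}, PairDen H x d δ k r c₁ c₂ → ¬ δ.exp2.isRdesc ∧
      ∃ z₂, H.obs H.spanR δ.pt2 z₂ x ∧ H.writer z₂ δ.pt2 δ.exp2 ∧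
        (δ.exp2 = δ.exp2 → ∃ z₁, H.obs H.spanR δ.pt1 z₁ x) := by
    intro d δ k r c₁ c₂ hp
    obtain ⟨v, hv⟩ : ∃ v, H.Out r (.word v) := by
      rcases hp.choice with ⟨-, ho⟩ | ⟨-, v, -, ho⟩ <;> exact ⟨_, ho⟩
    obtain ⟨⟨z₁, h1, -⟩, z₂, h2, h3⟩ := hp.exists_obs hH hv
    exact ⟨(hp.pairSpan hH).val, z₂, h2, h3, fun _ => ⟨z₁, h1⟩⟩
  have alloc : ∀ {v k q i w}, H.call x = .ralloc v k → H.fin x ≠ none →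
      H.out x = some (.ptr q) → i.1 = x → H.IsSpan q (i, i) → H.Out i (.word w) →
      H.line i = some .rallocC ∨ H.line i = some .rallocD →
      ¬ w.isRdesc ∧ H.fin x ≠ none ∧ H.out x = some w := by
    intro v k q i w hx ht hq hi hs ho hl
    obtain rfl := hH.word_unique ho (out_of_alloc_span hs hl)
    exact ⟨hH.not_rdesc_of_client (hH.client_of_span hs), ht, hq⟩
  cases id h with
  | rdcssFail δ d i c v hx hi hil hio hid hc hcl hco hcv hv =>
    simp only [specR, hx]
    obtain ⟨h1, z, h2, h3⟩ := single h hc hcv (.inr ⟨_, _, hco⟩)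
    exact ⟨v, rfl, h1, z, h2, h3, fun h => absurd h hv⟩
  | rdcssSucc δ d i r c₁ c₂ hx hi hil hio hid hr hc hrl hro hc1l hc1o hc2l hc2o hlast =>
    simp only [specR, hx]
    obtain ⟨k, hp⟩ := hH.pairDen_of_lastRead hi hil hio hid hc.1 hc1l hc1o (.inl hc2l) hlast
    exact ⟨_, rfl, pair hp⟩
  | rdcssUndo δ d i r c₁ c₂ hx hi hil hio hid hr hc hrl hro hc1l hc1o hc2l hc2o hlast =>
    simp only [specR, hx]
    obtain ⟨k, hp⟩ := hH.pairDen_of_lastRead hi hil hio hid hc hc1l hc1o (.inr hc2l) hlast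
    exact ⟨_, rfl, pair hp⟩
  | rread q r v hx hs hr hrl hro hrv | rreadc q r v hx hs hr hrl hro hrv =>
    simp only [specR, hx]
    exact ⟨v, rfl, single h hs hrv (.inl hro)⟩
  | rcas q e n c v hx hs hc hcl hco hcv | rcasc q e n c v hx hs hc hcl hco hcv =>
    simp only [specR, hx]
    exact ⟨v, rfl, single h hs hcv (.inr ⟨_, _, hco⟩)⟩
  | rwrite q v w r c hx hs =>
    simp only [specR, hx]
    exact ⟨_, rfl, id, rfl⟩
  | rwritec q v c hx hs =>
    simp only [specR, hx]
    exact ⟨_, rfl, id, rfl⟩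
  | rallocC v w q i hx ht hq hs hi hil hio hiw =>
    simp only [specR, hx]
    exact ⟨w, rfl, alloc hx ht hq hi hs.1 hiw (.inl hil)⟩
  | rallocD v w q i hx ht hq hs hi hil hio hiw =>
    simp only [specR, hx]
    exact ⟨w, rfl, alloc hx ht hq hi hs.1 hiw (.inr hil)⟩

theorem den_bunching (hH : H.IsExecution) {x : Ev}
    {D : Set (H.Rp × H.Rp) × Option (Word Ptr Dat)} (h : H.IsDen x D) :
    ∀ b ∈ D.1, ∀ c ∈ D.1, H.le b.1 c.2 := by
  cases hH.denShape h with
  | single c p v hc hs hf hl hr =>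
    rintro _ rfl _ rfl
    exact .inr ⟨rfl, (span_dom hs).1⟩
  | pair d δ k r c₁ c₂ hp =>
    obtain ⟨h1, h2⟩ := hp.pos_lt hH
    obtain ⟨h3, h4⟩ := span_dom hp.span
    refine mem_pair (mem_pair ?_ ?_) (mem_pair ?_ ?_) <;> rw [hH.le_iff]
    · exact ⟨hp.dom, hp.dom, le_rfl⟩
    · exact ⟨hp.dom, h4, h2.le⟩
    · exact ⟨h3, hp.dom, h1.le⟩
    · exact ⟨h3, h4, by simp only; omega⟩

theorem den_starts_within (hH : H.IsExecution) {x : Ev}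
    {D : Set (H.Rp × H.Rp) × Option (Word Ptr Dat)} (h : H.IsDen x D) :
    ∀ b ∈ D.1, H.start x ≤ H.rstart b.1 := by
  cases hH.denShape h with
  | single c p v hc hs hf hl hr =>
    rintro _ rfl
    rw [← hc]
    exact (hH.start_lt c).le
  | pair d δ k r c₁ c₂ hp =>
    refine mem_pair ?_ ?_
    · obtain ⟨i, hi, hio, hlt⟩ := hH.alloc_of_helps (a := r) (d := d) (δ := δ)
        (by rw [hp.read]; rfl)
      obtain ⟨j, hjc, hj, hjo, -⟩ := hH.alloc_of_rdcssCas hp.pc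
      obtain ⟨rfl, -⟩ := hH.rdcssAlloc_unique hi hio hj hjo
      have := hH.start_lt i
      rw [hjc, hp.fst] at this
      simp only
      omega
    · rw [← hp.fst]
      exact (hH.start_lt c₁).le

theorem den_ends_within (hH : H.IsExecution) {x : Ev}
    {D : Set (H.Rp × H.Rp) × Option (Word Ptr Dat)} (h : H.IsDen x D) {t : ℕ}
    (ht : H.fin x = some t) :
    ∀ b ∈ D.1, ∃ i ∈ H.dom, (∃ s, H.rend i = some s ∧ s ≤ t) ∧ H.le b.2 i := by
  cases hH.denShape h with
  | single c p v hc hs hf hl hr =>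
    rintro _ rfl
    subst hc
    exact ⟨c, (span_dom hs).1, hH.finished ht, .inr ⟨rfl, (span_dom hs).1⟩⟩
  | pair d δ k r c₁ c₂ hp =>
    obtain ⟨⟨t', w⟩, hr, -⟩ := Option.map_eq_some_iff.1 ht
    have ho : H.out x = some w := by simp [out, hr]
    have hfin := final_of_rdcssCas hp.pc hp.out (hH.val_of_rdcssCas hp.pc)
    obtain ⟨-, h2⟩ := hp.pos_lt hH
    rcases hH.last_of_rdcss (hp.call hH) ho with ⟨a, d', hax, hpc, hao, hne, hv⟩ |
      ⟨-, a, c, d', hax, hcx, ha, hpc, hco, hlt, hpa⟩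
    · obtain rfl := (final_of_rdcssCas hpc hao hv).eq hH hfin (hax.trans hp.fst.symm)
      exact absurd (hH.word_unique hao hp.out) hne
    · obtain rfl := (final_of_rdcssCas hpc hco (hH.val_of_rdcssCas hpc)).eq hH hfin
        (hcx.trans hp.fst.symm)
      have h1 := hpc
      rw [hp.pc] at h1
      cases h1
      have h3 := hp.pos_le hH ha hlt hpa
      subst hax
      have key : ∀ b ∈ H.dom, H.pos b ≤ H.pos a →
          ∃ i ∈ H.dom, (∃ s, H.rend i = some s ∧ s ≤ t) ∧ H.le b i :=
        fun b hb hle => ⟨a, ha, hH.finished ht, hH.le_iff.2 ⟨hb, ha, hle⟩⟩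
      exact mem_pair (key r hp.dom (by omega)) (key c₂ (span_dom hp.span).2 h3)

theorem aspan_eq (hH : H.IsExecution) {p : Ptr} {b c : H.Rp × H.Rp} (hb : b ∈ H.aspansR p)
    (hc : c ∈ H.aspansR p) : b = c := by
  obtain ⟨-, i, rfl, hi, -⟩ := hb
  obtain ⟨-, j, rfl, hj, -⟩ := hc
  rw [hH.allocs_unique hi hj]

/-- A pointer is allocated before it is accessed. -/
theorem exists_aspan (hH : H.IsExecution) {p : Ptr} {b : H.Rp × H.Rp} (hb : H.IsSpan p b) :
    ∃ c ∈ H.aspansR p, H.sbeforeEq c b := by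
  obtain ⟨i, hi⟩ := hH.client_of_span hb
  obtain ⟨j, hj, hia, -⟩ := hi.2
  cases hj
  refine ⟨_, hi, ?_⟩
  rcases hH.heap_of_accesses (accesses_of_span hb).1 with h | h
  · right
    obtain rfl := hH.allocs_unique hia h
    rcases hH.span_trichotomy hi.1.1 hb with h1 | h1 | h1
    · have := (hH.lt_iff.1 h1).2.2
      simp only [lt_self_iff_false] at this
    · have := (hH.lt_iff.1 h1).2.2
      have := hH.span_pos_le hb
      simp only at *
      omega
    · exact h1
  · exact .inl (hH.lt_iff.2 ⟨hia.2.dom, (span_dom hb).1, hH.allocs_pos_lt hia h⟩)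

theorem implementedBy (hH : H.IsExecution) :
    H.ImplementedBy (H.specR (H.obs H.spanR) (H.sep H.spanR)) H.spanR where
  disjointness _ _ hb _ hc := hH.span_trichotomy hb hc
  bunching _ b hb c hc := hH.den_bunching (isDen_of_nonempty ⟨b, hb⟩) b hb c hc
  adequacy x hx := by
    obtain ⟨⟨t, w⟩, hr⟩ : ∃ r, (H.ev x).resp = some r :=
      Option.ne_none_iff_exists'.1 fun h => hx (by simp [fin, h])
    have ho : H.out x = some w := by simp [out, hr]
    obtain ⟨S, hS⟩ := hH.exists_den_of_out ho
    change (H.denR x).2 = _ ∧ (H.denR x).1.Nonempty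
    rw [hH.den_eq hS, ho]
    refine ⟨rfl, ?_⟩
    generalize hD : (S, some w) = D at hS
    obtain rfl : S = D.1 := by rw [← hD]
    cases hH.denShape hS with
    | single => exact Set.singleton_nonempty _
    | pair => exact Set.insert_nonempty _ _
  first_le_last _ b hb := hH.le_iff.2 ⟨(span_dom hb).1, (span_dom hb).2, hH.span_pos_le hb⟩
  injective _ _ h := by
    obtain ⟨s, hs, hs'⟩ := h
    exact hH.den_injective (isDen_of_nonempty ⟨s, hs⟩) (isDen_of_nonempty ⟨s, hs'⟩) hs hs'
  write_spans_denoted p b hb := by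
    obtain ⟨⟨v, hv⟩, -⟩ := hH.stores_of_wspan hb
    obtain ⟨x, D, hD, hbD, -⟩ := hH.exists_den_of_wspan hb hv
    refine ⟨x, ?_⟩
    change b ∈ (H.denR x).1
    rwa [hH.den_eq hD]
  postcondition x h := by
    obtain ⟨v, h1, -, h2⟩ := hH.den_post (isDen_of_nonempty h)
    exact ⟨v, h1, h2⟩
  writers x p h := hH.den_writers (isDen_of_nonempty h) p
  starts_within x b hb := hH.den_starts_within (isDen_of_nonempty ⟨b, hb⟩) b hb
  ends_within x b hb t ht := hH.den_ends_within (isDen_of_nonempty ⟨b, hb⟩) ht b hb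
  alloc_unique _ _ hb _ hc := hH.aspan_eq hb hc
  allocated _ _ hb := hH.exists_aspan hb
  allocators x p h := hH.den_allocators (isDen_of_nonempty h) p

theorem denR_val (hH : H.IsExecution) {x : Ev} {v : Word Ptr Dat} (h : (H.denR x).2 = some v) :
    ¬ v.isRdesc := by
  have hD : H.IsDen x (H.denR x) := by
    unfold denR at h ⊢
    split at h
    · rename_i hex
      rw [dif_pos hex]
      exact hex.choose_spec
    · cases h
  obtain ⟨w, h1, h2, -⟩ := hH.den_post hD
  rw [h] at h1
  cases h1
  exact h2

theorem denR_encard_le (hH : H.IsExecution) (x : Ev) : (H.denR x).1.encard ≤ 2 := by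
  rcases (H.denR x).1.eq_empty_or_nonempty with h | h
  · simp [h]
  · have hs := hH.denShape (isDen_of_nonempty h)
    generalize H.denR x = D at hs ⊢
    cases hs with
    | single => simp
    | pair => exact (Set.encard_insert_le _ _).trans (by rw [Set.encard_singleton]; norm_num)

end IsExecution

end History

end RDCSS

theorem mainTheorem10 {Ptr Dat Thr Ev : Type*} [RDCSS.PtrTags Ptr]
    (H : RDCSS.History Ptr Dat Thr Ev) (hH : H.IsExecution) :
    H.ImplementedBy (H.specR (H.obs H.spanR) (H.sep H.spanR)) H.spanR ∧
    (∀ x D D', H.IsDen x D → H.IsDen x D' → D = D') ∧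
    (∀ x v, (H.spanR.den x).2 = some v → ¬ v.isRdesc) ∧
    (∀ x δ, H.call x = .rdcss δ → (H.spanR.den x).1.encard ≤ 2) :=
  ⟨hH.implementedBy, fun _ _ _ h h' => hH.isDen_unique h h', fun _ _ h => hH.denR_val h,
    fun x _ _ => hH.denR_encard_le x⟩
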